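/- Let $\mathbb G$ be a filiform group of the first kind of step $s\ge 1$: a simply connected (hence connected) Lie group with a stratification $\mathrm{Lie}(\mathbb G)=V_1\oplus\dots\oplus V_s$ (with $[V_1,V_j]=V_{j+1}$ for $1\le j\le s$, where $V_{s+1}=0$, and $V_s\neq0$) such that $\dim V_1=2$, $\dim V_j=1$ for $2\le j\le s$, which admits a *first-kind basis*, i.e. a basis $X_0,\dots,X_s$ of $\mathrm{Lie}(\mathbb G)$ with $X_0,X_1\in V_1$, $X_j\in V_j$ for $j\ge2$, $[X_0,X_{j-1}]=X_j$ for $2\le j\le s$, and all other brackets of basis vectors equal to zero. Let $\mathrm{vol}$ be a Haar measure on $\mathbb G$. For a measurable set $E\subseteq\mathbb G$ and a left-invariant vector field $X$, write $X\mathbb 1_E\ge0$ (resp. $X\mathbb 1_E=0$) if $-\int_E X\varphi\,d\mathrm{vol}\ge 0$ (resp. $\int_E X\varphi\,d\mathrm{vol}=0$) for all $\varphi\in C_c^\infty(\mathbb G)$ with $\varphi\ge0$. Fix a scalar product $\langle\cdot|\cdot\rangle$ on $V_1$ and let $E$ have constant horizontal normal $N\in V_1$, that is, $N\mathbb 1_E\ge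 0$, and $Y\mathbb 1_E=0$ for every $Y\in V_1$ with $\langle N|Y\rangle=0$. Call two sets equivalent if their symmetric difference has measure zero. Then the following hold. 1. $E$ is equivalent to a Lipschitz domain, i.e. to a set $F$ such that, for some smooth diffeomorphism $f:\mathbb G\to\mathbb R^{s+1}$, $f(F)$ is open and every boundary point of $f(F)$ has a neighbourhood in which $f(F)$ is, in suitable orthonormal coordinates, the upper-graph of a Lipschitz function of $s$ variables. 2. There is a first-kind basis $X_0,\dots,X_s$ such that either (a) $X_0\mathbb 1_E=0$ and $X_1\mathbb 1_E\ge0$, or (b) $X_1\mathbb 1_E=0$ and $X_0\mathbb 1_E\ge0$. 3. For every first-kind basis for which (a) holds and for all distinct $t_1,\dots,t_s\in\mathbb R$, the vectors $Y_j=\mathrm{Ad}_{\exp(t_jX_0)}X_1$ satisfy $Y_j\mathbb 1_E\ge0$, and $X_0,Y_1,\dots,Y_s$ is a basis of $\mathrm{Lie}(\mathbb G)$. 4. If (b) holds for some first-kind basis, then $E$ is equivalent to $\emptyset$, to $\mathbb G$, or to a vertical half-space, i.e. a set $\{p\in\mathbb G:\ell(p)>c\}$ with $c\in\mathbb R$ and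 $\ell:\mathbb G\to(\mathbb R,+)$ a nonzero continuous homomorphism. -/

import Mathlib

open MeasureTheory
open scoped Manifold ContDiff

noncomputable section

namespace Filiform

/-! ### Lipschitz domains -/

/-- A Lipschitz domain of `ℝⁿ`: an open set such that every boundary point has an open neighbourhood
in which the set is, in suitable orthonormal coordinates, the open upper-graph of a Lipschitz
function of `n - 1` variables. Here `ν` is the graphing direction and the function is defined on the
hyperplane orthogonal to `ν`. -/
def IsEuclideanLipschitzDomain {n : ℕ} (Ω : Set (EuclideanSpace ℝ (Fin n))) : Prop :=
  IsOpen Ω ∧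
    ∀ p ∈ frontier Ω,
      ∃ (U : Set (EuclideanSpace ℝ (Fin n))) (ν : EuclideanSpace ℝ (Fin n))
        (h : (ℝ ∙ ν)ᗮ → ℝ) (K : NNReal),
        IsOpen U ∧ p ∈ U ∧ ‖ν‖ = 1 ∧ LipschitzWith K h ∧
          ∀ x ∈ U, x ∈ Ω ↔ h ((ℝ ∙ ν)ᗮ.orthogonalProjectionOnto x) < inner ℝ ν x

variable {n : ℕ} {G : Type*} [TopologicalSpace G] [ChartedSpace (EuclideanSpace ℝ (Fin n)) G]

variable (n) in
/-- A subset of a smooth manifold diffeomorphic to `ℝⁿ` is a Lipschitz domain if its image under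
some (global, smooth) diffeomorphism onto `ℝⁿ` is a Lipschitz domain of `ℝⁿ`. -/
def IsLipschitzDomain (E : Set G) : Prop :=
  ∃ f : G ≃ₘ⟮𝓡 n, 𝓡 n⟯ EuclideanSpace ℝ (Fin n), IsEuclideanLipschitzDomain (f '' E)

variable [Group G]

/-! ### Exponential map and adjoint representation -/

open Classical in
/-- The exponential map of a Lie group: the value at time `1` of the integral curve, starting at the
identity, of the left-invariant vector field determined by `X`. (On a Lie group this curve exists for
all times and is unique; the value `1` in the other branch is never used.) -/
def lieExp (X : GroupLieAlgebra (𝓡 n) G) : G :=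
  if h : ∃ γ : ℝ → G, γ 0 = 1 ∧
      IsMIntegralCurve (I := 𝓡 n) γ (fun p : G => mulInvariantVectorField X p)
  then h.choose 1 else 1

/-- The adjoint representation: `Ad g` is the differential at the identity of `x ↦ g x g⁻¹`. -/
def Ad (g : G) (Y : GroupLieAlgebra (𝓡 n) G) : GroupLieAlgebra (𝓡 n) G :=
  (mfderiv (𝓡 n) (𝓡 n) (fun x : G => g * x * g⁻¹) 1) Y

/-! ### Stratifications and filiform groups of the first kind -/

/-- `V` is a stratification of step `s` of the Lie algebra of `G`: the Lie algebra is the direct sum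
of the strata `V 1, …, V s`, one has `[V 1, V j] = V (j + 1)` for `j ≥ 1` (with `V (s + 1) = 0`), and
`V s ≠ 0`. For convenience `V j = 0` for the indices `j` outside `1, …, s`. -/
structure IsStratification (s : ℕ) (V : ℕ → Submodule ℝ (GroupLieAlgebra (𝓡 n) G)) : Prop where
  isInternal : DirectSum.IsInternal V
  zero : V 0 = ⊥
  eq_bot_of_lt : ∀ j, s < j → V j = ⊥
  last_ne_bot : V s ≠ ⊥
  bracket : ∀ j, 1 ≤ j →
    Submodule.span ℝ {Z | ∃ X ∈ V 1, ∃ Y ∈ V j, Z = ⁅X, Y⁆} = V (j + 1)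

/-- A filiform stratification: `dim V 1 = 2` and `dim V j = 1` for `j = 2, …, s`. -/
structure IsFiliformStratification (s : ℕ) (V : ℕ → Submodule ℝ (GroupLieAlgebra (𝓡 n) G)) : Prop
    extends IsStratification s V where
  finrank_one : Module.finrank ℝ (V 1) = 2
  finrank_of_two_le : ∀ j, 2 ≤ j → j ≤ s → Module.finrank ℝ (V j) = 1

/-- A basis `X 0, …, X s` adapted to the stratification (`X 0, X 1 ∈ V 1` and `X j ∈ V j` for
`j ≥ 2`) with `[X 0, X (j - 1)] = X j` for `j = 2, …, s`, all other brackets of basis vectors being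
zero. -/
structure IsFirstKindBasis (s : ℕ) (V : ℕ → Submodule ℝ (GroupLieAlgebra (𝓡 n) G))
    (X : Module.Basis (Fin (s + 1)) ℝ (GroupLieAlgebra (𝓡 n) G)) : Prop where
  mem_zero : X 0 ∈ V 1
  mem : ∀ j : Fin (s + 1), 1 ≤ j.val → X j ∈ V j.val
  bracket_zero : ∀ i j : Fin (s + 1), 1 ≤ i.val → j.val = i.val + 1 → ⁅X 0, X i⁆ = X j
  bracket_zero_last : ⁅X 0, X (Fin.last s)⁆ = 0
  bracket_eq_zero : ∀ i j : Fin (s + 1), 1 ≤ i.val → 1 ≤ j.val → ⁅X i, X j⁆ = 0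

/-- The stratification `V` of step `s` makes (the simply connected Lie group) `G` a filiform group of
the first kind. -/
def IsFiliformOfFirstKind (s : ℕ) (V : ℕ → Submodule ℝ (GroupLieAlgebra (𝓡 n) G)) : Prop :=
  IsFiliformStratification s V ∧
    ∃ X : Module.Basis (Fin (s + 1)) ℝ (GroupLieAlgebra (𝓡 n) G), IsFirstKindBasis s V X

/-! ### Distributional derivatives of characteristic functions -/

/-- The derivative `Xφ` of `φ` along the left-invariant vector field determined by `X`. -/
def leftDeriv (X : GroupLieAlgebra (𝓡 n) G) (φ : G → ℝ) (p : G) : ℝ :=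
  (mfderiv (𝓡 n) 𝓘(ℝ, ℝ) φ p) (mulInvariantVectorField X p)

variable (n) in
/-- Nonnegative smooth functions with compact support. -/
structure IsTestFunction (φ : G → ℝ) : Prop where
  contMDiff : ContMDiff (𝓡 n) 𝓘(ℝ, ℝ) ∞ φ
  hasCompactSupport : HasCompactSupport φ
  nonneg : ∀ p, 0 ≤ φ p

variable [MeasurableSpace G]

/-- `X 1_E ≥ 0` in the sense of distributions: `X` is a monotone direction of `E`. -/
def IsMonotoneDirection (μ : Measure G) (E : Set G) (X : GroupLieAlgebra (𝓡 n) G) : Prop :=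
  ∀ φ : G → ℝ, IsTestFunction n φ → 0 ≤ -∫ p in E, leftDeriv X φ p ∂μ

/-- `X 1_E = 0` in the sense of distributions: `X` is an invariant direction of `E`. -/
def IsInvariantDirection (μ : Measure G) (E : Set G) (X : GroupLieAlgebra (𝓡 n) G) : Prop :=
  ∀ φ : G → ℝ, IsTestFunction n φ → ∫ p in E, leftDeriv X φ p ∂μ = 0

/-- `E` has constant horizontal normal `X`, an element of the horizontal layer `V₁`, with respect to
the scalar product `B` on `V₁`. -/
def HasConstantHorizontalNormal (μ : Measure G) (V₁ : Submodule ℝ (GroupLieAlgebra (𝓡 n) G))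
    (B : LinearMap.BilinForm ℝ V₁) (E : Set G) (X : V₁) : Prop :=
  IsMonotoneDirection μ E (X : GroupLieAlgebra (𝓡 n) G) ∧
    ∀ Y : V₁, B X Y = 0 → IsInvariantDirection μ E (Y : GroupLieAlgebra (𝓡 n) G)

/-- `E` and `F` are equivalent: their symmetric difference is a null set. -/
def Equivalent (μ : Measure G) (E F : Set G) : Prop :=
  μ (symmDiff E F) = 0

/-- A vertical half-space `{p | ℓ p > c}`, where `ℓ` is a nonzero continuous homomorphism to `(ℝ, +)`.
On a stratified group such `ℓ` are exactly the maps `exp (v₁ + ⋯ + vₛ) ↦ λ v₁` with `vⱼ ∈ Vⱼ` and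
`λ` a nonzero linear functional on the first stratum. -/
def IsVerticalHalfSpace {G : Type*} [TopologicalSpace G] [Group G] (H : Set G) : Prop :=
  ∃ (l : G → ℝ) (c : ℝ), Continuous l ∧ (∀ p q, l (p * q) = l p + l q) ∧ (∃ p, l p ≠ 0) ∧
    H = {p | c < l p}

end Filiform

end

/-! The distributional hypotheses become statements about a closed submonoid of the group.
`growthMonoid` collects the `g` with `∫_E φ(p g) ≤ ∫_E φ` for all test functions, which forces `E g
⊆ E` up to null sets (`ae_imp_mul_mem_of_mem_growthMonoid`). By `isMonotoneDirection_iff`, `X` is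
monotone exactly when `exp (r X)` lies in it for all `r ≥ 0`. An invariant direction contributes a
whole one-parameter subgroup, so conjugating by that subgroup preserves monotone directions.

In case (a) the vectors `Ad_{exp (t X₀)} X₁ = ∑ t^k/k! X_{k+1}` are therefore monotone. Monotone
directions form a convex cone, and by a Vandermonde determinant `s` distinct points of this moment
curve are a basis of the span of `X₁, …, X_s`. Hence the monotone directions in that span have
interior. In case (b), commutators of the group `exp (ℝ X₁)` with `exp (r X₀)`, rescaled as `r →
0+`, put every `exp (a X_k)` in the closed monoid, so `E` depends only on the `X₀`-coordinate and is
an upper set in it.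

In both cases the monoid contains an open set `C` accumulating at the identity along a one-parameter
subgroup. A Fubini argument (`exists_isOpen_ae_eq_of_monotone`) then replaces `E` by an open set `U`
with `U C ⊆ U` everywhere. The coordinates `(x, y) ↦ exp (∑ yⱼ Xⱼ) exp (x X₀)` identify the group
with `ℝ ⋉ ℝˢ`. They turn right multiplication by `C` into Euclidean translation by an open cone, and
an open set stable under such translations is the upper-graph of a Lipschitz function. In case (b)
the first coordinate is a homomorphism, which gives a half-space.

The choice between (a) and (b) is linear algebra in `V 1` (`IsFirstKindBasis.exists_adapted`): (b)
occurs when the line orthogonal to the normal is spanned by `X₁`. -/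

namespace Filiform

open Set Filter Topology

/-! ### Bracket and adjoint representation in the chart at the identity. -/

section LieGroupCalculus

variable {n : ℕ} {G : Type*} [TopologicalSpace G] [ChartedSpace (EuclideanSpace ℝ (Fin n)) G]
  [Group G]

variable (n G) in
/-- The preferred chart at the identity. -/
noncomputable def oneChart : PartialEquiv G (EuclideanSpace ℝ (Fin n)) :=
  extChartAt (𝓡 n) (1 : G)

variable (n G) in
/-- The multiplication read in the preferred chart at the identity. -/
noncomputable def chartMul (q : EuclideanSpace ℝ (Fin n) × EuclideanSpace ℝ (Fin n)) :
    EuclideanSpace ℝ (Fin n) :=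
  oneChart n G ((oneChart n G).symm q.1 * (oneChart n G).symm q.2)

variable (n G) in
/-- The conjugation read in the preferred chart at the identity. -/
noncomputable def chartConj (q : EuclideanSpace ℝ (Fin n) × EuclideanSpace ℝ (Fin n)) :
    EuclideanSpace ℝ (Fin n) :=
  oneChart n G ((oneChart n G).symm q.1 * (oneChart n G).symm q.2 * ((oneChart n G).symm q.1)⁻¹)

/-- The left-invariant vector field of `X` read in the preferred chart at the identity. -/
noncomputable def chartField (G : Type*) [TopologicalSpace G]
    [ChartedSpace (EuclideanSpace ℝ (Fin n)) G] [Group G] (X x : EuclideanSpace ℝ (Fin n)) :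
    EuclideanSpace ℝ (Fin n) :=
  fderiv ℝ (fun z => chartMul n G (x, z)) (oneChart n G 1) X

lemma one_mem_oneChart_source : (1 : G) ∈ (oneChart n G).source :=
  mem_extChartAt_source (1 : G)

lemma oneChart_one_mem_target : oneChart n G 1 ∈ (oneChart n G).target :=
  mem_extChartAt_target (1 : G)

@[simp] lemma oneChart_symm_one : (oneChart n G).symm (oneChart n G 1) = 1 :=
  extChartAt_to_inv (1 : G)

lemma oneChart_symm_oneChart {g : G} (hg : g ∈ (oneChart n G).source) :
    (oneChart n G).symm (oneChart n G g) = g :=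
  (oneChart n G).left_inv hg

/-- The tangent space at the identity is the model space itself, through the preferred chart; the
manifold derivative there is thus an ordinary derivative. `if_pos` unfolds the case distinction on
differentiability in `mfderiv`. -/
lemma mfderiv_one_apply {F : G → EuclideanSpace ℝ (Fin n)}
    (h : MDifferentiableAt (𝓡 n) 𝓘(ℝ, EuclideanSpace ℝ (Fin n)) F 1)
    (X : GroupLieAlgebra (𝓡 n) G) :
    (mfderiv (𝓡 n) 𝓘(ℝ, EuclideanSpace ℝ (Fin n)) F 1 X : EuclideanSpace ℝ (Fin n)) =
      fderiv ℝ (fun z => F ((oneChart n G).symm z)) (oneChart n G 1) X := by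
  have h1 : fderivWithin ℝ (fun z => F ((oneChart n G).symm z)) (range (𝓡 n)) (oneChart n G 1) =
      fderiv ℝ (fun z => F ((oneChart n G).symm z)) (oneChart n G 1) := by
    rw [ModelWithCorners.range_eq_univ, fderivWithin_univ]
  rw [← h1]
  exact congrArg (fun L : EuclideanSpace ℝ (Fin n) →L[ℝ] EuclideanSpace ℝ (Fin n) =>
    L (show EuclideanSpace ℝ (Fin n) from X)) (if_pos h)

lemma mfderiv_one_apply' {F : G → G} (h : MDifferentiableAt (𝓡 n) (𝓡 n) F 1) (h1 : F 1 = 1)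
    (X : GroupLieAlgebra (𝓡 n) G) :
    (mfderiv (𝓡 n) (𝓡 n) F 1 X : EuclideanSpace ℝ (Fin n)) =
      fderiv ℝ (fun z => oneChart n G (F ((oneChart n G).symm z))) (oneChart n G 1) X := by
  have h2 : fderivWithin ℝ (fun z => extChartAt (𝓡 n) (F 1) (F ((oneChart n G).symm z)))
      (range (𝓡 n)) (oneChart n G 1) =
      fderiv ℝ (fun z => oneChart n G (F ((oneChart n G).symm z))) (oneChart n G 1) := by
    rw [ModelWithCorners.range_eq_univ, fderivWithin_univ, h1]
    rfl
  rw [← h2]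
  exact congrArg (fun L : EuclideanSpace ℝ (Fin n) →L[ℝ] EuclideanSpace ℝ (Fin n) =>
    L (show EuclideanSpace ℝ (Fin n) from X)) (if_pos h)

variable [LieGroup (𝓡 n) ∞ G]

lemma contMDiffAt_oneChart {g : G} (hg : g ∈ (oneChart n G).source) :
    ContMDiffAt (𝓡 n) 𝓘(ℝ, EuclideanSpace ℝ (Fin n)) ∞ (oneChart n G) g :=
  contMDiffAt_extChartAt' (by simpa [oneChart] using hg)

lemma contMDiffAt_oneChart_symm {x : EuclideanSpace ℝ (Fin n)} (hx : x ∈ (oneChart n G).target) :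
    ContMDiffAt 𝓘(ℝ, EuclideanSpace ℝ (Fin n)) (𝓡 n) ∞ (oneChart n G).symm x :=
  (contMDiffOn_extChartAt_symm (1 : G)).contMDiffAt
    ((isOpen_extChartAt_target (I := 𝓡 n) (1 : G)).mem_nhds hx)

lemma contDiffAt_chartMul {q : EuclideanSpace ℝ (Fin n) × EuclideanSpace ℝ (Fin n)}
    (h1 : q.1 ∈ (oneChart n G).target) (h2 : q.2 ∈ (oneChart n G).target)
    (h3 : (oneChart n G).symm q.1 * (oneChart n G).symm q.2 ∈ (oneChart n G).source) :
    ContDiffAt ℝ ∞ (chartMul n G) q := by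
  rw [← contMDiffAt_iff_contDiffAt]
  have hf : ContMDiffAt 𝓘(ℝ, EuclideanSpace ℝ (Fin n) × EuclideanSpace ℝ (Fin n))
      𝓘(ℝ, EuclideanSpace ℝ (Fin n)) ∞ (fun q => q.1) q :=
    contMDiffAt_iff_contDiffAt.2 contDiffAt_fst
  have hs : ContMDiffAt 𝓘(ℝ, EuclideanSpace ℝ (Fin n) × EuclideanSpace ℝ (Fin n))
      𝓘(ℝ, EuclideanSpace ℝ (Fin n)) ∞ (fun q => q.2) q :=
    contMDiffAt_iff_contDiffAt.2 contDiffAt_snd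
  exact (contMDiffAt_oneChart h3).comp q
    (((contMDiffAt_oneChart_symm h1).comp q hf).mul ((contMDiffAt_oneChart_symm h2).comp q hs))

lemma contDiffAt_chartConj :
    ContDiffAt ℝ ∞ (chartConj n G) (oneChart n G 1, oneChart n G 1) := by
  rw [← contMDiffAt_iff_contDiffAt]
  set q := (oneChart n G 1, oneChart n G 1)
  have hf : ContMDiffAt 𝓘(ℝ, EuclideanSpace ℝ (Fin n) × EuclideanSpace ℝ (Fin n))
      𝓘(ℝ, EuclideanSpace ℝ (Fin n)) ∞ (fun q => q.1) q :=
    contMDiffAt_iff_contDiffAt.2 contDiffAt_fst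
  have hs : ContMDiffAt 𝓘(ℝ, EuclideanSpace ℝ (Fin n) × EuclideanSpace ℝ (Fin n))
      𝓘(ℝ, EuclideanSpace ℝ (Fin n)) ∞ (fun q => q.2) q :=
    contMDiffAt_iff_contDiffAt.2 contDiffAt_snd
  have h1 := (contMDiffAt_oneChart_symm (oneChart_one_mem_target (n := n) (G := G))).comp q hf
  have h2 := (contMDiffAt_oneChart_symm (oneChart_one_mem_target (n := n) (G := G))).comp q hs
  refine (contMDiffAt_oneChart ?_).comp q ((h1.mul h2).mul h1.inv)
  simp [q, one_mem_oneChart_source]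

lemma mdifferentiable_mul_left (g : G) : MDifferentiable (𝓡 n) (𝓡 n) (fun x : G => g * x) :=
  (contMDiff_mul_left (n := ∞)).mdifferentiable (by simp)

/-- The left-invariant field of `X`, read in the chart. -/
lemma mfderiv_oneChart_mulInvariantVectorField (X : GroupLieAlgebra (𝓡 n) G) {g : G}
    (hg : g ∈ (oneChart n G).source) :
    (mfderiv (𝓡 n) 𝓘(ℝ, EuclideanSpace ℝ (Fin n)) (oneChart n G) g
      (mulInvariantVectorField X g) : EuclideanSpace ℝ (Fin n)) =
    chartField G (X : EuclideanSpace ℝ (Fin n)) (oneChart n G g) := by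
  have h1 : MDifferentiableAt (𝓡 n) 𝓘(ℝ, EuclideanSpace ℝ (Fin n)) (oneChart n G)
      (g * 1) := by
    rw [mul_one]; exact (contMDiffAt_oneChart hg).mdifferentiableAt (by simp)
  have h2 := mdifferentiable_mul_left (n := n) g (1 : G)
  have h3 := mfderiv_comp (1 : G) h1 h2
  have h4 := mfderiv_one_apply (h1.comp (1 : G) h2) X
  have h6 : (mfderiv (𝓡 n) 𝓘(ℝ, EuclideanSpace ℝ (Fin n)) (oneChart n G) (g * 1)
      (mulInvariantVectorField X g) : EuclideanSpace ℝ (Fin n)) =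
      fderiv ℝ (fun z => oneChart n G (g * (oneChart n G).symm z)) (oneChart n G 1) X :=
    (congrArg (fun L => L X) h3).symm.trans h4
  rw [mul_one] at h6
  rw [h6]
  simp only [chartField, chartMul, oneChart_symm_oneChart hg]
  rfl

end LieGroupCalculus

section LieGroupCalculus

variable {n : ℕ} {G : Type*} [TopologicalSpace G] [ChartedSpace (EuclideanSpace ℝ (Fin n)) G]
  [Group G] [LieGroup (𝓡 n) ∞ G]

omit [LieGroup (𝓡 n) ∞ G] in
lemma isOpen_oneChart_target : IsOpen (oneChart n G).target := isOpen_extChartAt_target (1 : G)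

omit [LieGroup (𝓡 n) ∞ G] in
lemma isOpen_oneChart_source : IsOpen (oneChart n G).source := isOpen_extChartAt_source (1 : G)

omit [LieGroup (𝓡 n) ∞ G] in
lemma chartMul_one_right {x : EuclideanSpace ℝ (Fin n)} (hx : x ∈ (oneChart n G).target) :
    chartMul n G (x, oneChart n G 1) = x := by
  simp [chartMul, (oneChart n G).right_inv hx]

omit [LieGroup (𝓡 n) ∞ G] in
lemma chartMul_one_left {x : EuclideanSpace ℝ (Fin n)} (hx : x ∈ (oneChart n G).target) :
    chartMul n G (oneChart n G 1, x) = x := by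
  simp [chartMul, (oneChart n G).right_inv hx]

lemma chartMul_contDiffAt_right {x : EuclideanSpace ℝ (Fin n)} (hx : x ∈ (oneChart n G).target) :
    ContDiffAt ℝ ∞ (chartMul n G) (x, oneChart n G 1) :=
  contDiffAt_chartMul hx oneChart_one_mem_target
    (by simpa using (oneChart n G).map_target hx)

lemma chartMul_contDiffAt_left {x : EuclideanSpace ℝ (Fin n)} (hx : x ∈ (oneChart n G).target) :
    ContDiffAt ℝ ∞ (chartMul n G) (oneChart n G 1, x) :=
  contDiffAt_chartMul oneChart_one_mem_target hx
    (by simpa using (oneChart n G).map_target hx)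

lemma fderiv_slice_right {E F H : Type*} [NormedAddCommGroup E] [NormedSpace ℝ E]
    [NormedAddCommGroup F] [NormedSpace ℝ F] [NormedAddCommGroup H] [NormedSpace ℝ H]
    {f : E × F → H} {x : E} {y : F} (hf : DifferentiableAt ℝ f (x, y)) (v : F) :
    fderiv ℝ (fun z => f (x, z)) y v = fderiv ℝ f (x, y) (0, v) := by
  have := HasFDerivAt.comp (f := fun z => (x, z)) y hf.hasFDerivAt
    (hasFDerivAt_prodMk_right x y)
  have h2 := this.fderiv
  rw [show (fun z => f (x, z)) = f ∘ fun z => (x, z) from rfl, h2]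
  simp

lemma fderiv_slice_left {E F H : Type*} [NormedAddCommGroup E] [NormedSpace ℝ E]
    [NormedAddCommGroup F] [NormedSpace ℝ F] [NormedAddCommGroup H] [NormedSpace ℝ H]
    {f : E × F → H} {x : E} {y : F} (hf : DifferentiableAt ℝ f (x, y)) (v : E) :
    fderiv ℝ (fun z => f (z, y)) x v = fderiv ℝ f (x, y) (v, 0) := by
  have := HasFDerivAt.comp (f := fun z => (z, y)) x hf.hasFDerivAt
    (hasFDerivAt_prodMk_left x y)
  have h2 := this.fderiv
  rw [show (fun z => f (z, y)) = f ∘ fun z => (z, y) from rfl, h2]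
  simp

lemma chartField_eq (X : EuclideanSpace ℝ (Fin n)) {x : EuclideanSpace ℝ (Fin n)}
    (hx : x ∈ (oneChart n G).target) :
    chartField G X x = fderiv ℝ (chartMul n G) (x, oneChart n G 1) (0, X) :=
  fderiv_slice_right ((chartMul_contDiffAt_right hx).differentiableAt (by simp)) X

lemma contDiffOn_chartField (X : EuclideanSpace ℝ (Fin n)) :
    ContDiffOn ℝ ∞ (chartField G X) (oneChart n G).target := by
  intro x hx
  refine ContDiffAt.contDiffWithinAt ?_
  have h1 : ContDiffAt ℝ ∞ (fun x => fderiv ℝ (chartMul n G) (x, oneChart n G 1) (0, X)) x :=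
    (((chartMul_contDiffAt_right hx).fderiv_right (m := ∞) (by simp)).comp x
      (contDiffAt_id.prodMk contDiffAt_const)).clm_apply contDiffAt_const
  refine h1.congr_of_eventuallyEq ?_
  filter_upwards [isOpen_oneChart_target.mem_nhds hx] with y hy using chartField_eq X hy

omit [LieGroup (𝓡 n) ∞ G] in
lemma chartField_one (X : EuclideanSpace ℝ (Fin n)) :
    chartField G X (oneChart n G 1) = X := by
  have : (fun z => chartMul n G (oneChart n G 1, z)) =ᶠ[𝓝 (oneChart n G 1)] id := by
    filter_upwards [isOpen_oneChart_target.mem_nhds (oneChart_one_mem_target (n := n) (G := G))]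
      with y hy using chartMul_one_left hy
  rw [chartField, this.fderiv_eq]
  simp

lemma mfderiv_oneChart_one :
    (mfderiv (𝓡 n) 𝓘(ℝ, EuclideanSpace ℝ (Fin n)) (oneChart n G) 1 :
      EuclideanSpace ℝ (Fin n) →L[ℝ] EuclideanSpace ℝ (Fin n)) =
    ContinuousLinearMap.id ℝ (EuclideanSpace ℝ (Fin n)) := by
  ext1 X
  have h := mfderiv_one_apply
    ((contMDiffAt_oneChart (one_mem_oneChart_source (n := n) (G := G))).mdifferentiableAt
      (by simp)) X
  refine h.trans ?_
  have : (fun z => oneChart n G ((oneChart n G).symm z)) =ᶠ[𝓝 (oneChart n G 1)] id := by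
    filter_upwards [isOpen_oneChart_target.mem_nhds (oneChart_one_mem_target (n := n) (G := G))]
      with y hy using (oneChart n G).right_inv hy
  rw [this.fderiv_eq, fderiv_id]
  rfl

lemma mpullbackWithin_mulInvariantVectorField (X : GroupLieAlgebra (𝓡 n) G)
    {x : EuclideanSpace ℝ (Fin n)} (hx : x ∈ (oneChart n G).target) :
    (VectorField.mpullbackWithin 𝓘(ℝ, EuclideanSpace ℝ (Fin n)) (𝓡 n) (extChartAt (𝓡 n) (1 : G)).symm
      (mulInvariantVectorField X) (range (𝓡 n)) x : EuclideanSpace ℝ (Fin n)) =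
    chartField G (X : EuclideanSpace ℝ (Fin n)) x := by
  have h1 := mfderiv_extChartAt_comp_mfderivWithin_extChartAt_symm (I := 𝓡 n) hx
  have h2 := mfderivWithin_extChartAt_symm_comp_mfderiv_extChartAt (I := 𝓡 n) hx
  have h3 := ContinuousLinearMap.inverse_eq h2 h1
  have h4 := mfderiv_oneChart_mulInvariantVectorField X ((oneChart n G).map_target hx)
  rw [(oneChart n G).right_inv hx] at h4
  rw [← h4, VectorField.mpullbackWithin_apply]
  exact congrArg (fun L => L (mulInvariantVectorField X ((oneChart n G).symm x))) h3

/-- Pulled back by the chart, left-invariant fields become `chartField`, and the differential of the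
chart at the identity is the identity map, so the Lie bracket is the Euclidean one. -/
lemma bracket_eq_chart (X Y : GroupLieAlgebra (𝓡 n) G) :
    ((⁅X, Y⁆ : GroupLieAlgebra (𝓡 n) G) : EuclideanSpace ℝ (Fin n)) =
      fderiv ℝ (chartField G (Y : EuclideanSpace ℝ (Fin n))) (oneChart n G 1) X -
      fderiv ℝ (chartField G (X : EuclideanSpace ℝ (Fin n))) (oneChart n G 1) Y := by
  let P : GroupLieAlgebra (𝓡 n) G → EuclideanSpace ℝ (Fin n) → EuclideanSpace ℝ (Fin n) :=
    fun Z => VectorField.mpullbackWithin 𝓘(ℝ, EuclideanSpace ℝ (Fin n)) (𝓡 n)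
      (extChartAt (𝓡 n) (1 : G)).symm (mulInvariantVectorField Z) (range (𝓡 n))
  have key : ∀ Z : GroupLieAlgebra (𝓡 n) G, P Z =ᶠ[𝓝 (oneChart n G 1)]
      chartField G (Z : EuclideanSpace ℝ (Fin n)) := by
    intro Z
    filter_upwards [isOpen_oneChart_target.mem_nhds (oneChart_one_mem_target (n := n) (G := G))]
      with y hy using mpullbackWithin_mulInvariantVectorField Z hy
  have h1 := (key X).lieBracket_vectorField_eq (𝕜 := ℝ) (key Y)
  let T : EuclideanSpace ℝ (Fin n) →L[ℝ] EuclideanSpace ℝ (Fin n) :=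
    mfderiv (𝓡 n) 𝓘(ℝ, EuclideanSpace ℝ (Fin n)) (oneChart n G) 1
  have hT : T.inverse = ContinuousLinearMap.id ℝ (EuclideanSpace ℝ (Fin n)) := by
    rw [show T = ContinuousLinearMap.id ℝ (EuclideanSpace ℝ (Fin n)) from mfderiv_oneChart_one,
      ContinuousLinearMap.inverse_id]
  -- This is the definition of the bracket of vector fields on a manifold, evaluated at the
  -- identity.
  have h2 : ((⁅X, Y⁆ : GroupLieAlgebra (𝓡 n) G) : EuclideanSpace ℝ (Fin n)) =
      T.inverse (VectorField.lieBracketWithin ℝ (E := EuclideanSpace ℝ (Fin n)) (P X) (P Y)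
      ((extChartAt (𝓡 n) (1 : G)).symm ⁻¹' univ ∩ range (𝓡 n)) (oneChart n G 1)) := rfl
  rw [h2, hT, preimage_univ, univ_inter,
    ModelWithCorners.range_eq_univ, VectorField.lieBracketWithin_univ]
  refine Eq.trans h1 ?_
  exact congrArg₂ (fun a b => fderiv ℝ (chartField G (Y : EuclideanSpace ℝ (Fin n)))
    (oneChart n G 1) a - fderiv ℝ (chartField G (X : EuclideanSpace ℝ (Fin n)))
    (oneChart n G 1) b) (chartField_one (G := G) X) (chartField_one (G := G) Y)

end LieGroupCalculus

section LieGroupCalculus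

variable {n : ℕ} {G : Type*} [TopologicalSpace G] [ChartedSpace (EuclideanSpace ℝ (Fin n)) G]
  [Group G] [LieGroup (𝓡 n) ∞ G]

lemma contMDiff_conj (g : G) : ContMDiff (𝓡 n) (𝓡 n) ∞ (fun x : G => g * x * g⁻¹) :=
  (contMDiff_const.mul contMDiff_id).mul contMDiff_const

lemma mdifferentiable_conj (g : G) : MDifferentiable (𝓡 n) (𝓡 n) (fun x : G => g * x * g⁻¹) :=
  (contMDiff_conj g).mdifferentiable (by simp)

/-- The adjoint representation read in the chart. -/
lemma Ad_eq_chart {x : EuclideanSpace ℝ (Fin n)} (Y : GroupLieAlgebra (𝓡 n) G) :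
    (Ad ((oneChart n G).symm x) Y : EuclideanSpace ℝ (Fin n)) =
      fderiv ℝ (fun z => chartConj n G (x, z)) (oneChart n G 1) Y :=
  mfderiv_one_apply' (mdifferentiable_conj _ _) (by simp) Y

/-- The adjoint representation as a curve of vectors. -/
noncomputable def chartAd (G : Type*) [TopologicalSpace G]
    [ChartedSpace (EuclideanSpace ℝ (Fin n)) G] [Group G] (Y x : EuclideanSpace ℝ (Fin n)) :
    EuclideanSpace ℝ (Fin n) :=
  fderiv ℝ (fun z => chartConj n G (x, z)) (oneChart n G 1) Y

lemma eventually_chartConj_contDiffAt : ∀ᶠ x in 𝓝 (oneChart n G 1),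
    ContDiffAt ℝ 2 (chartConj n G) (x, oneChart n G 1) := by
  have h := (contDiffAt_chartConj (n := n) (G := G)).of_le (m := 2) (by norm_cast)
  have h2 := h.eventually (by simp)
  exact (Continuous.tendsto' (by fun_prop) _ _ rfl :
    Tendsto (fun x => (x, oneChart n G 1)) (𝓝 (oneChart n G 1)) (𝓝 (oneChart n G 1, oneChart n G 1))).eventually h2

lemma differentiableAt_chartAd (Y : EuclideanSpace ℝ (Fin n)) :
    DifferentiableAt ℝ (chartAd G Y) (oneChart n G 1) := by
  have h1 : ContDiffAt ℝ 1 (fun x => fderiv ℝ (chartConj n G) (x, oneChart n G 1) (0, Y))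
      (oneChart n G 1) :=
    (((contDiffAt_chartConj (n := n) (G := G)).fderiv_right (m := 1) (by norm_cast)).comp
      (f := fun x => (x, oneChart n G 1)) (oneChart n G 1) (contDiffAt_id.prodMk contDiffAt_const)).clm_apply contDiffAt_const
  refine (h1.differentiableAt one_ne_zero).congr_of_eventuallyEq ?_
  filter_upwards [eventually_chartConj_contDiffAt] with y hy
  exact fderiv_slice_right (hy.differentiableAt (by simp)) Y

omit [LieGroup (𝓡 n) ∞ G] in
lemma chartAd_one (Y : EuclideanSpace ℝ (Fin n)) : chartAd G Y (oneChart n G 1) = Y := by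
  have : (fun z => chartConj n G (oneChart n G 1, z)) =ᶠ[𝓝 (oneChart n G 1)] id := by
    filter_upwards [isOpen_oneChart_target.mem_nhds (oneChart_one_mem_target (n := n) (G := G))]
      with y hy
    simp [chartConj, (oneChart n G).right_inv hy]
  rw [chartAd, this.fderiv_eq]
  simp

/-- Differentiating `(g x g⁻¹) g = g x` in `x` at the identity. -/
lemma eventually_fderiv_chartMul_chartAd (Y : EuclideanSpace ℝ (Fin n)) :
    ∀ᶠ x in 𝓝 (oneChart n G 1),
      fderiv ℝ (chartMul n G) (oneChart n G 1, x) (chartAd G Y x, 0) = chartField G Y x := by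
  set o := oneChart n G 1 with ho
  filter_upwards [isOpen_oneChart_target.mem_nhds (oneChart_one_mem_target (n := n) (G := G)),
    eventually_chartConj_contDiffAt] with x hx hK
  have hKo : chartConj n G (x, o) = o := by simp [chartConj, ho]
  have hconjc : ContinuousAt (fun z => (oneChart n G).symm x * (oneChart n G).symm z *
      ((oneChart n G).symm x)⁻¹) o := by
    have h1 := (contMDiffAt_oneChart_symm (oneChart_one_mem_target (n := n) (G := G))).continuousAt
    have h2 := ((contMDiff_conj ((oneChart n G).symm x)).continuous (I := 𝓡 n)).continuousAt
      (x := (oneChart n G).symm o)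
    exact h2.comp h1
  have hev : ∀ᶠ z in 𝓝 o, chartMul n G (chartConj n G (x, z), x) = chartMul n G (x, z) := by
    have h3 := hconjc.preimage_mem_nhds (t := (oneChart n G).source)
      (isOpen_oneChart_source.mem_nhds (by simp [ho, one_mem_oneChart_source]))
    filter_upwards [h3] with z hz
    simp only [chartMul, chartConj]
    rw [oneChart_symm_oneChart hz]
    simp
  have hKd : HasFDerivAt (fun z => chartConj n G (x, z))
      (fderiv ℝ (fun z => chartConj n G (x, z)) o) o := by
    have : DifferentiableAt ℝ (fun z => chartConj n G (x, z)) o :=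
      (hK.differentiableAt (by simp)).comp o (by fun_prop)
    exact this.hasFDerivAt
  have hm : HasFDerivAt (chartMul n G) (fderiv ℝ (chartMul n G) (o, x)) (chartConj n G (x, o), x) := by
    rw [hKo]
    exact ((chartMul_contDiffAt_left hx).differentiableAt (by simp)).hasFDerivAt
  have h5 := HasFDerivAt.comp (f := fun z => (chartConj n G (x, z), x)) o hm
    (hKd.prodMk (hasFDerivAt_const x o))
  have h6 := (h5.congr_of_eventuallyEq (f₁ := fun z => chartMul n G (x, z))
    (by filter_upwards [hev] with z hz using hz.symm)).fderiv
  rw [chartField, h6]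
  simp [chartAd, ho]

/-- With `bracket_eq_chart` this says that `ad` is the derivative of `Ad`. It comes from
differentiating `D m (o, x) (Ad_x Y, 0) = Y(x)` in `x` at `o`, where `m` is the multiplication: the
left side gives `D(Ad Y) X` plus a mixed second derivative of `m`, equal by symmetry to the
derivative of the field of `X` along `Y`. -/
lemma fderiv_chartAd (X Y : EuclideanSpace ℝ (Fin n)) :
    fderiv ℝ (chartAd G Y) (oneChart n G 1) X =
      fderiv ℝ (chartField G Y) (oneChart n G 1) X -
      fderiv ℝ (chartField G X) (oneChart n G 1) Y := by
  set o := oneChart n G 1 with ho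
  have hot := oneChart_one_mem_target (n := n) (G := G)
  set m := chartMul n G with hm
  have hm2 : ContDiffAt ℝ ∞ m (o, o) := chartMul_contDiffAt_left hot
  have hDm : HasFDerivAt (fderiv ℝ m) (fderiv ℝ (fderiv ℝ m) (o, o)) (o, o) :=
    ((hm2.fderiv_right (m := 1) (by norm_cast)).differentiableAt one_ne_zero).hasFDerivAt
  have hfield2 : ∀ Z W : EuclideanSpace ℝ (Fin n), fderiv ℝ (chartField G Z) o W =
      fderiv ℝ (fderiv ℝ m) (o, o) (W, 0) (0, Z) := by
    intro Z W
    have h1 := HasFDerivAt.comp (f := fun z => (z, o)) o hDm (hasFDerivAt_prodMk_left o o)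
    have h2 := (h1.clm_apply (hasFDerivAt_const ((0 : EuclideanSpace ℝ (Fin n)), Z) o))
    have h3 : chartField G Z =ᶠ[𝓝 o] fun z => fderiv ℝ m (z, o) (0, Z) := by
      filter_upwards [isOpen_oneChart_target.mem_nhds hot] with y hy using chartField_eq Z hy
    rw [(h2.congr_of_eventuallyEq h3).fderiv]
    simp
  have hsymm : fderiv ℝ (fderiv ℝ m) (o, o) (0, X) (Y, 0) =
      fderiv ℝ (fderiv ℝ m) (o, o) (Y, 0) (0, X) :=
    (hm2.isSymmSndFDerivAt (by simp; norm_cast)) _ _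
  have hA : HasFDerivAt (chartAd G Y) (fderiv ℝ (chartAd G Y) o) o :=
    (differentiableAt_chartAd Y).hasFDerivAt
  have h1 := HasFDerivAt.comp (f := fun z => (o, z)) o hDm (hasFDerivAt_prodMk_right o o)
  have h2 := h1.clm_apply (hA.prodMk (hasFDerivAt_const (0 : EuclideanSpace ℝ (Fin n)) o))
  have h3 := (h2.congr_of_eventuallyEq (f₁ := chartField G Y) (by
    filter_upwards [eventually_fderiv_chartMul_chartAd (G := G) Y] with x hx
    exact hx.symm)).fderiv
  have hid : ∀ Z : EuclideanSpace ℝ (Fin n), fderiv ℝ m (o, o) (Z, 0) = Z := by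
    intro Z
    rw [← fderiv_slice_left (hm2.differentiableAt (by simp))]
    have : (fun z => m (z, o)) =ᶠ[𝓝 o] id := by
      filter_upwards [isOpen_oneChart_target.mem_nhds hot] with y hy using chartMul_one_right hy
    rw [this.fderiv_eq]
    simp
  have h7 : chartAd G Y o = Y := chartAd_one Y
  rw [h3, hfield2 X Y, ← hsymm]
  simp [h7, hid]

end LieGroupCalculus

/-! ### One-parameter subgroups: existence, uniqueness, smoothness. -/

section OneParameterSubgroups

/-- Solutions of a smooth autonomous differential equation are smooth. -/
lemma contDiffOn_of_hasDerivAt {E : Type*} [NormedAddCommGroup E] [NormedSpace ℝ E]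
    {F : E → E} {O : Set E} (hF : ContDiffOn ℝ ∞ F O) {u : ℝ → E} {J : Set ℝ} (hJ : IsOpen J)
    (hu : MapsTo u J O) (hd : ∀ t ∈ J, HasDerivAt u (F (u t)) t) : ContDiffOn ℝ ∞ u J := by
  -- Bootstrapping: if `u` is `C^k` then so is `u' = F ∘ u`.
  have key : ∀ k : ℕ, ContDiffOn ℝ k u J := by
    intro k
    induction k with
    | zero =>
      exact contDiffOn_zero.2 fun t ht => (hd t ht).continuousAt.continuousWithinAt
    | succ k ih =>
      push_cast
      rw [contDiffOn_succ_iff_deriv_of_isOpen hJ]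
      refine ⟨fun t ht => (hd t ht).differentiableAt.differentiableWithinAt, by simp, ?_⟩
      refine ((hF.of_le (by norm_cast; exact le_top)).comp ih hu).congr ?_
      exact fun t ht => (hd t ht).deriv
  exact contDiffOn_infty.2 key

lemma comp_smulRight_one {E F : Type*} [NormedAddCommGroup E] [NormedSpace ℝ E]
    [NormedAddCommGroup F] [NormedSpace ℝ F] (L : E →L[ℝ] F) (v : E) :
    L.comp ((1 : ℝ →L[ℝ] ℝ).smulRight v) = (1 : ℝ →L[ℝ] ℝ).smulRight (L v) := by
  ext; simp

variable {n : ℕ} {G : Type*} [TopologicalSpace G] [ChartedSpace (EuclideanSpace ℝ (Fin n)) G]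
  [Group G] [LieGroup (𝓡 n) ∞ G]

lemma contMDiff_mulInvariantVectorField_one (X : GroupLieAlgebra (𝓡 n) G) :
    ContMDiff (𝓡 n) (𝓡 n).tangent 1
      (fun g => (⟨g, mulInvariantVectorField X g⟩ : TangentBundle (𝓡 n) G)) := by
  have : LieGroup (𝓡 n) (minSmoothness ℝ 3) G :=
    LieGroup.of_le (n := ∞) (by simp; norm_cast)
  exact (contMDiff_mulInvariantVectorField X).of_le (by simp)

lemma mfderiv_mul_left_mulInvariantVectorField (X : GroupLieAlgebra (𝓡 n) G) (g h : G) :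
    mfderiv (𝓡 n) (𝓡 n) (fun x => g * x) h (mulInvariantVectorField X h) =
      mulInvariantVectorField X (g * h) := by
  have h1 : MDifferentiableAt (𝓡 n) (𝓡 n) (fun x => g * x) (h * 1) := mdifferentiable_mul_left g _
  have h2 : MDifferentiableAt (𝓡 n) (𝓡 n) (fun x => h * x) 1 := mdifferentiable_mul_left h _
  have h3 := mfderiv_comp (1 : G) h1 h2
  rw [mul_one] at h3
  have h4 : ((fun x => g * x) ∘ fun x => h * x) = fun x => g * h * x := by
    ext x; simp [mul_assoc]
  rw [h4] at h3
  exact (congrArg (fun L => L X) h3).symm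

omit [LieGroup (𝓡 n) ∞ G] in
-- The base point is a variable because the tangent spaces at `γ 0` and at `1` become the same type
-- only after substituting the equality.
lemma mfderiv_mul_left_of_eq_one {e : G} (he : e = 1) (g : G) (X : GroupLieAlgebra (𝓡 n) G) :
    (mfderiv (𝓡 n) (𝓡 n) (fun x => g * x) e X : EuclideanSpace ℝ (Fin n)) =
      mulInvariantVectorField X g := by
  subst he; rfl

lemma IsMIntegralCurveOn.mul_left {X : GroupLieAlgebra (𝓡 n) G} {γ : ℝ → G} {S : Set ℝ}
    (h : IsMIntegralCurveOn (I := 𝓡 n) γ (fun p : G => mulInvariantVectorField X p) S) (g : G) :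
    IsMIntegralCurveOn (I := 𝓡 n) (fun t => g * γ t)
      (fun p : G => mulInvariantVectorField X p) S := by
  intro t ht
  have h1 := (mdifferentiable_mul_left (n := n) g (γ t)).hasMFDerivAt.comp_hasMFDerivWithinAt t
    (h t ht)
  exact h1.congr_mfderiv ((comp_smulRight_one (E := EuclideanSpace ℝ (Fin n))
    (F := EuclideanSpace ℝ (Fin n)) _ _).trans (congrArg (ContinuousLinearMap.smulRight 1)
      (mfderiv_mul_left_mulInvariantVectorField X g (γ t))))

variable [T2Space G]

/-- Left-invariant fields are complete: left translates of one local curve through the identity give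
the same existence time at every point. -/
lemma exists_isMIntegralCurve (X : GroupLieAlgebra (𝓡 n) G) :
    ∃ γ : ℝ → G, γ 0 = 1 ∧
      IsMIntegralCurve (I := 𝓡 n) γ (fun p : G => mulInvariantVectorField X p) := by
  have : IsManifold (𝓡 n) 1 G := IsManifold.of_le (n := ∞) (by norm_cast)
  have hv := contMDiff_mulInvariantVectorField_one X
  obtain ⟨γ, h0, hγ⟩ := exists_isMIntegralCurveAt_of_contMDiffAt_boundaryless (I := 𝓡 n) 0
    (hv.contMDiffAt (x := (1 : G)))
  obtain ⟨ε, hε, hγ⟩ := isMIntegralCurveAt_iff'.1 hγ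
  refine exists_isMIntegralCurve_of_isMIntegralCurveOn hv hε (fun x => ?_) 1
  refine ⟨fun t => x * γ t, by simp [h0], ?_⟩
  have := IsMIntegralCurveOn.mul_left hγ x
  rwa [Real.ball_eq_Ioo, zero_sub, zero_add] at this

/-- The one-parameter subgroup with initial velocity `X`. -/
noncomputable def oneParam (X : GroupLieAlgebra (𝓡 n) G) : ℝ → G :=
  (exists_isMIntegralCurve X).choose

@[simp] lemma oneParam_zero (X : GroupLieAlgebra (𝓡 n) G) : oneParam X 0 = 1 :=
  (exists_isMIntegralCurve X).choose_spec.1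

lemma isMIntegralCurve_oneParam (X : GroupLieAlgebra (𝓡 n) G) :
    IsMIntegralCurve (I := 𝓡 n) (oneParam X) (fun p : G => mulInvariantVectorField X p) :=
  (exists_isMIntegralCurve X).choose_spec.2

lemma eq_of_isMIntegralCurve {X : GroupLieAlgebra (𝓡 n) G} {γ γ' : ℝ → G}
    (h : γ 0 = γ' 0)
    (hγ : IsMIntegralCurve (I := 𝓡 n) γ (fun p : G => mulInvariantVectorField X p))
    (hγ' : IsMIntegralCurve (I := 𝓡 n) γ' (fun p : G => mulInvariantVectorField X p)) :
    γ = γ' := by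
  have : IsManifold (𝓡 n) 1 G := IsManifold.of_le (n := ∞) (by norm_cast)
  exact isMIntegralCurve_Ioo_eq_of_contMDiff_boundaryless (t₀ := 0)
    (contMDiff_mulInvariantVectorField_one X) hγ hγ' h

lemma eq_oneParam {X : GroupLieAlgebra (𝓡 n) G} {γ : ℝ → G} (h : γ 0 = 1)
    (hγ : IsMIntegralCurve (I := 𝓡 n) γ (fun p : G => mulInvariantVectorField X p)) :
    γ = oneParam X :=
  eq_of_isMIntegralCurve (by simp [h]) hγ (isMIntegralCurve_oneParam X)

lemma lieExp_eq_oneParam (X : GroupLieAlgebra (𝓡 n) G) : lieExp X = oneParam X 1 := by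
  rw [lieExp, dif_pos (exists_isMIntegralCurve X)]
  rfl

lemma oneParam_smul (X : GroupLieAlgebra (𝓡 n) G) (c t : ℝ) :
    oneParam (c • X) t = oneParam X (c * t) := by
  have h := (isMIntegralCurve_oneParam X).comp_mul c
  have h2 : oneParam X ∘ (fun x => x * c) = oneParam (c • X) := by
    refine eq_oneParam (by simp) ?_
    rw [mulInvariantVectorField_smul]
    exact h
  rw [← h2]
  simp [mul_comm]

lemma oneParam_add (X : GroupLieAlgebra (𝓡 n) G) (s t : ℝ) :
    oneParam X (s + t) = oneParam X s * oneParam X t := by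
  have h1 := (isMIntegralCurve_oneParam X).comp_add s
  have h2 : IsMIntegralCurve (I := 𝓡 n) (fun t => oneParam X s * oneParam X t)
      (fun p : G => mulInvariantVectorField X p) := by
    rw [isMIntegralCurve_iff_isMIntegralCurveOn]
    exact IsMIntegralCurveOn.mul_left ((isMIntegralCurve_oneParam X).isMIntegralCurveOn _) _
  have h3 := congrFun (eq_of_isMIntegralCurve (by simp) h1 h2) t
  simpa [add_comm] using h3

lemma oneParam_neg (X : GroupLieAlgebra (𝓡 n) G) (t : ℝ) :
    oneParam X (-t) = (oneParam X t)⁻¹ := by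
  rw [eq_inv_iff_mul_eq_one, ← oneParam_add]; simp

/-- A differentiable one-parameter subgroup is determined by its velocity at `0`. -/
lemma eq_oneParam_of_add {γ : ℝ → G} (hadd : ∀ s t, γ (s + t) = γ s * γ t)
    (hd : MDifferentiableAt 𝓘(ℝ, ℝ) (𝓡 n) γ 0) {X : GroupLieAlgebra (𝓡 n) G}
    (hX : HasDerivAt (fun t => oneChart n G (γ t)) (X : EuclideanSpace ℝ (Fin n)) 0) :
    γ = oneParam X := by
  have h0 : γ 0 = 1 := by
    have := hadd 0 0
    simpa using this
  have hZ : (mfderiv 𝓘(ℝ, ℝ) (𝓡 n) γ 0 (1 : ℝ) : EuclideanSpace ℝ (Fin n)) = X := by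
    have h1 : HasMFDerivAt (𝓡 n) 𝓘(ℝ, EuclideanSpace ℝ (Fin n)) (oneChart n G) (γ 0)
        (ContinuousLinearMap.id ℝ (EuclideanSpace ℝ (Fin n))) := by
      rw [h0, ← mfderiv_oneChart_one (n := n) (G := G)]
      exact ((contMDiffAt_oneChart (one_mem_oneChart_source (n := n) (G := G))).mdifferentiableAt
        (by simp)).hasMFDerivAt
    have h2 := h1.comp (0 : ℝ) hd.hasMFDerivAt
    have h3 : HasFDerivAt (fun t => oneChart n G (γ t)) (show ℝ →L[ℝ] EuclideanSpace ℝ (Fin n) from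
      mfderiv 𝓘(ℝ, ℝ) (𝓡 n) γ 0) 0 := hasMFDerivAt_iff_hasFDerivAt.1 h2
    exact h3.hasDerivAt.unique hX
  refine eq_oneParam h0 fun t => ?_
  have h1 : HasMFDerivAt 𝓘(ℝ, ℝ) 𝓘(ℝ, ℝ) (fun r : ℝ => r - t) t
      (ContinuousLinearMap.id ℝ ℝ) :=
    ((hasFDerivAt_id (𝕜 := ℝ) t).sub_const t).hasMFDerivAt
  have h2 : HasMFDerivAt 𝓘(ℝ, ℝ) (𝓡 n) γ ((fun r : ℝ => r - t) t)
      (mfderiv 𝓘(ℝ, ℝ) (𝓡 n) γ ((fun r : ℝ => r - t) t)) := by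
    rw [show (fun r : ℝ => r - t) t = 0 by simp]; exact hd.hasMFDerivAt
  have h3 := ((mdifferentiable_mul_left (n := n) (γ t) _).hasMFDerivAt.comp t
    (HasMFDerivAt.comp (f := fun r : ℝ => r - t) t h2 h1))
  -- Near time `t` the curve is the left translate by `γ t` of its germ at `0`, so its velocity is
  -- the left-invariant field.
  have h4 : (fun x => γ t * x) ∘ γ ∘ (fun r : ℝ => r - t) = γ := by
    ext r
    simp [← hadd]
  rw [h4] at h3
  refine h3.congr_mfderiv ?_
  have h5 : ∀ L : ℝ →L[ℝ] EuclideanSpace ℝ (Fin n), L = (1 : ℝ →L[ℝ] ℝ).smulRight (L 1) := by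
    intro L; ext; simp
  refine (h5 _).trans (congrArg (ContinuousLinearMap.smulRight (1 : ℝ →L[ℝ] ℝ)) ?_)
  have h6 : ∀ τ : ℝ, τ = 0 → (mfderiv (𝓡 n) (𝓡 n) (fun x => γ t * x) (γ τ)
      (mfderiv 𝓘(ℝ, ℝ) (𝓡 n) γ τ (1 : ℝ)) : EuclideanSpace ℝ (Fin n)) =
      mulInvariantVectorField X (γ t) := by
    rintro τ rfl
    exact (congrArg (fun z => mfderiv (𝓡 n) (𝓡 n) (fun x => γ t * x) (γ 0) z) hZ).trans
      (mfderiv_mul_left_of_eq_one h0 (γ t) X)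
  exact h6 (t - t) (sub_self t)

lemma hasDerivAt_oneChart_oneParam (X : GroupLieAlgebra (𝓡 n) G) {t : ℝ}
    (ht : oneParam X t ∈ (oneChart n G).source) :
    HasDerivAt (fun t => oneChart n G (oneParam X t))
      (chartField G (X : EuclideanSpace ℝ (Fin n)) (oneChart n G (oneParam X t))) t := by
  have h1 := ((contMDiffAt_oneChart ht).mdifferentiableAt (by simp)).hasMFDerivAt.comp t
    (isMIntegralCurve_oneParam X t)
  have h3 := (comp_smulRight_one (E := EuclideanSpace ℝ (Fin n))
    (F := EuclideanSpace ℝ (Fin n)) _ _).trans (congrArg (ContinuousLinearMap.smulRight 1)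
      (mfderiv_oneChart_mulInvariantVectorField X ht))
  have h2 : HasFDerivAt (fun t => oneChart n G (oneParam X t)) (show ℝ →L[ℝ] EuclideanSpace ℝ (Fin n)
      from (1 : ℝ →L[ℝ] ℝ).smulRight (chartField G (X : EuclideanSpace ℝ (Fin n))
        (oneChart n G (oneParam X t)))) t :=
    hasMFDerivAt_iff_hasFDerivAt.1 (h1.congr_mfderiv h3)
  simpa using h2.hasDerivAt

lemma hasDerivAt_oneChart_oneParam_zero (X : GroupLieAlgebra (𝓡 n) G) :
    HasDerivAt (fun t => oneChart n G (oneParam X t)) (X : EuclideanSpace ℝ (Fin n)) 0 := by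
  have h := hasDerivAt_oneChart_oneParam X (t := 0) (by simp [one_mem_oneChart_source])
  rw [oneParam_zero] at h
  exact h.congr_deriv (chartField_one (G := G) X)

lemma continuous_oneParam (X : GroupLieAlgebra (𝓡 n) G) : Continuous (oneParam X) :=
  (isMIntegralCurve_oneParam X).continuous

/-- Near time `0` the curve solves a smooth differential equation in the chart; the group law
carries smoothness to all times. -/
lemma contMDiff_oneParam (X : GroupLieAlgebra (𝓡 n) G) :
    ContMDiff 𝓘(ℝ, ℝ) (𝓡 n) ∞ (oneParam X) := by
  set J := oneParam X ⁻¹' (oneChart n G).source with hJd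
  have hJ : IsOpen J := isOpen_oneChart_source.preimage (continuous_oneParam X)
  have h0J : (0 : ℝ) ∈ J := by simp [J, one_mem_oneChart_source]
  have h1 : ContDiffOn ℝ ∞ (fun t => oneChart n G (oneParam X t)) J :=
    contDiffOn_of_hasDerivAt (contDiffOn_chartField (G := G) X) hJ
      (fun t ht => (oneChart n G).map_source ht)
      (fun t ht => hasDerivAt_oneChart_oneParam X ht)
  have h2 : ContMDiffAt 𝓘(ℝ, ℝ) (𝓡 n) ∞ (oneParam X) 0 := by
    have h3 : ContMDiffAt 𝓘(ℝ, ℝ) 𝓘(ℝ, EuclideanSpace ℝ (Fin n)) ∞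
      (fun t => oneChart n G (oneParam X t)) 0 := (h1.contDiffAt (hJ.mem_nhds h0J)).contMDiffAt
    have h4 := (contMDiffAt_oneChart_symm (n := n) (G := G)
      ((oneChart n G).map_source h0J)).comp (0 : ℝ) h3
    refine h4.congr_of_eventuallyEq ?_
    filter_upwards [hJ.mem_nhds h0J] with t ht using (oneChart_symm_oneChart ht).symm
  intro t
  have h5 : ContMDiffAt 𝓘(ℝ, ℝ) 𝓘(ℝ, ℝ) ∞ (fun r : ℝ => r - t) t :=
    (contDiffAt_id.sub contDiffAt_const).contMDiffAt
  have h6 : ContMDiffAt 𝓘(ℝ, ℝ) (𝓡 n) ∞ (oneParam X) ((fun r : ℝ => r - t) t) := by simpa using h2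
  have h7 := (contMDiffAt_const (c := oneParam X t)).mul (ContMDiffAt.comp (f := fun r : ℝ => r - t) t h6 h5)
  refine h7.congr_of_eventuallyEq (Eventually.of_forall fun r => ?_)
  simp [← oneParam_add]

/-- Both sides are one-parameter subgroups with velocity `Ad g Y` at `0`. Together with
`oneParam_injective`, this reduces identities for `Ad` to identities in the group. -/
lemma conj_oneParam (g : G) (Y : GroupLieAlgebra (𝓡 n) G) (t : ℝ) :
    g * oneParam Y t * g⁻¹ = oneParam (Ad g Y) t := by
  have h1 : ContMDiff 𝓘(ℝ, ℝ) (𝓡 n) ∞ (fun t => g * oneParam Y t * g⁻¹) :=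
    (contMDiff_conj g).comp (contMDiff_oneParam Y)
  refine congrFun (eq_oneParam_of_add (γ := fun t => g * oneParam Y t * g⁻¹)
    (fun s t => by simp [oneParam_add, mul_assoc]) (h1.mdifferentiable (by simp) 0) ?_) t
  have hA : (Ad g Y : EuclideanSpace ℝ (Fin n)) = fderiv ℝ (fun z => oneChart n G
      (g * (oneChart n G).symm z * g⁻¹)) (oneChart n G 1) Y :=
    mfderiv_one_apply' (mdifferentiable_conj g 1) (by simp) Y
  rw [hA]
  have h2 : DifferentiableAt ℝ (fun z => oneChart n G
      (g * (oneChart n G).symm z * g⁻¹)) (oneChart n G 1) := by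
    refine MDifferentiableAt.differentiableAt (ContMDiffAt.mdifferentiableAt (n := ∞) ?_ (by simp))
    refine ContMDiffAt.comp (oneChart n G 1) (contMDiffAt_oneChart ?_)
      ((contMDiff_conj g).contMDiffAt.comp _ (contMDiffAt_oneChart_symm oneChart_one_mem_target))
    simp [one_mem_oneChart_source]
  have h3 : HasFDerivAt (fun z => oneChart n G (g * (oneChart n G).symm z * g⁻¹))
      (fderiv ℝ (fun z => oneChart n G (g * (oneChart n G).symm z * g⁻¹)) (oneChart n G 1))
      (oneChart n G (oneParam Y 0)) := by rw [oneParam_zero]; exact h2.hasFDerivAt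
  have h4 := h3.comp_hasDerivAt (0 : ℝ) (hasDerivAt_oneChart_oneParam_zero Y)
  refine h4.congr_of_eventuallyEq ?_
  filter_upwards [(continuous_oneParam Y).continuousAt.preimage_mem_nhds (x := 0)
    (t := (oneChart n G).source) (isOpen_oneChart_source.mem_nhds
      (by simp [one_mem_oneChart_source]))] with r hr
  simp [oneChart_symm_oneChart hr]

end OneParameterSubgroups

/-! ### The adjoint representation and commuting exponentials. -/

section Adjoint

variable {n : ℕ} {G : Type*} [TopologicalSpace G] [ChartedSpace (EuclideanSpace ℝ (Fin n)) G]
  [Group G] [LieGroup (𝓡 n) ∞ G]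

omit [LieGroup (𝓡 n) ∞ G] in
lemma Ad_add (g : G) (X Y : GroupLieAlgebra (𝓡 n) G) : Ad g (X + Y) = Ad g X + Ad g Y :=
  map_add (show EuclideanSpace ℝ (Fin n) →L[ℝ] EuclideanSpace ℝ (Fin n) from
    mfderiv (𝓡 n) (𝓡 n) (fun x : G => g * x * g⁻¹) 1) X Y

omit [LieGroup (𝓡 n) ∞ G] in
lemma Ad_smul (g : G) (c : ℝ) (X : GroupLieAlgebra (𝓡 n) G) : Ad g (c • X) = c • Ad g X :=
  map_smul (show EuclideanSpace ℝ (Fin n) →L[ℝ] EuclideanSpace ℝ (Fin n) from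
    mfderiv (𝓡 n) (𝓡 n) (fun x : G => g * x * g⁻¹) 1) c X

/-- The adjoint representation as a linear map. -/
noncomputable def adHom (g : G) : GroupLieAlgebra (𝓡 n) G →ₗ[ℝ] GroupLieAlgebra (𝓡 n) G where
  toFun := Ad g
  map_add' := Ad_add g
  map_smul' := Ad_smul g

variable [T2Space G]

lemma oneParam_injective : Function.Injective (oneParam : GroupLieAlgebra (𝓡 n) G → ℝ → G) := by
  intro X Y h
  have h1 := hasDerivAt_oneChart_oneParam_zero X
  rw [h] at h1
  exact h1.unique (hasDerivAt_oneChart_oneParam_zero Y)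

lemma Ad_mul (g h : G) (Y : GroupLieAlgebra (𝓡 n) G) : Ad (g * h) Y = Ad g (Ad h Y) := by
  apply oneParam_injective
  ext t
  rw [← conj_oneParam, ← conj_oneParam, ← conj_oneParam]
  group

lemma Ad_one (Y : GroupLieAlgebra (𝓡 n) G) : Ad (1 : G) Y = Y := by
  apply oneParam_injective
  ext t
  rw [← conj_oneParam]
  simp

lemma hasDerivAt_Ad_zero (X Y : GroupLieAlgebra (𝓡 n) G) :
    HasDerivAt (F := EuclideanSpace ℝ (Fin n)) (fun t => Ad (oneParam X t) Y)
      (⁅X, Y⁆ : GroupLieAlgebra (𝓡 n) G) 0 := by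
  have h1 : HasFDerivAt (chartAd G (Y : EuclideanSpace ℝ (Fin n)))
      (fderiv ℝ (chartAd G (Y : EuclideanSpace ℝ (Fin n))) (oneChart n G 1))
      (oneChart n G (oneParam X 0)) := by
    rw [oneParam_zero]; exact (differentiableAt_chartAd (G := G) _).hasFDerivAt
  have h2 := h1.comp_hasDerivAt (0 : ℝ) (hasDerivAt_oneChart_oneParam_zero X)
  have h3 := (fderiv_chartAd (G := G) (X : EuclideanSpace ℝ (Fin n)) Y).trans
    (bracket_eq_chart X Y).symm
  refine (h2.congr_deriv h3).congr_of_eventuallyEq ?_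
  filter_upwards [(continuous_oneParam X).continuousAt.preimage_mem_nhds (x := 0)
    (t := (oneChart n G).source) (isOpen_oneChart_source.mem_nhds
      (by simp [one_mem_oneChart_source]))] with r hr
  have h4 := Ad_eq_chart (x := oneChart n G (oneParam X r)) Y
  rw [oneChart_symm_oneChart hr] at h4
  exact h4

/-- `Ad_{exp (rX)} = Ad_{exp (tX)} Ad_{exp ((r-t)X)}` reduces the derivative at `t` to the one at
`0`. -/
lemma hasDerivAt_Ad (X Y : GroupLieAlgebra (𝓡 n) G) (t : ℝ) :
    HasDerivAt (F := EuclideanSpace ℝ (Fin n)) (fun t => Ad (oneParam X t) Y)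
      (Ad (oneParam X t) ⁅X, Y⁆) t := by
  let L : EuclideanSpace ℝ (Fin n) →L[ℝ] EuclideanSpace ℝ (Fin n) :=
    mfderiv (𝓡 n) (𝓡 n) (fun x : G => oneParam X t * x * (oneParam X t)⁻¹) 1
  have h0 : HasDerivAt (F := EuclideanSpace ℝ (Fin n)) (fun t => Ad (oneParam X t) Y)
      (⁅X, Y⁆ : GroupLieAlgebra (𝓡 n) G) (t - t) := by
    rw [sub_self]; exact hasDerivAt_Ad_zero X Y
  have h1 := (L.hasFDerivAt.comp_hasDerivAt (t - t) h0).comp_sub_const t t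
  refine h1.congr_of_eventuallyEq (Eventually.of_forall fun r => ?_)
  have h2 := Ad_mul (oneParam X t) (oneParam X (r - t)) Y
  rw [← oneParam_add, add_sub_cancel] at h2
  exact h2

lemma Ad_oneParam_of_bracket_eq_zero {X Y : GroupLieAlgebra (𝓡 n) G}
    (h : (⁅X, Y⁆ : GroupLieAlgebra (𝓡 n) G) = 0) (t : ℝ) : Ad (oneParam X t) Y = Y := by
  have h1 : ∀ t, HasDerivAt (F := EuclideanSpace ℝ (Fin n)) (fun t => Ad (oneParam X t) Y) 0 t := by
    intro t
    refine (hasDerivAt_Ad X Y t).congr_deriv ?_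
    rw [h]
    exact (adHom (oneParam X t)).map_zero
  have h2 := is_const_of_deriv_eq_zero (G := EuclideanSpace ℝ (Fin n)) (fun t => (h1 t).differentiableAt) (fun t => (h1 t).deriv) t 0
  refine Eq.trans h2 ?_
  rw [oneParam_zero]
  exact Ad_one Y

lemma oneParam_commute {X Y : GroupLieAlgebra (𝓡 n) G}
    (h : (⁅X, Y⁆ : GroupLieAlgebra (𝓡 n) G) = 0) (s t : ℝ) :
    Commute (oneParam X s) (oneParam Y t) := by
  have h1 := conj_oneParam (oneParam X s) Y t
  rw [Ad_oneParam_of_bracket_eq_zero h] at h1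
  exact mul_inv_eq_iff_eq_mul.1 h1

omit [T2Space G] in
lemma fderiv_chartMul_one (X Y : EuclideanSpace ℝ (Fin n)) :
    fderiv ℝ (chartMul n G) (oneChart n G 1, oneChart n G 1) (X, Y) = X + Y := by
  have hot := oneChart_one_mem_target (n := n) (G := G)
  have hd := (chartMul_contDiffAt_left hot).differentiableAt (by simp)
  have h1 : (X, Y) = (X, 0) + (0, Y) := by simp
  rw [h1, map_add, ← fderiv_slice_left hd, ← fderiv_slice_right hd]
  congr 1
  · have : (fun z => chartMul n G (z, oneChart n G 1)) =ᶠ[𝓝 (oneChart n G 1)] id := by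
      filter_upwards [isOpen_oneChart_target.mem_nhds hot] with y hy using chartMul_one_right hy
    rw [this.fderiv_eq]; simp
  · exact chartField_one Y

lemma oneParam_add_of_bracket_eq_zero {X Y : GroupLieAlgebra (𝓡 n) G}
    (h : (⁅X, Y⁆ : GroupLieAlgebra (𝓡 n) G) = 0) (t : ℝ) :
    oneParam (X + Y) t = oneParam X t * oneParam Y t := by
  refine (congrFun (eq_oneParam_of_add (γ := fun t => oneParam X t * oneParam Y t)
    (fun s t => ?_) ?_ ?_) t).symm
  · simp only [oneParam_add]
    have := oneParam_commute h t s
    rw [mul_assoc, ← mul_assoc (oneParam X t), this.eq]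
    simp only [mul_assoc]
  · exact ((contMDiff_oneParam X).mul (contMDiff_oneParam Y)).mdifferentiable (by simp) 0
  · have hot := oneChart_one_mem_target (n := n) (G := G)
    have h1 : HasFDerivAt (chartMul n G)
        (fderiv ℝ (chartMul n G) (oneChart n G 1, oneChart n G 1))
        (oneChart n G (oneParam X 0), oneChart n G (oneParam Y 0)) := by
      rw [oneParam_zero, oneParam_zero]
      exact ((chartMul_contDiffAt_left hot).differentiableAt (by simp)).hasFDerivAt
    have h2 := HasFDerivAt.comp_hasDerivAt
      (f := fun t => (oneChart n G (oneParam X t), oneChart n G (oneParam Y t))) (0 : ℝ) h1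
      ((hasDerivAt_oneChart_oneParam_zero X).prodMk (hasDerivAt_oneChart_oneParam_zero Y))
    refine (h2.congr_deriv (fderiv_chartMul_one (G := G) X Y)).congr_of_eventuallyEq ?_
    filter_upwards [(continuous_oneParam X).continuousAt.preimage_mem_nhds (x := 0)
      (t := (oneChart n G).source) (isOpen_oneChart_source.mem_nhds
      (by simp [one_mem_oneChart_source])),
      (continuous_oneParam Y).continuousAt.preimage_mem_nhds (x := 0)
      (t := (oneChart n G).source) (isOpen_oneChart_source.mem_nhds
      (by simp [one_mem_oneChart_source]))] with r hr hr'
    simp [chartMul, oneChart_symm_oneChart hr, oneChart_symm_oneChart hr']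

/-- A chain of linear differential equations `u_j' = u_{j+1}` has polynomial solutions. -/
lemma eq_sum_of_hasDerivAt_succ {E : Type*} [NormedAddCommGroup E] [NormedSpace ℝ E] {s : ℕ}
    {u : ℕ → ℝ → E} (hu : ∀ j, 1 ≤ j → ∀ t, HasDerivAt (u j) (u (j + 1) t) t)
    (h0 : ∀ j, s < j → ∀ t, u j t = 0) {m : ℕ} {j : ℕ} (hj : 1 ≤ j) (hm : s < j + m) (t : ℝ) :
    u j t = ∑ k ∈ Finset.range m, (t ^ k / k.factorial) • u (j + k) 0 := by
  induction m generalizing j t with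
  | zero => simpa using h0 j (by simpa using hm) t
  | succ m ih =>
    -- By the inductive hypothesis for `u (j + 1)`, the difference with the Taylor sum has zero
    -- derivative, and it vanishes at `0`.
    have h1 : ∀ t, HasDerivAt (fun t => u j t -
        ∑ k ∈ Finset.range (m + 1), (t ^ k / k.factorial) • u (j + k) 0) 0 t := by
      intro t
      have h2 : HasDerivAt (fun t : ℝ => ∑ k ∈ Finset.range (m + 1),
          (t ^ k / k.factorial) • u (j + k) 0)
          (∑ k ∈ Finset.range m, (t ^ k / k.factorial) • u (j + 1 + k) 0) t := by
        have h3 : ∀ k ∈ Finset.range (m + 1), HasDerivAt (fun t : ℝ =>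
            (t ^ k / k.factorial) • u (j + k) 0)
            ((k * t ^ (k - 1) / k.factorial) • u (j + k) 0) t := fun k _ =>
          (((hasDerivAt_pow k t).div_const _).smul_const _)
        refine (HasDerivAt.fun_sum h3).congr_deriv ?_
        rw [Finset.sum_range_succ']
        simp only [Nat.cast_zero, zero_mul, zero_div, zero_smul, add_zero, Nat.add_sub_cancel]
        refine Finset.sum_congr rfl fun k _ => ?_
        rw [show j + (k + 1) = j + 1 + k by ring]
        congr 1
        rw [Nat.factorial_succ]
        push_cast
        field_simp
      have h4 := (hu j hj t).sub h2
      rw [ih (by omega) (by omega) t, sub_self] at h4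
      exact h4
    have h5 := is_const_of_deriv_eq_zero (fun t => (h1 t).differentiableAt)
      (fun t => (h1 t).deriv) t 0
    have h6 : ∑ k ∈ Finset.range (m + 1), ((0 : ℝ) ^ k / k.factorial) • u (j + k) 0 = u j 0 := by
      rw [Finset.sum_range_succ']
      simp
    simp only [h6, sub_self] at h5
    exact sub_eq_zero.1 h5

end Adjoint

/-! ### The coordinate model `ℝ ⋉ ℝˢ`. -/

section ModelGroup

/-- The exponential `exp (x A)` of the nilpotent shift `A`, a lower triangular matrix. -/
noncomputable def shiftExp (s : ℕ) (x : ℝ) : Matrix (Fin s) (Fin s) ℝ :=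
  Matrix.of fun i j => if j ≤ i then x ^ (i.val - j.val) / (i.val - j.val).factorial else 0

lemma shiftExp_zero (s : ℕ) : shiftExp s 0 = 1 := by
  ext i j
  simp only [shiftExp, Matrix.of_apply, Matrix.one_apply]
  rcases lt_trichotomy i j with h | h | h
  · simp [not_le.2 h, h.ne]
  · simp [h]
  · have : i.val - j.val ≠ 0 := by have : j.val < i.val := h; omega
    simp [h.le, h.ne', this]

/-- Entrywise this is the binomial theorem for divided powers. -/
lemma shiftExp_add (s : ℕ) (x x' : ℝ) : shiftExp s (x + x') = shiftExp s x * shiftExp s x' := by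
  ext i j
  simp only [shiftExp, Matrix.of_apply, Matrix.mul_apply]
  by_cases hij : j ≤ i
  · rw [if_pos hij]
    -- The summand extended to all natural indices; only `j ≤ k ≤ i` contributes.
    let F : ℕ → ℝ := fun k => if k ∈ Finset.Ico j.val (i.val + 1) then
      x ^ (i.val - k) / ((i.val - k).factorial : ℝ) *
      (x' ^ (k - j.val) / ((k - j.val).factorial : ℝ)) else 0
    have h1 : ∀ k : Fin s, ((if k ≤ i then x ^ (i.val - k.val) / ((i.val - k.val).factorial : ℝ) else 0) *
        if j ≤ k then x' ^ (k.val - j.val) / ((k.val - j.val).factorial : ℝ) else 0) =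
        F k.val := by
      intro k
      simp only [F]
      by_cases h1 : k ≤ i <;> by_cases h2 : j ≤ k
      · rw [if_pos h1, if_pos h2]
        have : k.val ∈ Finset.Ico j.val (i.val + 1) :=
          Finset.mem_Ico.2 ⟨h2, Nat.lt_succ_of_le h1⟩
        simp only [this, if_true]
      all_goals
        have : k.val ∉ Finset.Ico j.val (i.val + 1) := by
          rw [Finset.mem_Ico]
          rintro ⟨h3, h4⟩
          have h5 : k ≤ i := Nat.le_of_lt_succ h4
          have h6 : j ≤ k := h3
          contradiction
        simp only [this, if_false, h1, h2, zero_mul, mul_zero]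
    have hij' : j.val ≤ i.val := hij
    refine Eq.trans ?_ ((Finset.sum_congr rfl fun k _ => h1 k).trans
      (Fin.sum_univ_eq_sum_range F s)).symm
    rw [← Finset.sum_filter]
    have h2 : (Finset.range s).filter (fun k => k ∈ Finset.Ico j.val (i.val + 1)) =
        Finset.Ico j.val (i.val + 1) := by
      ext k
      simp only [Finset.mem_filter, Finset.mem_range, Finset.mem_Ico]
      have := i.isLt
      omega
    rw [h2, Finset.sum_Ico_eq_sum_range, add_comm x x', add_pow, Finset.sum_div,
      show i.val + 1 - j.val = i.val - j.val + 1 by omega]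
    refine Finset.sum_congr rfl fun k hk => ?_
    have hk' : k ≤ i.val - j.val := Nat.le_of_lt_succ (Finset.mem_range.1 hk)
    rw [Nat.cast_choose ℝ hk', show i.val - (j.val + k) = i.val - j.val - k by omega,
      show j.val + k - j.val = k by omega]
    have := Nat.factorial_ne_zero (i.val - j.val)
    field_simp
  · rw [if_neg hij]
    symm
    refine Finset.sum_eq_zero fun k _ => ?_
    by_cases h1 : k ≤ i
    · have h2 : ¬ j ≤ k := fun h => hij (h.trans h1)
      simp [h2]
    · simp [h1]

lemma det_shiftExp (s : ℕ) (x : ℝ) : (shiftExp s x).det = 1 := by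
  rw [Matrix.det_of_isLowerTriangular]
  · simp [shiftExp]
  · intro i j hij
    have : ¬ j ≤ i := not_le.2 hij
    simp [shiftExp, this]

lemma continuous_shiftExp (s : ℕ) : Continuous (shiftExp s) := by
  refine continuous_matrix fun i j => ?_
  simp only [shiftExp, Matrix.of_apply]
  by_cases h : j ≤ i
  · simp only [h, if_true]; fun_prop
  · simp only [h, if_false]; fun_prop

/-- The coordinate model `ℝ ⋉ ℝˢ` of a filiform group of the first kind. -/
def Model (s : ℕ) : Type := ℝ × (Fin s → ℝ)

namespace Model

variable {s : ℕ}

instance : TopologicalSpace (Model s) := inferInstanceAs (TopologicalSpace (ℝ × (Fin s → ℝ)))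

noncomputable instance : Mul (Model s) := ⟨fun p q => (p.1 + q.1, p.2 + (shiftExp s p.1).mulVec q.2)⟩
noncomputable instance : One (Model s) := ⟨((0 : ℝ), (0 : Fin s → ℝ))⟩
noncomputable instance : Inv (Model s) := ⟨fun p => (-p.1, -(shiftExp s (-p.1)).mulVec p.2)⟩

lemma mul_fst (p q : Model s) : (p * q).1 = p.1 + q.1 := rfl
lemma mul_snd (p q : Model s) : (p * q).2 = p.2 + (shiftExp s p.1).mulVec q.2 := rfl
lemma one_fst : (1 : Model s).1 = 0 := rfl
lemma one_snd : (1 : Model s).2 = 0 := rfl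
lemma inv_fst (p : Model s) : (p⁻¹).1 = -p.1 := rfl
lemma inv_snd (p : Model s) : (p⁻¹).2 = -(shiftExp s (-p.1)).mulVec p.2 := rfl
noncomputable instance : Group (Model s) :=
  Group.ofLeftAxioms
    (fun p q r => by
      refine Prod.ext (add_assoc _ _ _) ?_
      simp only [mul_fst, mul_snd, shiftExp_add, Matrix.mulVec_add, ← Matrix.mulVec_mulVec, add_assoc])
    (fun p => by
      refine Prod.ext (zero_add _) ?_
      simp [mul_snd, one_fst, one_snd, shiftExp_zero])
    (fun p => by
      refine Prod.ext (neg_add_cancel _) ?_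
      simp [mul_snd, one_snd, inv_fst, inv_snd])

instance : IsTopologicalGroup (Model s) where
  continuous_mul := by
    refine Continuous.prodMk ?_ ?_
    · exact (continuous_fst.comp continuous_fst).add (continuous_fst.comp continuous_snd)
    · exact (continuous_snd.comp continuous_fst).add
        (((continuous_shiftExp s).comp (continuous_fst.comp continuous_fst)).matrix_mulVec
          (continuous_snd.comp continuous_snd))
  continuous_inv := by
    refine Continuous.prodMk ?_ ?_
    · exact continuous_fst.neg
    · exact (((continuous_shiftExp s).comp continuous_fst.neg).matrix_mulVec continuous_snd).neg

instance : ConnectedSpace (Model s) := inferInstanceAs (ConnectedSpace (ℝ × (Fin s → ℝ)))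

end Model

end ModelGroup

/-! ### Exponential coordinates attached to a filiform frame. -/

section Frame

variable {n : ℕ} {G : Type*} [TopologicalSpace G] [ChartedSpace (EuclideanSpace ℝ (Fin n)) G]
  [Group G]

/-- A sequence of elements of the Lie algebra, vanishing after the index `s`, with the bracket
relations of a filiform Lie algebra of the first kind. -/
structure IsFrame (s : ℕ) (X : ℕ → GroupLieAlgebra (𝓡 n) G) : Prop where
  bracket_zero : ∀ j, 1 ≤ j → ⁅X 0, X j⁆ = X (j + 1)
  bracket_eq_zero : ∀ i j, 1 ≤ i → 1 ≤ j → ⁅X i, X j⁆ = 0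
  eq_zero : ∀ j, s < j → X j = 0

/-- The combination of `X 1, …, X s` with coefficients `y`. -/
noncomputable def hvec {s : ℕ} (X : ℕ → GroupLieAlgebra (𝓡 n) G) (y : Fin s → ℝ) :
    GroupLieAlgebra (𝓡 n) G :=
  ∑ j : Fin s, y j • X (j.val + 1)

lemma hvec_add {s : ℕ} (X : ℕ → GroupLieAlgebra (𝓡 n) G) (y z : Fin s → ℝ) :
    hvec X (y + z) = hvec X y + hvec X z := by
  simp [hvec, add_smul, Finset.sum_add_distrib]

lemma hvec_smul {s : ℕ} (X : ℕ → GroupLieAlgebra (𝓡 n) G) (c : ℝ) (y : Fin s → ℝ) :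
    hvec X (c • y) = c • hvec X y := by
  simp [hvec, Finset.smul_sum, mul_smul]

variable [LieGroup (𝓡 n) ∞ G]

lemma sum_bracket_sum_eq_zero {ι : Type*} {S T : Finset ι} {A : ι → GroupLieAlgebra (𝓡 n) G}
    (h : ∀ i j, (⁅A i, A j⁆ : GroupLieAlgebra (𝓡 n) G) = 0) (y z : ι → ℝ) :
    (⁅∑ i ∈ S, y i • A i, ∑ i ∈ T, z i • A i⁆ : GroupLieAlgebra (𝓡 n) G) = 0 := by
  have : LieGroup (𝓡 n) (minSmoothness ℝ 3) G := LieGroup.of_le (n := ∞) (by simp; norm_cast)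
  rw [sum_lie_sum]
  simp [h]

variable [T2Space G] {s : ℕ} {X : ℕ → GroupLieAlgebra (𝓡 n) G}

/-- The curves `u_j(t) = Ad_{exp (t X₀)} X_j` satisfy `u_j' = u_{j+1}` and vanish for `j > s`, hence
are polynomials. Column `j` of the matrix belongs to `X (j + 1)`. -/
lemma IsFrame.Ad_oneParam (hX : IsFrame s X) (x : ℝ) (j : Fin s) :
    Ad (oneParam (X 0) x) (X (j.val + 1)) =
      hvec X (fun i : Fin s => shiftExp s x i j) := by
  let u : ℕ → ℝ → EuclideanSpace ℝ (Fin n) := fun j t => Ad (oneParam (X 0) t) (X j)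
  have hu0 : ∀ j, u j 0 = X j := fun j => by
    simp only [u, oneParam_zero]; exact Ad_one _
  have h1 := eq_sum_of_hasDerivAt_succ (u := u) (s := s) (m := s - j.val) (j := j.val + 1)
    (fun j hj t => by
      have := hasDerivAt_Ad (X 0) (X j) t
      rw [hX.bracket_zero j hj] at this
      exact this)
    (fun j hj t => by
      simp only [u, hX.eq_zero j hj]
      exact (adHom _).map_zero) (by omega) (by omega) x
  refine Eq.trans h1 ?_
  have h2 : (hvec X (fun i : Fin s => shiftExp s x i j) : EuclideanSpace ℝ (Fin n)) =
      ∑ i : Fin s, shiftExp s x i j • u (i.val + 1) 0 := by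
    simp only [hu0]; rfl
  rw [h2]
  let F : ℕ → EuclideanSpace ℝ (Fin n) := fun i => if i ∈ Finset.Ico j.val s then
    (x ^ (i - j.val) / ((i - j.val).factorial : ℝ)) • u (i + 1) 0 else 0
  have h3 : ∀ i : Fin s, shiftExp s x i j • u (i.val + 1) 0 = F i.val := by
    intro i
    simp only [F, shiftExp, Matrix.of_apply, Finset.mem_Ico, i.isLt, and_true, ite_smul, zero_smul]
    rfl
  refine Eq.trans ?_ ((Finset.sum_congr rfl fun k _ => h3 k).trans
    (Fin.sum_univ_eq_sum_range F s)).symm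
  rw [← Finset.sum_filter]
  have h4 : (Finset.range s).filter (fun k => k ∈ Finset.Ico j.val s) = Finset.Ico j.val s := by
    ext k
    simp only [Finset.mem_filter, Finset.mem_range, Finset.mem_Ico]
    omega
  rw [h4, Finset.sum_Ico_eq_sum_range]
  refine Finset.sum_congr rfl fun k _ => ?_
  rw [show j.val + k - j.val = k by omega, show j.val + 1 + k = j.val + k + 1 by ring]

lemma IsFrame.Ad_hvec (hX : IsFrame s X) (x : ℝ) (y : Fin s → ℝ) :
    Ad (oneParam (X 0) x) (hvec X y) = hvec X ((shiftExp s x).mulVec y) := by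
  have h1 : (adHom (oneParam (X 0) x)) (hvec X y) = hvec X ((shiftExp s x).mulVec y) := by
    rw [hvec, map_sum]
    have h2 : ∀ j : Fin s, adHom (oneParam (X 0) x) (y j • X (j.val + 1)) =
        ∑ i : Fin s, (y j * shiftExp s x i j) • X (i.val + 1) := by
      intro j
      rw [map_smul]
      rw [show adHom (oneParam (X 0) x) (X (j.val + 1)) = _ from hX.Ad_oneParam x j, hvec,
        Finset.smul_sum]
      simp [mul_smul]
    simp_rw [h2]
    rw [Finset.sum_comm, hvec]
    refine Finset.sum_congr rfl fun i _ => ?_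
    rw [← Finset.sum_smul, Matrix.mulVec, dotProduct]
    simp [mul_comm]
  exact h1

/-- The exponential of the abelian ideal spanned by `X 1, …, X s`. -/
noncomputable def nu (X : ℕ → GroupLieAlgebra (𝓡 n) G) (y : Fin s → ℝ) : G :=
  oneParam (hvec X y) 1

lemma IsFrame.nu_add (hX : IsFrame s X) (y z : Fin s → ℝ) :
    nu X (y + z) = nu X y * nu X z := by
  rw [nu, hvec_add, oneParam_add_of_bracket_eq_zero]
  · rfl
  · exact sum_bracket_sum_eq_zero (fun i j => hX.bracket_eq_zero _ _ (by omega) (by omega)) y z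

lemma IsFrame.conj_nu (hX : IsFrame s X) (x : ℝ) (y : Fin s → ℝ) :
    oneParam (X 0) x * nu X y * (oneParam (X 0) x)⁻¹ = nu X ((shiftExp s x).mulVec y) := by
  rw [nu, conj_oneParam, hX.Ad_hvec]; rfl

/-- The exponential coordinates `(x, y) ↦ exp (∑ yⱼ Xⱼ) exp (x X₀)`. -/
noncomputable def coordMap (X : ℕ → GroupLieAlgebra (𝓡 n) G) (p : ℝ × (Fin s → ℝ)) : G :=
  nu X p.2 * oneParam (X 0) p.1

/-- The semidirect product law: `exp (p₁ X₀)` is moved past `nu X q.2` by conjugation, which acts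
through `shiftExp`. -/
lemma IsFrame.coordMap_mul (hX : IsFrame s X) (p q : ℝ × (Fin s → ℝ)) :
    coordMap X p * coordMap X q =
      coordMap X (p.1 + q.1, p.2 + (shiftExp s p.1).mulVec q.2) := by
  simp only [coordMap, hX.nu_add, ← hX.conj_nu, oneParam_add]
  group

/-- Since `X₁, …, X_s` commute, the exponential of their combination is a product of one-parameter
subgroups, so no smooth dependence of flows on parameters is needed. -/
lemma contMDiff_nu (hX : IsFrame s X) {M : Type*} {E' H' : Type*} [NormedAddCommGroup E']
    [NormedSpace ℝ E'] [TopologicalSpace H'] {J : ModelWithCorners ℝ E' H'} [TopologicalSpace M]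
    [ChartedSpace H' M] {y : M → Fin s → ℝ} (hy : ∀ j, ContMDiff J 𝓘(ℝ, ℝ) ∞ (fun p => y p j)) :
    ContMDiff J (𝓡 n) ∞ (fun p => nu X (y p)) := by
  have key : ∀ S : Finset (Fin s), ContMDiff J (𝓡 n) ∞
      (fun p => oneParam (∑ j ∈ S, y p j • X (j.val + 1)) 1) := by
    intro S
    induction S using Finset.induction_on with
    | empty =>
      have : oneParam (0 : GroupLieAlgebra (𝓡 n) G) 1 = 1 := by
        have := oneParam_smul (0 : GroupLieAlgebra (𝓡 n) G) 0 1
        simpa using this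
      simp only [Finset.sum_empty, this]
      exact contMDiff_const
    | insert a S ha ih =>
      have h1 : ∀ p, oneParam (∑ j ∈ insert a S, y p j • X (j.val + 1)) 1 =
          oneParam (X (a.val + 1)) (y p a) * oneParam (∑ j ∈ S, y p j • X (j.val + 1)) 1 := by
        intro p
        rw [Finset.sum_insert ha, oneParam_add_of_bracket_eq_zero, oneParam_smul, mul_one]
        have := sum_bracket_sum_eq_zero (S := {a}) (T := S) (A := fun j : Fin s => X (j.val + 1))
          (fun i j => hX.bracket_eq_zero _ _ (by omega) (by omega)) (y p) (y p)
        simpa using this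
      simp only [h1]
      exact ((contMDiff_oneParam _).comp (hy a)).mul ih
  exact key Finset.univ

end Frame

/-! ### The exponential coordinates are a global diffeomorphism. -/

section Coordinates

variable {s : ℕ} {G : Type*} [TopologicalSpace G]
  [ChartedSpace (EuclideanSpace ℝ (Fin (s + 1))) G]
  [Group G] [LieGroup (𝓡 (s + 1)) ∞ G] [T2Space G]
  {X : ℕ → GroupLieAlgebra (𝓡 (s + 1)) G}

omit [LieGroup (𝓡 (s + 1)) ∞ G] [T2Space G] in
lemma hvec_zero : hvec X (0 : Fin s → ℝ) = 0 := by simp [hvec]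

@[simp] lemma oneParam_zero_left (t : ℝ) :
    oneParam (0 : GroupLieAlgebra (𝓡 (s + 1)) G) t = 1 := by
  have := oneParam_smul (0 : GroupLieAlgebra (𝓡 (s + 1)) G) 0 t
  simpa using this

lemma nu_zero : nu X (0 : Fin s → ℝ) = 1 := by rw [nu, hvec_zero, oneParam_zero_left]

lemma nu_smul (t : ℝ) (y : Fin s → ℝ) : nu X (t • y) = oneParam (hvec X y) t := by
  rw [nu, hvec_smul, oneParam_smul, mul_one]

lemma coordMap_zero : coordMap X (0 : ℝ × (Fin s → ℝ)) = 1 := by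
  simp [coordMap, nu_zero]

lemma contMDiff_coordMap (hX : IsFrame s X) :
    ContMDiff 𝓘(ℝ, ℝ × (Fin s → ℝ)) (𝓡 (s + 1)) ∞ (coordMap (s := s) X) := by
  refine (contMDiff_nu hX (y := Prod.snd) fun j => ?_).mul ((contMDiff_oneParam (X 0)).comp ?_)
  · exact ContDiff.contMDiff (by fun_prop)
  · exact contDiff_fst.contMDiff

/-- The coordinate map read in the chart at the identity. -/
noncomputable def chartCoord (X : ℕ → GroupLieAlgebra (𝓡 (s + 1)) G) (p : ℝ × (Fin s → ℝ)) :
    EuclideanSpace ℝ (Fin (s + 1)) := oneChart (s + 1) G (coordMap X p)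

lemma contDiffAt_chartCoord (hX : IsFrame s X) : ContDiffAt ℝ ∞ (chartCoord X) 0 := by
  rw [← contMDiffAt_iff_contDiffAt]
  refine ContMDiffAt.comp 0 (contMDiffAt_oneChart ?_) (contMDiff_coordMap hX).contMDiffAt
  rw [coordMap_zero]; exact one_mem_oneChart_source

/-- Lines through `0` in either factor are mapped to one-parameter subgroups, whose initial
velocities are known. -/
lemma fderiv_chartCoord (hX : IsFrame s X) (p : ℝ × (Fin s → ℝ)) :
    fderiv ℝ (chartCoord X) 0 p = (p.1 • X 0 + hvec X p.2 : GroupLieAlgebra (𝓡 (s + 1)) G) := by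
  have hd := ((contDiffAt_chartCoord hX).differentiableAt (by simp)).hasFDerivAt
  have key : ∀ (q : ℝ × (Fin s → ℝ)) (Z : GroupLieAlgebra (𝓡 (s + 1)) G),
      (∀ t : ℝ, coordMap X (t • q) = oneParam Z t) →
      fderiv ℝ (chartCoord X) 0 q = (Z : EuclideanSpace ℝ (Fin (s + 1))) := by
    intro q Z h
    have h0 : HasFDerivAt (chartCoord X) (fderiv ℝ (chartCoord X) 0) ((0 : ℝ) • q) := by
      rw [zero_smul]; exact hd
    have h1 := h0.comp_hasDerivAt (0 : ℝ) ((hasDerivAt_id (0 : ℝ)).smul_const q)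
    have h2 : (chartCoord X ∘ fun t : ℝ => t • q) = fun t => oneChart (s + 1) G (oneParam Z t) := by
      ext1 t
      simp [chartCoord, h]
    simp only [id] at h1
    rw [h2, one_smul] at h1
    exact h1.unique (hasDerivAt_oneChart_oneParam_zero Z)
  have h1 := key (p.1, 0) (p.1 • X 0) (fun t => by
    simp [coordMap, nu_zero, oneParam_smul, mul_comm])
  have h2 := key (0, p.2) (hvec X p.2) (fun t => by
    simp [coordMap, nu_smul])
  have h3 : p = (p.1, 0) + (0, p.2) := by simp
  conv_lhs => rw [h3, map_add, h1, h2]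
  rfl

lemma exists_equiv_fderiv_chartCoord (hX : IsFrame s X)
    (hb : LinearIndependent ℝ (fun i : Fin (s + 1) => X i.val)) :
    ∃ L : (ℝ × (Fin s → ℝ)) ≃L[ℝ] EuclideanSpace ℝ (Fin (s + 1)),
      HasFDerivAt (chartCoord X) (L : (ℝ × (Fin s → ℝ)) →L[ℝ] EuclideanSpace ℝ (Fin (s + 1))) 0 := by
  have hinj : Function.Injective (fderiv ℝ (chartCoord X) 0) := by
    rw [injective_iff_map_eq_zero]
    intro p hp
    have h1 : (p.1 • X 0 + hvec X p.2 : GroupLieAlgebra (𝓡 (s + 1)) G) = 0 :=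
      (fderiv_chartCoord hX p).symm.trans hp
    have h2 := Fintype.linearIndependent_iff.1 hb (Fin.cons p.1 p.2) (by
      rw [Fin.sum_univ_succ]
      simpa [hvec] using h1)
    refine Prod.ext (h2 0) ?_
    ext j
    simpa using h2 j.succ
  have hrank : Module.finrank ℝ (ℝ × (Fin s → ℝ)) =
      Module.finrank ℝ (EuclideanSpace ℝ (Fin (s + 1))) := by
    simp [add_comm]
  let L0 := LinearEquiv.ofInjectiveOfFinrankEq _ hinj hrank
  refine ⟨L0.toContinuousLinearEquiv, ?_⟩
  have h2 : (L0.toContinuousLinearEquiv :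
      (ℝ × (Fin s → ℝ)) →L[ℝ] EuclideanSpace ℝ (Fin (s + 1))) = fderiv ℝ (chartCoord X) 0 := by
    exact ContinuousLinearMap.ext fun p => rfl
  rw [h2]
  exact ((contDiffAt_chartCoord hX).differentiableAt (by simp)).hasFDerivAt

/-- Near the identity the coordinate map has a smooth inverse. -/
lemma exists_local_inverse (hX : IsFrame s X)
    (hb : LinearIndependent ℝ (fun i : Fin (s + 1) => X i.val)) :
    ∃ ψ : G → ℝ × (Fin s → ℝ), ContMDiffAt (𝓡 (s + 1)) 𝓘(ℝ, ℝ × (Fin s → ℝ)) ∞ ψ 1 ∧ ψ 1 = 0 ∧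
      (∀ᶠ g in 𝓝 1, coordMap X (ψ g) = g) ∧ (∀ᶠ p in 𝓝 0, ψ (coordMap X p) = p) := by
  obtain ⟨L, hL⟩ := exists_equiv_fderiv_chartCoord hX hb
  have hC := contDiffAt_chartCoord hX
  have hn : (∞ : WithTop ℕ∞) ≠ 0 := by simp
  set e := hC.toOpenPartialHomeomorph (chartCoord X) hL hn with he
  have he0 : (0 : ℝ × (Fin s → ℝ)) ∈ e.source := hC.mem_toOpenPartialHomeomorph_source hL hn
  have hec : ∀ p, e p = chartCoord X p := fun p => by
    rw [he, ContDiffAt.toOpenPartialHomeomorph_coe]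
  have hk0 : chartCoord X 0 = oneChart (s + 1) G 1 := by rw [chartCoord, coordMap_zero]
  have hsm : ContDiffAt ℝ ∞ e.symm (chartCoord X 0) := hC.to_localInverse hL hn
  have hcont1 : ContinuousAt (oneChart (s + 1) G) 1 :=
    (contMDiffAt_oneChart one_mem_oneChart_source).continuousAt
  have hψ : ContMDiffAt (𝓡 (s + 1)) 𝓘(ℝ, ℝ × (Fin s → ℝ)) ∞
      (fun g => e.symm (oneChart (s + 1) G g)) 1 := by
    rw [hk0] at hsm
    exact hsm.contMDiffAt.comp 1 (contMDiffAt_oneChart one_mem_oneChart_source)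
  have hψ1 : e.symm (oneChart (s + 1) G 1) = 0 := by
    rw [← hk0, ← hec, e.left_inv he0]
  have hcoordcont : ContinuousAt (coordMap (s := s) X) 0 :=
    (contMDiff_coordMap hX).continuous.continuousAt
  have hsrc : ∀ᶠ p in 𝓝 (0 : ℝ × (Fin s → ℝ)), coordMap X p ∈ (oneChart (s + 1) G).source :=
    hcoordcont.preimage_mem_nhds (isOpen_oneChart_source.mem_nhds
      (by rw [coordMap_zero]; exact one_mem_oneChart_source))
  refine ⟨fun g => e.symm (oneChart (s + 1) G g), hψ, hψ1, ?_, ?_⟩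
  · have h1 : ∀ᶠ g in 𝓝 (1 : G), oneChart (s + 1) G g ∈ e.target :=
      hcont1.preimage_mem_nhds (e.open_target.mem_nhds (by
        rw [← hk0, ← hec]; exact e.map_source he0))
    have h2 : ∀ᶠ g in 𝓝 (1 : G), coordMap X (e.symm (oneChart (s + 1) G g)) ∈
        (oneChart (s + 1) G).source := by
      have := hψ.continuousAt
      rw [ContinuousAt, hψ1] at this
      exact this.eventually hsrc
    filter_upwards [h1, h2, isOpen_oneChart_source.mem_nhds
      (one_mem_oneChart_source (n := s + 1) (G := G))]
      with g hg1 hg2 hg3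
    have h3 := e.right_inv hg1
    rw [hec] at h3
    exact (oneChart (s + 1) G).injOn hg2 hg3 h3
  · filter_upwards [e.open_source.mem_nhds he0] with p hp
    have h3 := e.left_inv hp
    rwa [hec] at h3

/-- The coordinate map as a homomorphism from the model group. -/
noncomputable def IsFrame.coordHom (hX : IsFrame s X) : Model s →* G where
  toFun := coordMap X
  map_one' := coordMap_zero
  map_mul' p q := (hX.coordMap_mul p q).symm

lemma IsFrame.continuous_coordHom (hX : IsFrame s X) : Continuous hX.coordHom :=
  (contMDiff_coordMap hX).continuous

lemma IsFrame.map_nhds_coordHom (hX : IsFrame s X)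
    (hb : LinearIndependent ℝ (fun i : Fin (s + 1) => X i.val)) :
    𝓝 (1 : G) ≤ map hX.coordHom (𝓝 1) := by
  obtain ⟨ψ, h1, h2, h3, -⟩ := exists_local_inverse hX hb
  intro U hU
  have h4 := h1.continuousAt
  rw [ContinuousAt, h2] at h4
  filter_upwards [h3, h4.eventually hU] with g hg hg'
  have : coordMap X (ψ g) ∈ U := hg'
  rwa [hg] at this

lemma IsFrame.isOpenMap_coordHom (hX : IsFrame s X)
    (hb : LinearIndependent ℝ (fun i : Fin (s + 1) => X i.val)) : IsOpenMap hX.coordHom := by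
  have : IsTopologicalGroup G := topologicalGroup_of_lieGroup (𝓡 (s + 1)) ∞
  exact IsTopologicalGroup.isOpenMap_iff_nhds_one.2 (hX.map_nhds_coordHom hb)

/-- The range is an open subgroup, hence closed, hence everything by connectedness. -/
lemma IsFrame.surjective_coordHom [ConnectedSpace G] (hX : IsFrame s X)
    (hb : LinearIndependent ℝ (fun i : Fin (s + 1) => X i.val)) :
    Function.Surjective hX.coordHom := by
  have : IsTopologicalGroup G := topologicalGroup_of_lieGroup (𝓡 (s + 1)) ∞
  have h1 : IsOpen (hX.coordHom.range : Set G) := by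
    rw [MonoidHom.coe_range]
    exact (hX.isOpenMap_coordHom hb).isOpen_range
  have h2 : IsClosed (hX.coordHom.range : Set G) := Subgroup.isClosed_of_isOpen _ h1
  have h3 := IsClopen.eq_univ ⟨h2, h1⟩ ⟨1, hX.coordHom.range.one_mem⟩
  rw [MonoidHom.coe_range] at h3
  exact range_eq_univ.1 h3

lemma IsFrame.isDiscrete_ker_coordHom (hX : IsFrame s X)
    (hb : LinearIndependent ℝ (fun i : Fin (s + 1) => X i.val)) :
    IsDiscrete (hX.coordHom.ker : Set (Model s)) := by
  obtain ⟨ψ, -, h2, -, h4⟩ := exists_local_inverse hX hb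
  rw [isDiscrete_iff_discreteTopology]
  suffices h : IsOpen ({1} : Set hX.coordHom.ker) from
    discreteTopology_of_isOpen_singleton_one (G := hX.coordHom.ker) h
  obtain ⟨U, hU, hUo, hU0⟩ := mem_nhds_iff.1 h4
  have h5 : ({1} : Set hX.coordHom.ker) = Subtype.val ⁻¹' (show Set (Model s) from U) := by
    ext p
    simp only [mem_singleton_iff]
    constructor
    · rintro rfl
      exact hU0
    · intro hp
      have h6 : ψ (coordMap X p.1) = p.1 := hU hp
      have h7 : coordMap X p.1 = 1 := p.2
      rw [h7, h2] at h6
      exact Subtype.ext h6.symm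
  rw [h5]
  exact IsOpen.preimage continuous_subtype_val hUo

/-- An open surjective homomorphism with discrete kernel is a covering; over a simply connected
group the identity lifts to a section of it. -/
lemma IsFrame.injective_coordHom [SimplyConnectedSpace G] (hX : IsFrame s X)
    (hb : LinearIndependent ℝ (fun i : Fin (s + 1) => X i.val)) :
    Function.Injective hX.coordHom := by
  have hq : IsQuotientMap hX.coordHom := (hX.isOpenMap_coordHom hb).isQuotientMap
    hX.continuous_coordHom (hX.surjective_coordHom hb)
  have hcov : IsCoveringMap hX.coordHom :=
    (hq.isQuotientCoveringMap_of_isDiscrete_ker_monoidHom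
      (hX.isDiscrete_ker_coordHom hb)).isCoveringMap
  have : LocallyPathConnectedSpace G :=
    ChartedSpace.locallyPathConnectedSpace (EuclideanSpace ℝ (Fin (s + 1))) G
  obtain ⟨F, ⟨hF1, hF2⟩, -⟩ := hcov.existsUnique_continuousMap_lifts (ContinuousMap.id G) 1 1
    (by simp)
  -- Both maps lift `coordHom` and agree at `1`, and the model is connected; the section is thus a
  -- left inverse.
  have h1 : F ∘ hX.coordHom = id := by
    refine hcov.eq_of_comp_eq (F.continuous.comp hX.continuous_coordHom) continuous_id ?_ 1 ?_
    · rw [← Function.comp_assoc, hF2]; rfl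
    · simp [hF1]
  exact Function.LeftInverse.injective (g := F) (fun p => congrFun h1 p)

/-- The global coordinates. -/
noncomputable def IsFrame.coordEquiv [SimplyConnectedSpace G] (hX : IsFrame s X)
    (hb : LinearIndependent ℝ (fun i : Fin (s + 1) => X i.val)) : (ℝ × (Fin s → ℝ)) ≃ G :=
  Equiv.ofBijective (coordMap X) ⟨hX.injective_coordHom hb, hX.surjective_coordHom hb⟩

lemma IsFrame.contMDiff_coordEquiv_symm [SimplyConnectedSpace G] (hX : IsFrame s X)
    (hb : LinearIndependent ℝ (fun i : Fin (s + 1) => X i.val)) :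
    ContMDiff (𝓡 (s + 1)) 𝓘(ℝ, ℝ × (Fin s → ℝ)) ∞ (hX.coordEquiv hb).symm := by
  obtain ⟨ψ, h1, h2, h3, h4⟩ := exists_local_inverse hX hb
  have hone : ContMDiffAt (𝓡 (s + 1)) 𝓘(ℝ, ℝ × (Fin s → ℝ)) ∞ (hX.coordEquiv hb).symm 1 := by
    refine h1.congr_of_eventuallyEq ?_
    filter_upwards [h3] with g hg
    rw [Equiv.symm_apply_eq]
    exact hg.symm
  intro g
  set p := (hX.coordEquiv hb).symm g with hp
  have hpg : coordMap X p = g := (hX.coordEquiv hb).apply_symm_apply g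
  have h5 : ContMDiff (𝓡 (s + 1)) (𝓡 (s + 1)) ∞ (fun h => g⁻¹ * h) := contMDiff_mul_left
  -- Left translation in the model is smooth, so smoothness of the inverse at `1` spreads to every
  -- `g`.
  have h6 : ContDiff ℝ ∞ (fun q : ℝ × (Fin s → ℝ) =>
      (p.1 + q.1, p.2 + (shiftExp s p.1).mulVec q.2)) := by
    have : ContDiff ℝ ∞ (fun y : Fin s → ℝ => (shiftExp s p.1).mulVec y) :=
      ((shiftExp s p.1).mulVecLin.toContinuousLinearMap).contDiff
    exact (contDiff_const.add contDiff_fst).prodMk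
      (contDiff_const.add (this.comp contDiff_snd))
  have h7 : ContMDiffAt (𝓡 (s + 1)) 𝓘(ℝ, ℝ × (Fin s → ℝ)) ∞ (hX.coordEquiv hb).symm
      (g⁻¹ * g) := by rw [inv_mul_cancel]; exact hone
  have h8 := h6.contMDiff.contMDiffAt.comp g
    (ContMDiffAt.comp (f := fun h => g⁻¹ * h) g h7 h5.contMDiffAt)
  refine h8.congr_of_eventuallyEq (Eventually.of_forall fun h => ?_)
  rw [Equiv.symm_apply_eq]
  have h9 : coordMap X ((hX.coordEquiv hb).symm (g⁻¹ * h)) = g⁻¹ * h :=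
    (hX.coordEquiv hb).apply_symm_apply _
  have h10 := hX.coordMap_mul p ((hX.coordEquiv hb).symm (g⁻¹ * h))
  rw [hpg, h9, mul_inv_cancel_left] at h10
  exact h10

variable (s) in
/-- Coordinates of `ℝ × ℝˢ` as a Euclidean space. -/
noncomputable def consEquiv : (ℝ × (Fin s → ℝ)) ≃L[ℝ] EuclideanSpace ℝ (Fin (s + 1)) :=
  (LinearEquiv.ofFinrankEq (R := ℝ) _ _ (by simp [add_comm])).toContinuousLinearEquiv

/-- The global coordinates as a diffeomorphism onto a Euclidean space. -/
noncomputable def IsFrame.diffeo [SimplyConnectedSpace G] (hX : IsFrame s X)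
    (hb : LinearIndependent ℝ (fun i : Fin (s + 1) => X i.val)) :
    G ≃ₘ⟮𝓡 (s + 1), 𝓡 (s + 1)⟯ EuclideanSpace ℝ (Fin (s + 1)) where
  toEquiv := (hX.coordEquiv hb).symm.trans (consEquiv s).toEquiv
  contMDiff_toFun := (consEquiv s).contDiff.contMDiff.comp (hX.contMDiff_coordEquiv_symm hb)
  contMDiff_invFun := (contMDiff_coordMap hX).comp (consEquiv s).symm.contDiff.contMDiff

end Coordinates

/-! ### Haar measure is Lebesgue measure in coordinates, and is bi-invariant. -/

section HaarMeasure

lemma measurePreserving_shiftExp (s : ℕ) (x : ℝ) :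
    MeasurePreserving (fun y : Fin s → ℝ => (shiftExp s x).mulVec y) volume volume := by
  have h := Real.map_matrix_volume_pi_eq_smul_volume_pi (M := shiftExp s x)
    (by rw [det_shiftExp]; exact one_ne_zero)
  rw [det_shiftExp] at h
  refine ⟨((shiftExp s x).mulVecLin.continuous_of_finiteDimensional).measurable, ?_⟩
  have h' : Measure.map (Matrix.toLin' (shiftExp s x)) volume = volume := by simpa using h
  exact h'

lemma measurePreserving_model_mul_left {s : ℕ} (p : ℝ × (Fin s → ℝ)) :
    MeasurePreserving (fun q : ℝ × (Fin s → ℝ) =>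
      (p.1 + q.1, p.2 + (shiftExp s p.1).mulVec q.2)) volume volume :=
  (measurePreserving_add_left volume p.1).prod
    ((measurePreserving_add_left volume p.2).comp (measurePreserving_shiftExp s p.1))

lemma continuous_shiftExp_mulVec (s : ℕ) :
    Continuous (fun q : ℝ × (Fin s → ℝ) => (shiftExp s q.1).mulVec q.2) :=
  ((continuous_shiftExp s).comp continuous_fst).matrix_mulVec continuous_snd

lemma measurePreserving_shear {s : ℕ} (c : ℝ → Fin s → ℝ) (hc : Continuous c) (x : ℝ) :
    MeasurePreserving (fun q : ℝ × (Fin s → ℝ) => (q.1 + x, q.2 + c q.1)) volume volume := by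
  refine MeasurePreserving.skew_product (g := fun x y => y + c x)
    (measurePreserving_add_right volume x) ?_ ?_
  · exact (continuous_snd.add (hc.comp continuous_fst)).measurable
  · exact Eventually.of_forall fun a => (measurePreserving_add_right volume (c a)).map_eq

variable {s : ℕ} {G : Type*} [TopologicalSpace G]
  [ChartedSpace (EuclideanSpace ℝ (Fin (s + 1))) G]
  [Group G] [LieGroup (𝓡 (s + 1)) ∞ G] [T2Space G]
  {X : ℕ → GroupLieAlgebra (𝓡 (s + 1)) G} [SimplyConnectedSpace G]

/-- The global coordinates as a homeomorphism. -/
noncomputable def IsFrame.coordHomeo (hX : IsFrame s X)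
    (hb : LinearIndependent ℝ (fun i : Fin (s + 1) => X i.val)) : (ℝ × (Fin s → ℝ)) ≃ₜ G where
  toEquiv := hX.coordEquiv hb
  continuous_toFun := (contMDiff_coordMap hX).continuous
  continuous_invFun := (hX.contMDiff_coordEquiv_symm hb).continuous

variable [SecondCountableTopology G] [MeasurableSpace G] [BorelSpace G]

lemma IsFrame.exists_eq_smul_map (hX : IsFrame s X)
    (hb : LinearIndependent ℝ (fun i : Fin (s + 1) => X i.val))
    (μ : Measure G) [μ.IsHaarMeasure] :
    ∃ c : NNReal, c ≠ 0 ∧ μ = c • Measure.map (coordMap X) (volume : Measure (ℝ × (Fin s → ℝ))) := by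
  have : IsTopologicalGroup G := topologicalGroup_of_lieGroup (𝓡 (s + 1)) ∞
  have : LocallyCompactSpace G := Manifold.locallyCompact_of_finiteDimensional (𝓡 (s + 1))
  have hcont : Continuous (coordMap (s := s) X) := (contMDiff_coordMap hX).continuous
  have h1 : IsFiniteMeasureOnCompacts
      (Measure.map (coordMap X) (volume : Measure (ℝ × (Fin s → ℝ)))) :=
    Measure.IsFiniteMeasureOnCompacts.map volume (hX.coordHomeo hb)
  have h2 : (Measure.map (coordMap X) (volume : Measure (ℝ × (Fin s → ℝ)))).IsOpenPosMeasure :=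
    hcont.isOpenPosMeasure_map (hX.coordEquiv hb).surjective
  have h3 : (Measure.map (coordMap X) (volume : Measure (ℝ × (Fin s → ℝ)))).IsMulLeftInvariant := by
    refine ⟨fun g => ?_⟩
    obtain ⟨p, rfl⟩ := (hX.coordEquiv hb).surjective g
    rw [Measure.map_map (measurable_const_mul _) hcont.measurable]
    have h4 : ((fun x => (hX.coordEquiv hb) p * x) ∘ coordMap X) = coordMap X ∘
        (fun q : ℝ × (Fin s → ℝ) => (p.1 + q.1, p.2 + (shiftExp s p.1).mulVec q.2)) := by
      ext q
      exact hX.coordMap_mul p q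
    rw [h4, ← Measure.map_map hcont.measurable (measurePreserving_model_mul_left p).measurable,
      (measurePreserving_model_mul_left p).map_eq]
  have h5 : (Measure.map (coordMap X) (volume : Measure (ℝ × (Fin s → ℝ)))).IsHaarMeasure := ⟨⟩
  refine ⟨_, ?_, Measure.isMulLeftInvariant_eq_smul μ
    (Measure.map (coordMap X) (volume : Measure (ℝ × (Fin s → ℝ))))⟩
  exact (Measure.haarScalarFactor_pos_of_isHaarMeasure _ _).ne'

/-- In coordinates a right translation is a shear, which preserves Lebesgue measure. This
unimodularity is used to change variables by right translations. -/
lemma IsFrame.isMulRightInvariant (hX : IsFrame s X)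
    (hb : LinearIndependent ℝ (fun i : Fin (s + 1) => X i.val))
    (μ : Measure G) [μ.IsHaarMeasure] : μ.IsMulRightInvariant := by
  have : IsTopologicalGroup G := topologicalGroup_of_lieGroup (𝓡 (s + 1)) ∞
  obtain ⟨c, hc, h⟩ := hX.exists_eq_smul_map hb μ
  have hcont : Continuous (coordMap (s := s) X) := (contMDiff_coordMap hX).continuous
  refine ⟨fun g => ?_⟩
  obtain ⟨p, rfl⟩ := (hX.coordEquiv hb).surjective g
  have h2 := measurePreserving_shear (fun x => (shiftExp s x).mulVec p.2)
    ((continuous_shiftExp_mulVec s).comp (continuous_id.prodMk continuous_const)) p.1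
  have h4 : ((fun x => x * (hX.coordEquiv hb) p) ∘ coordMap X) = coordMap X ∘
      (fun q : ℝ × (Fin s → ℝ) => (q.1 + p.1, q.2 + (shiftExp s q.1).mulVec p.2)) := by
    ext q
    exact hX.coordMap_mul q p
  rw [h, Measure.map_smul, Measure.map_map (measurable_mul_const _) hcont.measurable, h4,
    ← Measure.map_map hcont.measurable h2.measurable, h2.map_eq]

end HaarMeasure

/-! ### Open representatives of almost-monotone sets. -/

section Semigroup

variable {G : Type*} [TopologicalSpace G] [Group G] [IsTopologicalGroup G]
  [SecondCountableTopology G] [MeasurableSpace G] [BorelSpace G]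

/-- Fubini exchanges "for every `q`, almost every `p`" into "for almost every `p`, almost every
`q`"; then `z = p q` by left invariance. -/
lemma ae_imp_ae_of_monotone (μ : Measure G) [μ.IsHaarMeasure] [SFinite μ]
    {E C : Set G} (hE : MeasurableSet E) (hC : IsOpen C)
    (h : ∀ q ∈ C, ∀ᵐ p ∂μ, p ∈ E → p * q ∈ E) :
    ∀ᵐ p ∂μ, p ∈ E → ∀ᵐ z ∂μ, p⁻¹ * z ∈ C → z ∈ E := by
  have hm : MeasurableSet {x : G × G | x.1 ∈ C → x.2 ∈ E → x.2 * x.1 ∈ E} := by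
    have h1 : MeasurableSet {x : G × G | x.1 ∈ C} := measurable_fst hC.measurableSet
    have h2 : MeasurableSet {x : G × G | x.2 ∈ E} := measurable_snd hE
    have h3 : MeasurableSet {x : G × G | x.2 * x.1 ∈ E} :=
      (measurable_snd.mul measurable_fst) hE
    exact h1.imp (h2.imp h3)
  have h1 : ∀ᵐ q ∂μ, ∀ᵐ p ∂μ, q ∈ C → p ∈ E → p * q ∈ E := by
    refine Eventually.of_forall fun q => ?_
    by_cases hq : q ∈ C
    · filter_upwards [h q hq] with p hp _ using hp
    · exact Eventually.of_forall fun p hq' => absurd hq' hq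
  have h2 := (Measure.ae_ae_comm hm).1 h1
  filter_upwards [h2] with p hp hpE
  have h3 : ∀ᵐ z ∂μ, p⁻¹ * z ∈ C → p ∈ E → p * (p⁻¹ * z) ∈ E :=
    (measurePreserving_mul_left μ p⁻¹).quasiMeasurePreserving.ae hp
  filter_upwards [h3] with z hz hzC
  simpa using hz hzC hpE

/-- Each curve `r ↦ p γ(r)` meets `D` at most once. By Fubini some right translate of `D` is null,
and right invariance concludes. -/
lemma measure_eq_zero_of_mul_notMem (μ : Measure G) [SFinite μ]
    [μ.IsMulRightInvariant] {D : Set G} (hDm : MeasurableSet D) {γ : ℝ → G} (hγ : Continuous γ)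
    (key : ∀ p r r', r < r' → p * γ r ∈ D → p * γ r' ∉ D) : μ D = 0 := by
  have h1 : ∀ᵐ p ∂μ, ∀ᵐ r : ℝ, p * γ r ∉ D := by
    refine Eventually.of_forall fun p => ?_
    have hsub : Set.Subsingleton {r : ℝ | ¬ p * γ r ∉ D} := by
      intro r hr r' hr'
      simp only [mem_ofPred_eq, not_not] at hr hr'
      rcases lt_trichotomy r r' with h | h | h
      · exact absurd hr' (key p _ _ h hr)
      · exact h
      · exact absurd hr (key p _ _ h hr')
    exact hsub.measure_zero volume
  have hm : MeasurableSet {x : G × ℝ | x.1 * γ x.2 ∉ D} :=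
    (measurable_fst.mul (hγ.measurable.comp measurable_snd)) hDm.compl
  have h2 := (Measure.ae_ae_comm hm).1 h1
  obtain ⟨r, hr⟩ := h2.exists
  have h3 : ∀ᵐ p ∂μ, p * (γ r)⁻¹ * γ r ∉ D :=
    (measurePreserving_mul_right μ (γ r)⁻¹).quasiMeasurePreserving.ae hr
  have h4 : ∀ᵐ p ∂μ, p ∉ D := by simpa using h3
  simpa [ae_iff] using h4

/-- A set which is monotone, up to null sets, with respect to an open set `C` of right translations
that accumulates at the identity along a one-parameter subgroup agrees almost everywhere with an
open set which is monotone with respect to `C`. -/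
theorem exists_isOpen_ae_eq_of_monotone (μ : Measure G) [μ.IsHaarMeasure] [SFinite μ]
    [μ.IsMulRightInvariant] {E C : Set G} (hE : MeasurableSet E) (hC : IsOpen C) {γ : ℝ → G}
    (hγ : Continuous γ) (hadd : ∀ r r', γ (r + r') = γ r * γ r') (hγC : ∀ r, 0 < r → γ r ∈ C)
    (h : ∀ q ∈ C, ∀ᵐ p ∂μ, p ∈ E → p * q ∈ E) :
    ∃ U, IsOpen U ∧ U =ᵐ[μ] E ∧ ∀ p ∈ U, ∀ q ∈ C, p * q ∈ U := by
  have hswap := ae_imp_ae_of_monotone μ hE hC h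
  -- `W` and `U` are the largest open sets on which `E` is null, respectively of full measure.
  set W := (μ.restrict E).supportᶜ with hW
  set U := (μ.restrict Eᶜ).supportᶜ with hU
  have hWE : μ (W ∩ E) = 0 := by
    rw [← Measure.restrict_apply Measure.isOpen_compl_support.measurableSet]
    exact Measure.measure_compl_support
  have hUE : μ (U ∩ Eᶜ) = 0 := by
    rw [← Measure.restrict_apply Measure.isOpen_compl_support.measurableSet]
    exact Measure.measure_compl_support
  have hUo : IsOpen U := Measure.isOpen_compl_support
  have hWo : IsOpen W := Measure.isOpen_compl_support
  have hdisj : ∀ p ∈ U, p ∉ W := by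
    intro p hpU hpW
    have h1 : μ (U ∩ W) = 0 := by
      refine measure_mono_null (t := (U ∩ Eᶜ) ∪ (W ∩ E)) ?_ (measure_union_null hUE hWE)
      intro z hz
      by_cases hzE : z ∈ E
      · exact Or.inr ⟨hz.2, hzE⟩
      · exact Or.inl ⟨hz.1, hzE⟩
    exact ((hUo.inter hWo).measure_pos μ ⟨p, hpU, hpW⟩).ne' h1
  -- If `E` has positive measure near `y`, some good point `p ∈ E` close to `y` fills almost all of
  -- `p C`, which contains a neighbourhood of `y q`.
  have hmono : ∀ p, p ∉ W → ∀ q ∈ C, p * q ∈ U := by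
    intro y hy q hq
    have hnear : ∀ᶠ x : G × G in 𝓝 y ×ˢ 𝓝 (y * q), x.1⁻¹ * x.2 ∈ C := by
      rw [← nhds_prod_eq]
      have hc : Continuous (fun x : G × G => x.1⁻¹ * x.2) := by fun_prop
      exact hc.continuousAt.preimage_mem_nhds (hC.mem_nhds (by simpa using hq))
    obtain ⟨B, hB, Q, hQ, hBQ⟩ := mem_prod_iff.1 hnear
    have hy' : y ∈ (μ.restrict E).support := by simpa [hW] using hy
    obtain ⟨B', hB', hB'o, hyB'⟩ := mem_nhds_iff.1 hB
    have hpos : 0 < μ (B' ∩ E) := by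
      rw [← Measure.restrict_apply hB'o.measurableSet]
      exact (Measure.mem_support_iff_forall y).1 hy' B' (hB'o.mem_nhds hyB')
    obtain ⟨p, ⟨hpB, hpE⟩, hp⟩ : ∃ p ∈ B' ∩ E, ∀ᵐ z ∂μ, p⁻¹ * z ∈ C → z ∈ E := by
      by_contra hcon
      refine hpos.ne' (measure_mono_null (fun p hp => ?_) hswap)
      simp only [mem_compl_iff, mem_ofPred_eq]
      exact fun hh => hcon ⟨p, hp, hh hp.2⟩
    rw [hU, mem_compl_iff, Measure.notMem_support_iff_exists]
    refine ⟨Q, hQ, ?_⟩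
    refine Measure.restrict_apply_eq_zero' hE.compl |>.2 ?_
    refine measure_mono_null (fun z hz => ?_) hp
    simp only [mem_compl_iff, mem_ofPred_eq]
    intro hh
    exact hz.2 (hh (hBQ (mk_mem_prod (hB' hpB) hz.1)))
  -- A translate of a point outside `W` by `γ(r' - r) ∈ C` is already in `U`, so each curve leaves
  -- `Wᶜ \ U` at once.
  have hD : μ (Wᶜ \ U) = 0 := by
    refine measure_eq_zero_of_mul_notMem μ (hWo.measurableSet.compl.diff hUo.measurableSet) hγ
      fun p r r' hr hD hD' => hD'.2 ?_
    have := hmono _ hD.1 (γ (r' - r)) (hγC _ (by linarith))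
    rwa [mul_assoc, ← hadd, add_sub_cancel] at this
  refine ⟨U, hUo, ?_, fun p hp q hq => hmono p (hdisj p hp) q hq⟩
  have hn : μ ((U ∩ Eᶜ) ∪ (W ∩ E) ∪ (Wᶜ \ U)) = 0 :=
    measure_union_null (measure_union_null hUE hWE) hD
  have hae : ∀ᵐ p ∂μ, p ∉ (U ∩ Eᶜ) ∪ (W ∩ E) ∪ (Wᶜ \ U) := measure_eq_zero_iff_ae_notMem.1 hn
  refine eventuallyEq_set.2 ?_
  filter_upwards [hae] with p hp
  simp only [mem_union, mem_inter_iff, mem_compl_iff, Set.mem_sdiff] at hp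
  tauto

end Semigroup

/-! ### Sets stable under an open cone of translations are Lipschitz domains. -/

section Cones

variable {F : Type*} [NormedAddCommGroup F] [NormedSpace ℝ F]

/-- Far along a direction of an open cone, every vector lies in the cone. -/
lemma exists_forall_add_smul_mem {C : Set F} (hC : IsOpen C)
    (hcone : ∀ c : ℝ, 0 < c → ∀ v ∈ C, c • v ∈ C) {ν : F} (hν : ν ∈ C) :
    ∃ K : NNReal, ∀ (v : F) (t : ℝ), K * ‖v‖ < t → v + t • ν ∈ C := by
  obtain ⟨ε, hε, hball⟩ := Metric.isOpen_iff.1 hC ν hν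
  -- With `ε` the radius of a ball around `ν` in `C`, the bound says that `ν + v / t` lies in that
  -- ball.
  refine ⟨⟨ε⁻¹, inv_nonneg.2 hε.le⟩, fun v t ht => ?_⟩
  change ε⁻¹ * ‖v‖ < t at ht
  have ht0 : 0 < t := lt_of_le_of_lt (by positivity) ht
  have h1 : t⁻¹ • v + ν ∈ C := hball (by
    rw [mem_ball_iff_norm, add_sub_cancel_right, norm_smul, norm_inv, Real.norm_of_nonneg ht0.le,
      inv_mul_lt_iff₀ ht0]
    rw [inv_mul_lt_iff₀ hε] at ht
    linarith)
  have h2 := hcone t ht0 _ h1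
  rwa [smul_add, smul_smul, mul_inv_cancel₀ ht0.ne', one_smul] at h2

lemma eq_Ioi_sInf {A : Set ℝ} (hA : IsOpen A) (hne : A.Nonempty) (hbdd : BddBelow A)
    (hup : ∀ t ∈ A, ∀ t', t < t' → t' ∈ A) : A = Ioi (sInf A) := by
  ext t
  constructor
  · intro ht
    obtain ⟨t', ht', h⟩ := (hA.mem_nhds ht |> exists_Ioc_subset_of_mem_nhds) (exists_lt t)
    have : (t' + t) / 2 ∈ A := h ⟨by linarith, by linarith⟩
    exact lt_of_le_of_lt (csInf_le hbdd this) (by linarith)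
  · intro ht
    obtain ⟨t', ht', h⟩ := exists_lt_of_csInf_lt hne ht
    exact hup t' ht' t h

/-- An open set that is stable under translations by an open cone is a Lipschitz domain. -/
theorem isEuclideanLipschitzDomain_of_cone {n : ℕ} {Ω C : Set (EuclideanSpace ℝ (Fin n))}
    (hΩ : IsOpen Ω) (hC : IsOpen C) (hne : C.Nonempty)
    (hcone : ∀ c : ℝ, 0 < c → ∀ v ∈ C, c • v ∈ C) (hadd : ∀ p ∈ Ω, ∀ v ∈ C, p + v ∈ Ω) :
    IsEuclideanLipschitzDomain Ω := by
  refine ⟨hΩ, fun p hp => ?_⟩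
  obtain ⟨a, haΩ⟩ : Ω.Nonempty := by
    by_contra h
    rw [not_nonempty_iff_eq_empty] at h
    simp [h] at hp
  obtain ⟨b, hbΩ⟩ : ∃ b, b ∉ Ω := by
    by_contra! h
    rw [← eq_univ_iff_forall] at h
    simp [h] at hp
  -- An open cone containing `0` is the whole space, which would force `Ω` to be everything.
  have h0 : (0 : EuclideanSpace ℝ (Fin n)) ∉ C := by
    intro h0
    obtain ⟨K, hK⟩ := exists_forall_add_smul_mem hC hcone h0
    have h1 := hK (b - a) (K * ‖b - a‖ + 1) (by linarith)
    have h2 := hadd a haΩ _ h1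
    rw [smul_zero, add_zero, add_sub_cancel] at h2
    exact hbΩ h2
  obtain ⟨u, hu⟩ := hne
  have hu0 : u ≠ 0 := fun h => h0 (h ▸ hu)
  obtain ⟨ν, hν, hν1⟩ : ∃ ν ∈ C, ‖ν‖ = 1 :=
    ⟨‖u‖⁻¹ • u, hcone _ (inv_pos.2 (norm_pos_iff.2 hu0)) u hu, norm_smul_inv_norm hu0⟩
  obtain ⟨K, hK⟩ := exists_forall_add_smul_mem hC hcone hν
  -- The slices of `Ω` along `ν` are open half-lines; their endpoints define the Lipschitz graph,
  -- with `K` as Lipschitz constant.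
  let A : EuclideanSpace ℝ (Fin n) → Set ℝ := fun z => {t | z + t • ν ∈ Ω}
  have hstep : ∀ z z' t t', t ∈ A z → K * ‖z' - z‖ < t' - t → t' ∈ A z' := by
    intro z z' t t' ht h
    have h1 := hadd _ ht _ (hK (z' - z) (t' - t) h)
    rw [show z + t • ν + (z' - z + (t' - t) • ν) = z' + t' • ν by module] at h1
    exact h1
  have hA : ∀ z, A z = Ioi (sInf (A z)) := by
    intro z
    refine eq_Ioi_sInf (hΩ.preimage (by fun_prop)) ?_ ?_ ?_
    · exact ⟨_, hstep a z 0 (K * ‖z - a‖ + 1) (by simpa [A] using haΩ) (by linarith)⟩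
    · refine ⟨-(K * ‖b - z‖ + 1), fun t ht => ?_⟩
      by_contra! hlt
      have := hstep z b t 0 ht (by linarith)
      exact hbΩ (by simpa [A] using this)
    · intro t ht t' h
      exact hstep z z t t' ht (by simpa using h)
  refine ⟨univ, ν, fun z => sInf (A z), K, isOpen_univ, mem_univ p, hν1, ?_, fun x _ => ?_⟩
  · refine LipschitzWith.of_le_add_mul K fun z z' => ?_
    refine le_of_forall_gt_imp_ge_of_dense fun t ht => ?_
    have h1 : t - K * dist z z' ∈ A z' := by
      rw [hA z', mem_Ioi]
      linarith
    by_contra! hlt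
    obtain ⟨t', ht1, ht2⟩ := exists_between hlt
    have h2 : t' ∈ A z := hstep z' z _ t' h1 (by
      have h3 : dist z z' = ‖(z : EuclideanSpace ℝ (Fin n)) - z'‖ := by
        rw [Subtype.dist_eq, dist_eq_norm]
      rw [← h3]
      linarith)
    rw [hA z, mem_Ioi] at h2
    exact lt_asymm h2 ht2
  · have h1 : (((ℝ ∙ ν)ᗮ.orthogonalProjectionOnto x : (ℝ ∙ ν)ᗮ) : EuclideanSpace ℝ (Fin n)) =
        x - inner ℝ ν x • ν := by
      rw [Submodule.orthogonalProjectionOnto_orthogonal]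
      exact congrArg (x - ·) (Submodule.starProjection_unit_singleton ℝ hν1 x)
    have h2 : inner ℝ ν x ∈ A ((ℝ ∙ ν)ᗮ.orthogonalProjectionOnto x) ↔ x ∈ Ω := by
      change _ + inner ℝ ν x • ν ∈ Ω ↔ x ∈ Ω
      rw [h1, sub_add_cancel]
    rw [← h2, hA, mem_Ioi]

end Cones

/-! ### Integrals of right translates of a compactly supported function. -/

section Dominated

variable {G : Type*} [TopologicalSpace G] [Group G] [IsTopologicalGroup G] [T2Space G]
  [MeasurableSpace G] [BorelSpace G]

open scoped Pointwise in
-- The translates by `g ∈ L` are all supported in the compact set `tsupport f * L⁻¹`; this bound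
-- serves dominated convergence and differentiation under the integral.
lemma exists_integrable_bound (μ : Measure G) [IsFiniteMeasureOnCompacts μ] {f : G → ℝ}
    (hf : Continuous f) (hs : HasCompactSupport f) {L : Set G} (hL : IsCompact L) :
    ∃ b : G → ℝ, Integrable b μ ∧ ∀ g ∈ L, ∀ p, ‖f (p * g)‖ ≤ b p := by
  obtain ⟨M, hM⟩ := hs.exists_bound_of_continuous hf
  have hK : IsCompact (tsupport f * L⁻¹) := IsCompact.mul hs hL.inv
  refine ⟨(tsupport f * L⁻¹).indicator (fun _ => M), ?_, fun g hg p => ?_⟩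
  · rw [integrable_indicator_iff hK.measurableSet]
    exact integrableOn_const hK.measure_lt_top.ne
  · by_cases hp : p * g ∈ tsupport f
    · have h1 : p ∈ tsupport f * L⁻¹ := ⟨p * g, hp, g⁻¹, inv_mem_inv.2 hg, by simp⟩
      rw [indicator_of_mem h1]
      exact hM _
    · rw [image_eq_zero_of_notMem_tsupport hp, norm_zero]
      refine indicator_nonneg (fun _ _ => ?_) _
      exact (norm_nonneg _).trans (hM 1)

lemma continuous_integral_mul_right [SecondCountableTopology G] [LocallyCompactSpace G]
    (μ : Measure G) [IsFiniteMeasureOnCompacts μ] (E : Set G) {f : G → ℝ} (hf : Continuous f)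
    (hs : HasCompactSupport f) : Continuous (fun g => ∫ p in E, f (p * g) ∂μ) := by
  rw [continuous_iff_continuousAt]
  intro g
  obtain ⟨L, hL, hgL⟩ := exists_compact_mem_nhds g
  obtain ⟨b, hb, hbound⟩ := exists_integrable_bound μ hf hs hL
  refine continuousAt_of_dominated (bound := b) ?_ ?_ hb.integrableOn ?_
  · exact Eventually.of_forall fun g => (hf.comp (continuous_mul_const g)).aestronglyMeasurable
  · filter_upwards [hgL] with g hg
    exact Eventually.of_forall fun p => hbound g hg p
  · exact Eventually.of_forall fun p => (hf.comp (continuous_const_mul p)).continuousAt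

end Dominated

/-! ### Derivatives along left-invariant fields. -/

section LeftDeriv

variable {n : ℕ} {G : Type*} [TopologicalSpace G] [ChartedSpace (EuclideanSpace ℝ (Fin n)) G]
  [Group G]

lemma leftDeriv_add (X Y : GroupLieAlgebra (𝓡 n) G) (φ : G → ℝ) (p : G) :
    leftDeriv (X + Y) φ p = leftDeriv X φ p + leftDeriv Y φ p := by
  rw [leftDeriv, mulInvariantVectorField_add]
  exact map_add _ _ _

lemma leftDeriv_smul (c : ℝ) (X : GroupLieAlgebra (𝓡 n) G) (φ : G → ℝ) (p : G) :
    leftDeriv (c • X) φ p = c * leftDeriv X φ p := by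
  have h : mulInvariantVectorField (c • X) p = c • mulInvariantVectorField X p :=
    map_smul (mfderiv (𝓡 n) (𝓡 n) (fun x => p * x) 1) c X
  rw [leftDeriv, h]
  exact map_smul _ _ _

lemma leftDeriv_eq_zero (X : GroupLieAlgebra (𝓡 n) G) {φ : G → ℝ} {p : G} (hp : p ∉ tsupport φ) :
    leftDeriv X φ p = 0 := by
  have h : φ =ᶠ[𝓝 p] fun _ => 0 := notMem_tsupport_iff_eventuallyEq.1 hp
  rw [leftDeriv, h.mfderiv_eq, mfderiv_const]
  rfl

lemma hasCompactSupport_leftDeriv (X : GroupLieAlgebra (𝓡 n) G) {φ : G → ℝ}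
    (hφ : HasCompactSupport φ) : HasCompactSupport (leftDeriv X φ) :=
  hφ.mono' fun _ hp => by_contra fun h => hp (leftDeriv_eq_zero X h)

variable [LieGroup (𝓡 n) ∞ G]

lemma continuous_leftDeriv (X : GroupLieAlgebra (𝓡 n) G) {φ : G → ℝ}
    (hφ : ContMDiff (𝓡 n) 𝓘(ℝ, ℝ) ∞ φ) : Continuous (leftDeriv X φ) := by
  have : IsManifold (𝓡 n) 1 G := IsManifold.of_le (n := ∞) (by simp)
  have h1 : Continuous (tangentMap (𝓡 n) 𝓘(ℝ, ℝ) φ) :=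
    (hφ.contMDiff_tangentMap (m := 0) (by simp)).continuous
  have h2 := h1.comp (contMDiff_mulInvariantVectorField_one X).continuous
  exact (contMDiff_snd_tangentBundle_modelSpace (n := 0) ℝ 𝓘(ℝ, ℝ)).continuous.comp h2

variable [T2Space G]

lemma hasDerivAt_comp_oneParam (X : GroupLieAlgebra (𝓡 n) G) {φ : G → ℝ}
    (hφ : ContMDiff (𝓡 n) 𝓘(ℝ, ℝ) ∞ φ) (p : G) (t : ℝ) :
    HasDerivAt (fun r => φ (p * oneParam X r)) (leftDeriv X φ (p * oneParam X t)) t := by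
  have h1 : HasMFDerivAt 𝓘(ℝ, ℝ) (𝓡 n) (fun r => p * oneParam X r) t
      ((1 : ℝ →L[ℝ] ℝ).smulRight (mulInvariantVectorField X (p * oneParam X t))) := by
    have := IsMIntegralCurveOn.mul_left ((isMIntegralCurve_oneParam X).isMIntegralCurveOn univ) p t
      (mem_univ t)
    exact hasMFDerivWithinAt_univ.1 this
  have h2 := ((hφ.mdifferentiable (by simp)) (p * oneParam X t)).hasMFDerivAt.comp t h1
  have h3 : HasFDerivAt (E := ℝ) (F := ℝ) (fun r => φ (p * oneParam X r))
      ((1 : ℝ →L[ℝ] ℝ).smulRight (leftDeriv X φ (p * oneParam X t))) t :=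
    hasMFDerivAt_iff_hasFDerivAt.1 (h2.congr_mfderiv
      (comp_smulRight_one (E := EuclideanSpace ℝ (Fin n)) (F := ℝ) _ _))
  simpa using h3.hasDerivAt

/-- The field of `X` generates right translations by `exp (r X)`, which commute with right
translation by `exp (t X)`. -/
lemma leftDeriv_comp_mul_oneParam (X : GroupLieAlgebra (𝓡 n) G) {φ : G → ℝ}
    (hφ : ContMDiff (𝓡 n) 𝓘(ℝ, ℝ) ∞ φ) (p : G) (t : ℝ) :
    leftDeriv X (fun q => φ (q * oneParam X t)) p = leftDeriv X φ (p * oneParam X t) := by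
  have h1 := hasDerivAt_comp_oneParam X (φ := fun q => φ (q * oneParam X t))
    (hφ.comp contMDiff_mul_right) p 0
  have h2 := hasDerivAt_comp_oneParam X hφ (p * oneParam X t) 0
  simp only [oneParam_zero, mul_one] at h1 h2
  have h3 : ∀ r, p * oneParam X r * oneParam X t = p * oneParam X t * oneParam X r := fun r => by
    rw [mul_assoc, mul_assoc, ← oneParam_add, ← oneParam_add, add_comm]
  simp only [h3] at h1
  exact h1.unique h2

end LeftDeriv

/-! ### Monotone and invariant directions as elements of a closed monoid. -/

section Directions

variable {n : ℕ} {G : Type*} [TopologicalSpace G] [ChartedSpace (EuclideanSpace ℝ (Fin n)) G]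
  [Group G] [LieGroup (𝓡 n) ∞ G]

lemma IsTestFunction.comp_mul_right {φ : G → ℝ} (hφ : IsTestFunction n φ) (g : G) :
    IsTestFunction n (fun p => φ (p * g)) := by
  have : IsTopologicalGroup G := topologicalGroup_of_lieGroup (𝓡 n) ∞
  exact ⟨hφ.contMDiff.comp contMDiff_mul_right,
    hφ.hasCompactSupport.comp_homeomorph (Homeomorph.mulRight g), fun p => hφ.nonneg _⟩

variable [MeasurableSpace G] (μ : Measure G)

variable (n) in
/-- The elements whose right translations enlarge `E` in the sense of distributions. -/
def growthMonoid (E : Set G) : Submonoid G where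
  carrier := {g | ∀ φ : G → ℝ, IsTestFunction n φ →
    ∫ p in E, φ (p * g) ∂μ ≤ ∫ p in E, φ p ∂μ}
  one_mem' φ _ := by simp
  mul_mem' {g h} hg hh φ hφ := by
    have h1 := hg _ (hφ.comp_mul_right h)
    simp only [mul_assoc] at h1
    exact h1.trans (hh φ hφ)

lemma mem_growthMonoid {E : Set G} {g : G} : g ∈ growthMonoid n μ E ↔
    ∀ φ : G → ℝ, IsTestFunction n φ → ∫ p in E, φ (p * g) ∂μ ≤ ∫ p in E, φ p ∂μ := Iff.rfl

variable [BorelSpace G] [T2Space G] [IsFiniteMeasureOnCompacts μ]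

lemma isClosed_growthMonoid [SecondCountableTopology G] (E : Set G) :
    IsClosed (growthMonoid n μ E : Set G) := by
  have : IsTopologicalGroup G := topologicalGroup_of_lieGroup (𝓡 n) ∞
  have : LocallyCompactSpace G := Manifold.locallyCompact_of_finiteDimensional (𝓡 n)
  have h : (growthMonoid n μ E : Set G) = ⋂ (φ : G → ℝ) (_ : IsTestFunction n φ),
      {g | ∫ p in E, φ (p * g) ∂μ ≤ ∫ p in E, φ p ∂μ} := by
    ext g
    simp [mem_growthMonoid]
  rw [h]
  refine isClosed_iInter fun φ => isClosed_iInter fun hφ => ?_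
  exact isClosed_le (continuous_integral_mul_right μ E hφ.contMDiff.continuous
    hφ.hasCompactSupport) continuous_const

variable {μ} {E : Set G}

lemma hasDerivAt_setIntegral_mul_oneParam [SecondCountableTopology G]
    (X : GroupLieAlgebra (𝓡 n) G) {φ : G → ℝ} (hφ : IsTestFunction n φ) (t : ℝ) :
    HasDerivAt (fun r => ∫ p in E, φ (p * oneParam X r) ∂μ)
      (∫ p in E, leftDeriv X φ (p * oneParam X t) ∂μ) t := by
  have : IsTopologicalGroup G := topologicalGroup_of_lieGroup (𝓡 n) ∞
  have hL : IsCompact (oneParam X '' Icc (t - 1) (t + 1)) :=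
    isCompact_Icc.image (continuous_oneParam X)
  have hφc := hφ.contMDiff.continuous
  have hdc := continuous_leftDeriv X hφ.contMDiff
  obtain ⟨b, hb, hbound⟩ := exists_integrable_bound μ hdc
    (hasCompactSupport_leftDeriv X hφ.hasCompactSupport) hL
  have hs : Icc (t - 1) (t + 1) ∈ 𝓝 t := Icc_mem_nhds (by linarith) (by linarith)
  refine (hasDerivAt_integral_of_dominated_loc_of_deriv_le (bound := b)
    (F := fun r p => φ (p * oneParam X r)) (F' := fun r p => leftDeriv X φ (p * oneParam X r)) hs ?_ ?_ ?_ ?_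
    hb.integrableOn ?_).2
  · exact Eventually.of_forall fun r => (hφc.comp (continuous_mul_const _)).aestronglyMeasurable
  · refine Integrable.integrableOn ?_
    exact (hφc.comp (continuous_mul_const _)).integrable_of_hasCompactSupport
      (hφ.comp_mul_right _).hasCompactSupport
  · exact (hdc.comp (continuous_mul_const _)).aestronglyMeasurable
  · exact Eventually.of_forall fun p r hr => hbound _ (mem_image_of_mem _ hr) p
  · exact Eventually.of_forall fun p r _ => hasDerivAt_comp_oneParam X hφ.contMDiff p r

/-- The derivative of `r ↦ ∫_E φ(p exp (rX))` is `∫_E Xψ`, where `ψ` is a right translate of `φ` and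
again a test function. So monotonicity means that all these functions decrease; the converse takes
the right derivative at `0`. -/
lemma isMonotoneDirection_iff [SecondCountableTopology G] (X : GroupLieAlgebra (𝓡 n) G) :
    IsMonotoneDirection μ E X ↔ ∀ r, 0 ≤ r → oneParam X r ∈ growthMonoid n μ E := by
  constructor
  · intro h r hr φ hφ
    have h1 : Antitone (fun r => ∫ p in E, φ (p * oneParam X r) ∂μ) := by
      refine antitone_of_deriv_nonpos
        (fun t => (hasDerivAt_setIntegral_mul_oneParam X hφ t).differentiableAt) fun t => ?_
      rw [(hasDerivAt_setIntegral_mul_oneParam X hφ t).deriv]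
      have h2 := h _ (hφ.comp_mul_right (oneParam X t))
      simp only [leftDeriv_comp_mul_oneParam X hφ.contMDiff] at h2
      linarith
    simpa using h1 hr
  · intro h φ hφ
    have h1 := hasDerivAt_setIntegral_mul_oneParam (μ := μ) (E := E) X hφ 0
    simp only [oneParam_zero, mul_one] at h1
    have h2 : ∫ p in E, leftDeriv X φ p ∂μ ≤ 0 := by
      have h3 := (hasDerivWithinAt_iff_tendsto_slope' (s := Ioi 0) (by simp)).1
        h1.hasDerivWithinAt
      refine le_of_tendsto h3 ?_
      filter_upwards [self_mem_nhdsWithin] with r hr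
      have h4 := h r (le_of_lt hr) φ hφ
      rw [slope_def_field]
      refine div_nonpos_of_nonpos_of_nonneg ?_ (by simpa using le_of_lt hr)
      simpa using h4
    linarith

omit [T2Space G] in
lemma integrable_leftDeriv (X : GroupLieAlgebra (𝓡 n) G) {φ : G → ℝ}
    (hφ : IsTestFunction n φ) : Integrable (leftDeriv X φ) μ :=
  (continuous_leftDeriv X hφ.contMDiff).integrable_of_hasCompactSupport
    (hasCompactSupport_leftDeriv X hφ.hasCompactSupport)

omit [T2Space G] in
lemma IsMonotoneDirection.add {X Y : GroupLieAlgebra (𝓡 n) G} (hX : IsMonotoneDirection μ E X)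
    (hY : IsMonotoneDirection μ E Y) : IsMonotoneDirection μ E (X + Y) := by
  intro φ hφ
  simp only [leftDeriv_add]
  rw [integral_add (integrable_leftDeriv X hφ).integrableOn (integrable_leftDeriv Y hφ).integrableOn]
  linarith [hX φ hφ, hY φ hφ]

omit [LieGroup (𝓡 n) ∞ G] [BorelSpace G] [T2Space G] [IsFiniteMeasureOnCompacts μ] in
lemma IsMonotoneDirection.smul {X : GroupLieAlgebra (𝓡 n) G} (hX : IsMonotoneDirection μ E X)
    {c : ℝ} (hc : 0 ≤ c) : IsMonotoneDirection μ E (c • X) := by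
  intro φ hφ
  simp only [leftDeriv_smul]
  rw [integral_const_mul, ← mul_neg]
  exact mul_nonneg hc (hX φ hφ)

omit [LieGroup (𝓡 n) ∞ G] [BorelSpace G] [T2Space G] [IsFiniteMeasureOnCompacts μ] in
lemma IsInvariantDirection.smul {X : GroupLieAlgebra (𝓡 n) G} (hX : IsInvariantDirection μ E X)
    (c : ℝ) : IsInvariantDirection μ E (c • X) := by
  intro φ hφ
  simp only [leftDeriv_smul]
  rw [integral_const_mul, hX φ hφ, mul_zero]

omit [LieGroup (𝓡 n) ∞ G] [BorelSpace G] [T2Space G] [IsFiniteMeasureOnCompacts μ] in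
lemma IsInvariantDirection.isMonotoneDirection {X : GroupLieAlgebra (𝓡 n) G}
    (hX : IsInvariantDirection μ E X) : IsMonotoneDirection μ E X := by
  intro φ hφ
  rw [hX φ hφ, neg_zero]

lemma IsInvariantDirection.oneParam_mem [SecondCountableTopology G] {X : GroupLieAlgebra (𝓡 n) G}
    (hX : IsInvariantDirection μ E X) (r : ℝ) : oneParam X r ∈ growthMonoid n μ E := by
  have h := (isMonotoneDirection_iff (μ := μ) (E := E) (r • X)).1
    (hX.smul r).isMonotoneDirection 1 zero_le_one
  rwa [oneParam_smul, mul_one] at h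

omit [LieGroup (𝓡 n) ∞ G] [BorelSpace G] [T2Space G] [IsFiniteMeasureOnCompacts μ] in
lemma IsMonotoneDirection.congr_set {E' : Set G} {X : GroupLieAlgebra (𝓡 n) G}
    (hX : IsMonotoneDirection μ E X) (h : E =ᵐ[μ] E') : IsMonotoneDirection μ E' X := by
  intro φ hφ
  rw [← setIntegral_congr_set h]
  exact hX φ hφ

omit [LieGroup (𝓡 n) ∞ G] [BorelSpace G] [T2Space G] [IsFiniteMeasureOnCompacts μ] in
lemma IsInvariantDirection.congr_set {E' : Set G} {X : GroupLieAlgebra (𝓡 n) G}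
    (hX : IsInvariantDirection μ E X) (h : E =ᵐ[μ] E') : IsInvariantDirection μ E' X := by
  intro φ hφ
  rw [← setIntegral_congr_set h]
  exact hX φ hφ

variable [SecondCountableTopology G]

/-- Measures are compared by their values on nonnegative smooth test functions. -/
lemma measure_le_of_forall_integral_le {μ₁ μ₂ : Measure G} [IsFiniteMeasureOnCompacts μ₁]
    [IsFiniteMeasureOnCompacts μ₂]
    (h : ∀ φ : G → ℝ, IsTestFunction n φ → ∫ p, φ p ∂μ₁ ≤ ∫ p, φ p ∂μ₂)
    {A : Set G} (hA : MeasurableSet A) : μ₁ A ≤ μ₂ A := by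
  have : IsTopologicalGroup G := topologicalGroup_of_lieGroup (𝓡 n) ∞
  have : LocallyCompactSpace G := Manifold.locallyCompact_of_finiteDimensional (𝓡 n)
  have : IsManifold (𝓡 n) ∞ G := inferInstance
  have : SigmaCompactSpace G := inferInstance
  have hcomp : ∀ K : Set G, IsCompact K → μ₁ K ≤ μ₂ K := by
    intro K hK
    refine le_of_forall_gt fun r hr => ?_
    obtain ⟨V, hKV, hV, hVr⟩ := K.exists_isOpen_lt_of_lt r hr
    obtain ⟨L, hL, hKL⟩ := exists_compact_superset hK
    -- A smooth function between the indicators of `K` and of `V ∩ interior L`; `L` makes its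
    -- support compact.
    obtain ⟨φ, hφ, hφ01, hsupp, hone⟩ := exists_contMDiff_support_eq_eq_one_iff (𝓡 n) (n := ⊤)
      (hV.inter isOpen_interior) hK.isClosed (subset_inter hKV hKL)
    have htest : IsTestFunction n φ := by
      refine ⟨hφ, ?_, fun p => (hφ01 (mem_range_self p)).1⟩
      refine HasCompactSupport.of_support_subset_isCompact hL ?_
      rw [hsupp]
      exact inter_subset_right.trans interior_subset
    have hW : MeasurableSet (V ∩ interior L) := (hV.inter isOpen_interior).measurableSet
    have hWfin : ∀ (m : Measure G) [IsFiniteMeasureOnCompacts m], m (V ∩ interior L) < ⊤ :=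
      fun m _ => (measure_mono (inter_subset_right.trans interior_subset)).trans_lt
        hL.measure_lt_top
    have h1 : μ₁.real K ≤ ∫ p, φ p ∂μ₁ := by
      rw [← integral_indicator_one hK.measurableSet]
      refine integral_mono ?_ (hφ.continuous.integrable_of_hasCompactSupport
        htest.hasCompactSupport) fun p => ?_
      · exact (integrable_indicator_iff hK.measurableSet).2
          (integrableOn_const hK.measure_lt_top.ne)
      · by_cases hp : p ∈ K
        · simp [hp, (hone p).1 hp]
        · simp [hp, htest.nonneg p]
    have h2 : ∫ p, φ p ∂μ₂ ≤ μ₂.real (V ∩ interior L) := by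
      rw [← integral_indicator_one hW]
      refine integral_mono (hφ.continuous.integrable_of_hasCompactSupport
        htest.hasCompactSupport) ?_ fun p => ?_
      · exact (integrable_indicator_iff hW).2 (integrableOn_const (hWfin μ₂).ne)
      · by_cases hp : p ∈ V ∩ interior L
        · simpa [hp] using (hφ01 (mem_range_self p)).2
        · have : φ p = 0 := by rw [← Function.notMem_support, hsupp]; exact hp
          simp [hp, this]
    have h3 : μ₁ K ≤ μ₂ (V ∩ interior L) :=
      (ENNReal.toReal_le_toReal hK.measure_lt_top.ne (hWfin μ₂).ne).1
        (h1.trans ((h φ htest).trans h2))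
    exact (h3.trans (measure_mono inter_subset_left)).trans_lt hVr
  rw [hA.measure_eq_iSup_isCompact]
  refine iSup₂_le fun K hKA => iSup_le fun hK => ?_
  exact (hcomp K hK).trans (measure_mono hKA)

/-- Distributional growth implies growth up to null sets. -/
lemma ae_imp_mul_mem_of_mem_growthMonoid [μ.IsMulRightInvariant] (hE : MeasurableSet E) {g : G}
    (hg : g ∈ growthMonoid n μ E) : ∀ᵐ p ∂μ, p ∈ E → p * g ∈ E := by
  have : IsTopologicalGroup G := topologicalGroup_of_lieGroup (𝓡 n) ∞
  have : LocallyCompactSpace G := Manifold.locallyCompact_of_finiteDimensional (𝓡 n)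
  set E' : Set G := (fun p => p * g⁻¹) ⁻¹' E with hE'
  have hE'm : MeasurableSet E' := (measurable_mul_const g⁻¹) hE
  have h1 : ∀ φ : G → ℝ, IsTestFunction n φ →
      ∫ p, φ p ∂(μ.restrict E') ≤ ∫ p, φ p ∂(μ.restrict E) := by
    intro φ hφ
    have h2 := hg φ hφ
    have h3 : ∫ p in E, φ (p * g) ∂μ = ∫ p in E', φ p ∂μ := by
      rw [← (measurePreserving_mul_right μ g).setIntegral_preimage_emb
        (measurableEmbedding_mulRight g) φ E']
      congr 2
      simp [hE', preimage_preimage]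
    rwa [h3] at h2
  -- On `E' \ E` the restriction to `E'` is all of `μ`, while the restriction to `E` is zero.
  have h2 := measure_le_of_forall_integral_le h1 (hE'm.diff hE)
  rw [Measure.restrict_apply (hE'm.diff hE), Measure.restrict_apply (hE'm.diff hE)] at h2
  have h3 : (E' \ E) ∩ E = ∅ := by
    ext p
    simp
  rw [h3, measure_empty, inter_eq_left.2 sdiff_subset] at h2
  have h4 : ∀ᵐ p ∂μ, p ∉ E' \ E := measure_eq_zero_iff_ae_notMem.1 (le_antisymm h2 bot_le)
  have h5 : ∀ᵐ p ∂μ, p * g ∉ E' \ E :=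
    (measurePreserving_mul_right μ g).quasiMeasurePreserving.ae h4
  filter_upwards [h5] with p hp hpE
  by_contra hcon
  exact hp ⟨by simpa [hE'] using hpE, hcon⟩

end Directions

/-! ### The moment curve and the convex cones containing it. -/

section Moments

/-- The vector of divided powers of `t`. -/
noncomputable def powVec (s : ℕ) (t : ℝ) : Fin s → ℝ := fun i => t ^ i.val / i.val.factorial

lemma shiftExp_col_zero {s : ℕ} (hs : 0 < s) (t : ℝ) :
    (fun i : Fin s => shiftExp s t i ⟨0, hs⟩) = powVec s t := by
  ext i
  have : (⟨0, hs⟩ : Fin s) ≤ i := Nat.zero_le _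
  simp [shiftExp, powVec, this]

lemma det_powVec_ne_zero {s : ℕ} {t : Fin s → ℝ} (ht : Function.Injective t) :
    (Matrix.of fun i j : Fin s => powVec s (t j) i).det ≠ 0 := by
  have h : (Matrix.of fun i j : Fin s => powVec s (t j) i) =
      Matrix.diagonal (fun i : Fin s => ((i.val.factorial : ℝ))⁻¹) *
        (Matrix.vandermonde t).transpose := by
    ext i j
    simp [powVec, Matrix.diagonal_mul, Matrix.vandermonde_apply, div_eq_inv_mul]
  rw [h, Matrix.det_mul, Matrix.det_diagonal, Matrix.det_transpose]
  refine mul_ne_zero (Finset.prod_ne_zero_iff.2 fun i _ => ?_)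
    (Matrix.det_vandermonde_ne_zero_iff.2 ht)
  exact inv_ne_zero (Nat.cast_ne_zero.2 (Nat.factorial_ne_zero _))

lemma mulVec_powVec {s : ℕ} (t r : Fin s → ℝ) :
    (Matrix.of fun i j : Fin s => powVec s (t j) i).mulVec r = ∑ j, r j • powVec s (t j) := by
  ext i
  simp [Matrix.mulVec, dotProduct, mul_comm]

/-- A convex cone containing all the vectors of divided powers has nonempty interior. -/
lemma interior_nonempty_of_powVec_mem {s : ℕ} {T : Set (Fin s → ℝ)} (h0 : (0 : Fin s → ℝ) ∈ T)
    (hadd : ∀ y ∈ T, ∀ z ∈ T, y + z ∈ T) (hsmul : ∀ c : ℝ, 0 ≤ c → ∀ y ∈ T, c • y ∈ T)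
    (hpow : ∀ t, powVec s t ∈ T) : (interior T).Nonempty := by
  -- Any `s` distinct parameters would do: the positive combinations of the corresponding vectors
  -- form an open simplicial cone inside `T`.
  let t : Fin s → ℝ := fun j => (j.val : ℝ)
  have ht : Function.Injective t := fun i j h => Fin.ext (Nat.cast_injective h)
  set A : Matrix (Fin s) (Fin s) ℝ := Matrix.of fun i j : Fin s => powVec s (t j) i with hA
  have hdet : IsUnit A.det := (det_powVec_ne_zero ht).isUnit
  have hcomb : ∀ r : Fin s → ℝ, (∀ j, 0 ≤ r j) → A.mulVec r ∈ T := by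
    intro r hr
    rw [mulVec_powVec]
    exact Finset.sum_induction _ (· ∈ T) (fun y z hy hz => hadd y hy z hz) h0
      fun j _ => hsmul _ (hr j) _ (hpow _)
  have hopen : IsOpen {y : Fin s → ℝ | ∀ j, 0 < (A⁻¹).mulVec y j} := by
    simp only [ofPred_forall]
    refine isOpen_iInter_of_finite fun j => isOpen_lt continuous_const ?_
    exact (continuous_apply j).comp (continuous_const.matrix_mulVec continuous_id)
  refine ⟨A.mulVec 1, interior_maximal (fun y hy => ?_) hopen ?_⟩
  · have := hcomb ((A⁻¹).mulVec y) fun j => (hy j).le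
    rwa [Matrix.mulVec_mulVec, Matrix.mul_nonsing_inv A hdet, Matrix.one_mulVec] at this
  · intro j
    rw [Matrix.mulVec_mulVec, Matrix.nonsing_inv_mul A hdet, Matrix.one_mulVec]
    exact one_pos

lemma shiftExp_neg_mulVec (s : ℕ) (x : ℝ) (y : Fin s → ℝ) :
    (shiftExp s (-x)).mulVec ((shiftExp s x).mulVec y) = y := by
  rw [Matrix.mulVec_mulVec, ← shiftExp_add, neg_add_cancel, shiftExp_zero, Matrix.one_mulVec]

lemma shiftExp_mulVec_mem_interior {s : ℕ} {T : Set (Fin s → ℝ)}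
    (hT : ∀ x, ∀ y ∈ T, (shiftExp s x).mulVec y ∈ T) (x : ℝ) {y : Fin s → ℝ}
    (hy : y ∈ interior T) : (shiftExp s x).mulVec y ∈ interior T := by
  have hc : ∀ x, Continuous fun y : Fin s → ℝ => (shiftExp s x).mulVec y := fun x =>
    continuous_const.matrix_mulVec continuous_id
  have h : interior T ⊆ interior ((fun y => (shiftExp s x).mulVec y) ⁻¹' T) :=
    interior_mono fun y hy => hT x y hy
  refine interior_maximal (s := T)
    (t := (fun z => (shiftExp s (-x)).mulVec z) ⁻¹' interior T) ?_
    (isOpen_interior.preimage (hc _)) ?_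
  · intro z hz
    have h1 := hT x _ (interior_subset hz)
    have h2 := shiftExp_neg_mulVec s (-x) z
    rw [neg_neg] at h2
    rwa [h2] at h1
  · change (shiftExp s (-x)).mulVec ((shiftExp s x).mulVec y) ∈ interior T
    rwa [shiftExp_neg_mulVec]

lemma smul_mem_interior {F : Type*} [NormedAddCommGroup F] [NormedSpace ℝ F] {T : Set F}
    (hT : ∀ c : ℝ, 0 ≤ c → ∀ y ∈ T, c • y ∈ T) {c : ℝ} (hc : 0 < c) {y : F}
    (hy : y ∈ interior T) : c • y ∈ interior T := by
  refine interior_maximal (t := (fun z => c⁻¹ • z) ⁻¹' interior T) ?_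
    (isOpen_interior.preimage (continuous_const_smul _)) ?_
  · intro z hz
    have h1 := hT c hc.le _ (interior_subset hz)
    rwa [smul_smul, mul_inv_cancel₀ hc.ne', one_smul] at h1
  · change c⁻¹ • c • y ∈ interior T
    rwa [smul_smul, inv_mul_cancel₀ hc.ne', one_smul]

end Moments

/-! ### The case where `X 0` is invariant. -/

section Cases

variable {s : ℕ} {G : Type*} [TopologicalSpace G]
  [ChartedSpace (EuclideanSpace ℝ (Fin (s + 1))) G]
  [Group G] [LieGroup (𝓡 (s + 1)) ∞ G] [T2Space G] [SecondCountableTopology G]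
  {X : ℕ → GroupLieAlgebra (𝓡 (s + 1)) G}

omit [SecondCountableTopology G] in
lemma IsFrame.Ad_oneParam_one (hX : IsFrame s X) (hs : 0 < s) (t : ℝ) :
    Ad (oneParam (X 0) t) (X 1) = hvec X (powVec s t) := by
  rw [← shiftExp_col_zero hs]
  exact hX.Ad_oneParam t ⟨0, hs⟩

omit [SecondCountableTopology G] in
lemma IsFrame.linearIndependent_cons (hX : IsFrame s X)
    (hb : LinearIndependent ℝ (fun i : Fin (s + 1) => X i.val)) (hs : 0 < s) {t : Fin s → ℝ}
    (ht : Function.Injective t) :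
    LinearIndependent ℝ (Fin.cons (X 0) (fun j => Ad (oneParam (X 0) (t j)) (X 1)) :
      Fin (s + 1) → GroupLieAlgebra (𝓡 (s + 1)) G) := by
  rw [Fintype.linearIndependent_iff]
  intro g hg
  rw [Fin.sum_univ_succ] at hg
  simp only [Fin.cons_zero, Fin.cons_succ, hX.Ad_oneParam_one hs] at hg
  have h1 : ∑ j : Fin s, g j.succ • hvec X (powVec s (t j)) =
      hvec X (∑ j : Fin s, g j.succ • powVec s (t j)) := by
    have : ∀ S : Finset (Fin s), ∑ j ∈ S, g j.succ • hvec X (powVec s (t j)) =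
        hvec X (∑ j ∈ S, g j.succ • powVec s (t j)) := by
      intro S
      induction S using Finset.induction_on with
      | empty => simp [hvec]
      | insert a S ha ih => rw [Finset.sum_insert ha, Finset.sum_insert ha, ih, hvec_add, hvec_smul]
    exact this _
  rw [h1] at hg
  have h2 := Fintype.linearIndependent_iff.1 hb
    (Fin.cons (g 0) (∑ j : Fin s, g j.succ • powVec s (t j))) (by
      rw [Fin.sum_univ_succ]
      simpa [hvec] using hg)
  have h3 : (Matrix.of fun i j : Fin s => powVec s (t j) i).mulVec (fun j => g j.succ) = 0 := by
    rw [mulVec_powVec]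
    ext i
    exact h2 i.succ
  have h4 := Matrix.eq_zero_of_mulVec_eq_zero (det_powVec_ne_zero ht) h3
  intro i
  refine Fin.cases (h2 0) (fun j => congrFun h4 j) i

variable [MeasurableSpace G] [BorelSpace G] {μ : Measure G} [μ.IsHaarMeasure] {E : Set G}

/-- Invariance of `Y` puts both `exp (tY)` and its inverse in the monoid, so the monoid is stable
under conjugation by `exp (tY)`. -/
lemma IsMonotoneDirection.Ad_oneParam {Y Z : GroupLieAlgebra (𝓡 (s + 1)) G}
    (hY : IsInvariantDirection μ E Y) (hZ : IsMonotoneDirection μ E Z) (t : ℝ) :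
    IsMonotoneDirection μ E (Ad (oneParam Y t) Z) := by
  rw [isMonotoneDirection_iff] at hZ ⊢
  intro r hr
  rw [← conj_oneParam, ← oneParam_neg]
  exact mul_mem (mul_mem (hY.oneParam_mem t) (hZ r hr)) (hY.oneParam_mem (-t))

variable [SimplyConnectedSpace G]

omit [SecondCountableTopology G] [MeasurableSpace G] [BorelSpace G] in
lemma IsFrame.coordMap_symm (hX : IsFrame s X)
    (hb : LinearIndependent ℝ (fun i : Fin (s + 1) => X i.val)) (g : G) :
    coordMap X ((hX.coordEquiv hb).symm g) = g := (hX.coordEquiv hb).apply_symm_apply g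

omit [SecondCountableTopology G] [MeasurableSpace G] [BorelSpace G] in
lemma IsFrame.symm_coordMap (hX : IsFrame s X)
    (hb : LinearIndependent ℝ (fun i : Fin (s + 1) => X i.val)) (p : ℝ × (Fin s → ℝ)) :
    (hX.coordEquiv hb).symm (coordMap X p) = p := (hX.coordEquiv hb).symm_apply_apply p

omit [SecondCountableTopology G] [MeasurableSpace G] [BorelSpace G] in
/-- In global coordinates, an open set that is stable under coordinate translations by an open cone
is a Lipschitz domain. -/
lemma IsFrame.isLipschitzDomain (hX : IsFrame s X)
    (hb : LinearIndependent ℝ (fun i : Fin (s + 1) => X i.val)) {U : Set G} (hU : IsOpen U)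
    {C : Set (ℝ × (Fin s → ℝ))} (hC : IsOpen C) (hne : C.Nonempty)
    (hcone : ∀ c : ℝ, 0 < c → ∀ v ∈ C, c • v ∈ C)
    (hadd : ∀ p, coordMap X p ∈ U → ∀ v ∈ C, coordMap X (p + v) ∈ U) :
    IsLipschitzDomain (s + 1) U := by
  refine ⟨hX.diffeo hb, ?_⟩
  have himage : (hX.diffeo hb) '' U = consEquiv s '' (coordMap X ⁻¹' U) := by
    ext z
    constructor
    · rintro ⟨g, hg, rfl⟩
      exact ⟨(hX.coordEquiv hb).symm g, by rwa [mem_preimage, hX.coordMap_symm], rfl⟩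
    · rintro ⟨p, hp, rfl⟩
      refine ⟨coordMap X p, hp, ?_⟩
      change consEquiv s ((hX.coordEquiv hb).symm (coordMap X p)) = _
      rw [hX.symm_coordMap]
  rw [himage]
  -- Any linear isomorphism suffices here, as it maps open cones to open cones.
  refine isEuclideanLipschitzDomain_of_cone (C := consEquiv s '' C) ?_ ?_ (hne.image _) ?_ ?_
  · exact (consEquiv s).toHomeomorph.isOpenMap _ (hU.preimage (contMDiff_coordMap hX).continuous)
  · exact (consEquiv s).toHomeomorph.isOpenMap _ hC
  · rintro c hc _ ⟨v, hv, rfl⟩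
    exact ⟨c • v, hcone c hc v hv, map_smul _ _ _⟩
  · rintro _ ⟨p, hp, rfl⟩ _ ⟨v, hv, rfl⟩
    exact ⟨p + v, hadd p hp v hv, map_add _ _ _⟩

/-- A set with an invariant direction `X 0` and a monotone direction `X 1` is a Lipschitz domain. -/
theorem IsFrame.exists_isLipschitzDomain_of_invariant_zero (hX : IsFrame s X)
    (hb : LinearIndependent ℝ (fun i : Fin (s + 1) => X i.val)) (hs : 0 < s)
    (hE : MeasurableSet E) (h0 : IsInvariantDirection μ E (X 0))
    (h1 : IsMonotoneDirection μ E (X 1)) :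
    ∃ U, IsLipschitzDomain (s + 1) U ∧ U =ᵐ[μ] E := by
  have : IsTopologicalGroup G := topologicalGroup_of_lieGroup (𝓡 (s + 1)) ∞
  have : LocallyCompactSpace G := Manifold.locallyCompact_of_finiteDimensional (𝓡 (s + 1))
  have : μ.IsMulRightInvariant := hX.isMulRightInvariant hb μ
  set T : Set (Fin s → ℝ) := {y | IsMonotoneDirection μ E (hvec X y)} with hT
  have hadd : ∀ y ∈ T, ∀ z ∈ T, y + z ∈ T := by
    intro y hy z hz
    simp only [hT, mem_ofPred_eq, hvec_add]
    exact IsMonotoneDirection.add hy hz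
  have hsmul : ∀ c : ℝ, 0 ≤ c → ∀ y ∈ T, c • y ∈ T := by
    intro c hc y hy
    simp only [hT, mem_ofPred_eq, hvec_smul]
    exact IsMonotoneDirection.smul hy hc
  have hpow : ∀ t, powVec s t ∈ T := by
    intro t
    simp only [hT, mem_ofPred_eq, ← hX.Ad_oneParam_one hs]
    exact IsMonotoneDirection.Ad_oneParam h0 h1 t
  have hshift : ∀ x, ∀ y ∈ T, (shiftExp s x).mulVec y ∈ T := by
    intro x y hy
    simp only [hT, mem_ofPred_eq, ← hX.Ad_hvec]
    exact IsMonotoneDirection.Ad_oneParam h0 hy x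
  obtain ⟨y₀, hy₀⟩ := interior_nonempty_of_powVec_mem
    (by simpa using hsmul 0 le_rfl _ (hpow 0)) hadd hsmul hpow
  have hcontS := (hX.contMDiff_coordEquiv_symm hb).continuous
  have hray : ∀ r, 0 < r → oneParam (hvec X y₀) r ∈
      {g | ((hX.coordEquiv hb).symm g).2 ∈ interior T} := by
    intro r hr
    have h2 : oneParam (hvec X y₀) r = coordMap X (0, r • y₀) := by
      simp [coordMap, nu_smul]
    simp only [mem_ofPred_eq, h2, hX.symm_coordMap]
    exact smul_mem_interior hsmul hr hy₀
  have hmem : ∀ q ∈ {g | ((hX.coordEquiv hb).symm g).2 ∈ interior T},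
      ∀ᵐ p ∂μ, p ∈ E → p * q ∈ E := by
    intro q hq
    refine ae_imp_mul_mem_of_mem_growthMonoid (n := s + 1) hE ?_
    rw [← hX.coordMap_symm hb q]
    exact mul_mem ((isMonotoneDirection_iff _).1 (interior_subset hq) 1 zero_le_one)
      (h0.oneParam_mem _)
  obtain ⟨U, hU, hUE, hUC⟩ := exists_isOpen_ae_eq_of_monotone μ hE
    (isOpen_interior.preimage (continuous_snd.comp hcontS)) (continuous_oneParam _)
    (oneParam_add _) hray hmem
  refine ⟨U, hX.isLipschitzDomain hb hU (C := univ ×ˢ interior T)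
    (isOpen_univ.prod isOpen_interior) ⟨(0, y₀), mem_univ _, hy₀⟩ ?_ ?_, hUE⟩
  · rintro c hc v ⟨-, hv⟩
    exact ⟨mem_univ _, smul_mem_interior hsmul hc hv⟩
  · rintro p hp v ⟨-, hv⟩
    -- Translation by `v` at `p` is a right multiplication twisted by `shiftExp s (-p.1)`; the twist
    -- preserves `interior T`.
    have h2 := hUC _ hp (coordMap X (v.1, (shiftExp s (-p.1)).mulVec v.2)) (by
      rw [mem_preimage, Function.comp_apply, hX.symm_coordMap]
      exact shiftExp_mulVec_mem_interior hshift _ hv)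
    have h3 := shiftExp_neg_mulVec s (-p.1) v.2
    rw [neg_neg] at h3
    rwa [hX.coordMap_mul, h3] at h2

end Cases

/-! ### The case where `X 1` is invariant. -/

section HalfSpaces

lemma hasDerivAt_shiftExp_zero {s : ℕ} (i j : Fin s) :
    HasDerivAt (fun x => shiftExp s x i j) (if i.val = j.val + 1 then 1 else 0) 0 := by
  simp only [shiftExp, Matrix.of_apply]
  by_cases h : j ≤ i
  · have h' : j.val ≤ i.val := h
    simp only [h, if_true]
    refine ((hasDerivAt_pow (i.val - j.val) (0 : ℝ)).div_const _).congr_deriv ?_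
    split_ifs with h1
    · have : i.val - j.val = 1 := by omega
      simp [this]
    · by_cases h2 : i.val = j.val
      · simp [h2]
      · have : i.val - j.val - 1 ≠ 0 := by omega
        simp [this]
  · have h' : ¬ j.val ≤ i.val := h
    have h1 : ¬ i.val = j.val + 1 := by omega
    simp only [h, h1, if_false]
    exact hasDerivAt_const _ _

/-- The infinitesimal action of the shift on a basis vector. -/
lemma tendsto_shiftExp_slope {s : ℕ} {k : ℕ} (hk : k + 1 < s) (a : ℝ) :
    Tendsto (fun r : ℝ =>
      (shiftExp s (-r)).mulVec (Pi.single (⟨k, by omega⟩ : Fin s) (-a / r)) +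
        Pi.single (⟨k, by omega⟩ : Fin s) (a / r)) (𝓝[>] 0)
      (𝓝 (Pi.single (⟨k + 1, hk⟩ : Fin s) a)) := by
  rw [tendsto_pi_nhds]
  intro i
  set j : Fin s := ⟨k, by omega⟩ with hj
  have h1 : HasDerivAt (fun r => shiftExp s (-r) i j)
      (-(if i.val = j.val + 1 then 1 else 0)) 0 := by
    have h2 : HasDerivAt (fun x => shiftExp s x i j) (if i.val = j.val + 1 then 1 else 0)
        (-(0 : ℝ)) := by
      rw [neg_zero]; exact hasDerivAt_shiftExp_zero i j
    exact (h2.comp (0 : ℝ) (hasDerivAt_neg (0 : ℝ))).congr_deriv (by ring)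
  have h3 := (hasDerivWithinAt_iff_tendsto_slope' (s := Ioi 0) (by simp)).1
    h1.hasDerivWithinAt
  have h4 := h3.const_mul (-a)
  refine (h4.congr' ?_).trans_eq ?_
  · filter_upwards [self_mem_nhdsWithin] with r hr
    have hr0 : r ≠ 0 := ne_of_gt hr
    rw [Pi.add_apply, Matrix.mulVec_single, slope_def_field, neg_zero, shiftExp_zero]
    simp only [Matrix.col_apply, Pi.smul_apply, MulOpposite.smul_eq_mul_unop,
      MulOpposite.unop_op, Matrix.one_apply, Pi.single_apply]
    split_ifs <;> field_simp <;> ring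
  · congr 1
    simp only [Pi.single_apply, Fin.ext_iff, hj]
    split_ifs <;> simp

variable {s : ℕ} {G : Type*} [TopologicalSpace G]
  [ChartedSpace (EuclideanSpace ℝ (Fin (s + 1))) G]
  [Group G] [LieGroup (𝓡 (s + 1)) ∞ G] [T2Space G] [SecondCountableTopology G]
  {X : ℕ → GroupLieAlgebra (𝓡 (s + 1)) G}
  [MeasurableSpace G] [BorelSpace G] {μ : Measure G} [μ.IsHaarMeasure] {E : Set G}

omit [SecondCountableTopology G] [MeasurableSpace G] [BorelSpace G] in
lemma IsFrame.oneParam_mul_nu (hX : IsFrame s X) (r : ℝ) (y z : Fin s → ℝ) :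
    nu X y * oneParam (X 0) r * nu X z =
      oneParam (X 0) r * nu X ((shiftExp s (-r)).mulVec y + z) := by
  rw [hX.nu_add, ← hX.conj_nu, oneParam_neg]
  group

omit [SecondCountableTopology G] [MeasurableSpace G] [BorelSpace G] in
lemma continuous_nu (hX : IsFrame s X) : Continuous (nu (s := s) X) :=
  (contMDiff_nu hX (J := 𝓘(ℝ, Fin s → ℝ)) (y := id) fun j =>
    ContDiff.contMDiff (contDiff_apply ℝ ℝ j)).continuous

/-- Induction on `k`: the product `exp (-(a/r) X_{k+1}) exp (r X₀) exp ((a/r) X_{k+1})` lies in the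
monoid for `r > 0` and tends to `exp (a X_{k+2})` as `r → 0+`. Only positive times of `X₀` are used,
yet `a` may have either sign; closedness gives the limit. -/
lemma IsFrame.nu_single_mem (hX : IsFrame s X) (h1 : IsInvariantDirection μ E (X 1))
    (h0 : IsMonotoneDirection μ E (X 0)) (k : ℕ) (hk : k < s) (a : ℝ) :
    nu X (Pi.single (⟨k, hk⟩ : Fin s) a) ∈ growthMonoid (s + 1) μ E := by
  induction k generalizing a with
  | zero =>
    have h2 : nu X (Pi.single (⟨0, hk⟩ : Fin s) a) = oneParam (X 1) a := by
      have : hvec X (Pi.single (⟨0, hk⟩ : Fin s) a) = a • X 1 := by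
        rw [hvec, Finset.sum_eq_single (⟨0, hk⟩ : Fin s)]
        · simp
        · intro j _ hj; simp [hj]
        · simp
      rw [nu, this, oneParam_smul, mul_one]
    rw [h2]
    exact h1.oneParam_mem a
  | succ k ih =>
    have hk' : k < s := by omega
    have hγ : Tendsto (fun r => oneParam (X 0) r) (𝓝[>] 0) (𝓝 1) := by
      have := (continuous_oneParam (X 0)).tendsto 0
      rw [oneParam_zero] at this
      exact this.mono_left nhdsWithin_le_nhds
    have : IsTopologicalGroup G := topologicalGroup_of_lieGroup (𝓡 (s + 1)) ∞
    have h2 := hγ.mul (((continuous_nu hX).tendsto _).comp (tendsto_shiftExp_slope hk a))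
    rw [one_mul] at h2
    refine (isClosed_growthMonoid μ E).mem_of_tendsto h2 ?_
    filter_upwards [self_mem_nhdsWithin] with r hr
    rw [Function.comp_apply, ← hX.oneParam_mul_nu]
    exact mul_mem (mul_mem (ih hk' _)
      ((isMonotoneDirection_iff _).1 h0 r (le_of_lt hr))) (ih hk' _)

lemma IsFrame.nu_mem (hX : IsFrame s X) (h1 : IsInvariantDirection μ E (X 1))
    (h0 : IsMonotoneDirection μ E (X 0)) (y : Fin s → ℝ) :
    nu X y ∈ growthMonoid (s + 1) μ E := by
  have h : ∀ S : Finset (Fin s), nu X (∑ j ∈ S, Pi.single j (y j)) ∈ growthMonoid (s + 1) μ E := by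
    intro S
    induction S using Finset.induction_on with
    | empty =>
      rw [Finset.sum_empty, nu_zero]
      exact one_mem _
    | insert a S ha ih =>
      rw [Finset.sum_insert ha, hX.nu_add]
      exact mul_mem (hX.nu_single_mem h1 h0 a.val a.isLt (y a)) ih
  have h2 := h Finset.univ
  rwa [Finset.univ_sum_single] at h2

variable [SimplyConnectedSpace G]

/-- If `X 1` is an invariant and `X 0` a monotone direction, the set agrees almost everywhere with
an open set that is determined by an open upper set of values of the first coordinate. -/
lemma IsFrame.exists_isOpen_ae_eq_of_invariant_one (hX : IsFrame s X)
    (hb : LinearIndependent ℝ (fun i : Fin (s + 1) => X i.val))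
    (hE : MeasurableSet E) (h1 : IsInvariantDirection μ E (X 1))
    (h0 : IsMonotoneDirection μ E (X 0)) :
    ∃ U, IsOpen U ∧ U =ᵐ[μ] E ∧ ∀ p q : ℝ × (Fin s → ℝ), coordMap X p ∈ U →
      p.1 < q.1 → coordMap X q ∈ U := by
  have : IsTopologicalGroup G := topologicalGroup_of_lieGroup (𝓡 (s + 1)) ∞
  have : LocallyCompactSpace G := Manifold.locallyCompact_of_finiteDimensional (𝓡 (s + 1))
  have : μ.IsMulRightInvariant := hX.isMulRightInvariant hb μ
  have hray : ∀ r, 0 < r → oneParam (X 0) r ∈ {g | 0 < ((hX.coordEquiv hb).symm g).1} := by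
    intro r hr
    have h2 : oneParam (X 0) r = coordMap (s := s) X (r, 0) := by simp [coordMap, nu_zero]
    simpa only [mem_ofPred_eq, h2, hX.symm_coordMap] using hr
  have hmem : ∀ q ∈ {g | 0 < ((hX.coordEquiv hb).symm g).1}, ∀ᵐ p ∂μ, p ∈ E → p * q ∈ E := by
    intro q hq
    refine ae_imp_mul_mem_of_mem_growthMonoid (n := s + 1) hE ?_
    rw [← hX.coordMap_symm hb q]
    exact mul_mem (hX.nu_mem h1 h0 _) ((isMonotoneDirection_iff _).1 h0 _ (le_of_lt hq))
  obtain ⟨U, hU, hUE, hUC⟩ := exists_isOpen_ae_eq_of_monotone μ hE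
    (isOpen_lt continuous_const
      (continuous_fst.comp (hX.contMDiff_coordEquiv_symm hb).continuous))
    (continuous_oneParam _) (oneParam_add _) hray hmem
  refine ⟨U, hU, hUE, fun p q hp hpq => ?_⟩
  have h2 := hUC _ hp (coordMap X (q.1 - p.1, (shiftExp s (-p.1)).mulVec (q.2 - p.2))) (by
    rw [mem_ofPred_eq, Function.comp_apply, hX.symm_coordMap]
    exact sub_pos.2 hpq)
  have h3 := shiftExp_neg_mulVec s (-p.1) (q.2 - p.2)
  rw [neg_neg] at h3
  rw [hX.coordMap_mul, h3] at h2
  simpa using h2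

/-- A set with an invariant direction `X 1` and a monotone direction `X 0` is a Lipschitz domain. -/
theorem IsFrame.exists_isLipschitzDomain_of_invariant_one (hX : IsFrame s X)
    (hb : LinearIndependent ℝ (fun i : Fin (s + 1) => X i.val))
    (hE : MeasurableSet E) (h1 : IsInvariantDirection μ E (X 1))
    (h0 : IsMonotoneDirection μ E (X 0)) :
    ∃ U, IsLipschitzDomain (s + 1) U ∧ U =ᵐ[μ] E := by
  obtain ⟨U, hU, hUE, hUp⟩ := hX.exists_isOpen_ae_eq_of_invariant_one hb hE h1 h0
  refine ⟨U, hX.isLipschitzDomain hb hU (C := Ioi 0 ×ˢ univ) (isOpen_Ioi.prod isOpen_univ)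
    ⟨(1, 0), one_pos, mem_univ _⟩ ?_ ?_, hUE⟩
  · rintro c hc v ⟨hv, -⟩
    exact ⟨mul_pos hc hv, mem_univ _⟩
  · rintro p hp v ⟨hv, -⟩
    exact hUp p _ hp (lt_add_of_pos_right p.1 hv)

/-- A set with an invariant direction `X 1` and a monotone direction `X 0` is a half-space. -/
theorem IsFrame.exists_halfSpace_of_invariant_one (hX : IsFrame s X)
    (hb : LinearIndependent ℝ (fun i : Fin (s + 1) => X i.val))
    (hE : MeasurableSet E) (h1 : IsInvariantDirection μ E (X 1))
    (h0 : IsMonotoneDirection μ E (X 0)) :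
    ∃ H : Set G, (H = ∅ ∨ H = univ ∨ IsVerticalHalfSpace H) ∧ H =ᵐ[μ] E := by
  obtain ⟨U, hU, hUE, hUp⟩ := hX.exists_isOpen_ae_eq_of_invariant_one hb hE h1 h0
  refine ⟨U, ?_, hUE⟩
  have hc : Continuous (coordMap (s := s) X) := (contMDiff_coordMap hX).continuous
  let A : Set ℝ := {x | coordMap (s := s) X (x, 0) ∈ U}
  have hUA : ∀ g, g ∈ U ↔ ((hX.coordEquiv hb).symm g).1 ∈ A := by
    -- `hUp` needs a strict increase of the first coordinate; openness of `U` allows starting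
    -- slightly to the left of `p`.
    have key : ∀ p q : ℝ × (Fin s → ℝ), p.1 = q.1 → coordMap X p ∈ U → coordMap X q ∈ U := by
      intro p q hpq hp
      have h2 : ∀ᶠ r : ℝ in 𝓝[<] 0, coordMap X (p.1 + r, p.2) ∈ U := by
        have h3 : Continuous (fun r : ℝ => coordMap X (p.1 + r, p.2)) := hc.comp (by fun_prop)
        exact (h3.tendsto 0).mono_left nhdsWithin_le_nhds |>.eventually
          (hU.mem_nhds (by simpa using hp))
      obtain ⟨r, hr, hr0⟩ := (h2.and self_mem_nhdsWithin).exists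
      exact hUp _ q hr (by rw [← hpq]; exact add_lt_of_neg_right _ hr0)
    intro g
    constructor
    · intro hg
      exact key ((hX.coordEquiv hb).symm g) _ rfl (by rwa [hX.coordMap_symm])
    · intro hg
      have := key (((hX.coordEquiv hb).symm g).1, 0) ((hX.coordEquiv hb).symm g) rfl hg
      rwa [hX.coordMap_symm] at this
  rcases A.eq_empty_or_nonempty with hA | hA
  · left
    ext g
    simp [hUA, hA]
  right
  have hup : ∀ t ∈ A, ∀ t', t < t' → t' ∈ A := fun t ht t' h => hUp _ _ ht h
  by_cases hbdd : BddBelow A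
  · right
    have hAo : IsOpen A := hU.preimage (hc.comp (by fun_prop))
    refine ⟨fun g => ((hX.coordEquiv hb).symm g).1, sInf A,
      continuous_fst.comp (hX.contMDiff_coordEquiv_symm hb).continuous, fun g h => ?_,
      ⟨coordMap X (1, 0), by
        change ((hX.coordEquiv hb).symm (coordMap X (1, 0))).1 ≠ 0
        rw [hX.symm_coordMap]
        exact one_ne_zero⟩, ?_⟩
    · have h2 := hX.coordMap_mul ((hX.coordEquiv hb).symm g) ((hX.coordEquiv hb).symm h)
      rw [hX.coordMap_symm, hX.coordMap_symm] at h2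
      change ((hX.coordEquiv hb).symm (g * h)).1 = _
      rw [h2, hX.symm_coordMap]
    · ext g
      rw [hUA, eq_Ioi_sInf hAo hA hbdd hup, csInf_Ioi]
      rfl
  · left
    rw [eq_univ_iff_forall]
    intro g
    rw [hUA]
    rw [not_bddBelow_iff] at hbdd
    obtain ⟨t, ht, hlt⟩ := hbdd ((hX.coordEquiv hb).symm g).1
    exact hup t ht _ hlt

end HalfSpaces

/-! ### Changes of first-kind basis and adaptation to the normal. -/

section Bases

variable {n s : ℕ} {G : Type*} [TopologicalSpace G] [ChartedSpace (EuclideanSpace ℝ (Fin n)) G]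
  [Group G]

/-- A finite basis extended by zero to a sequence. -/
noncomputable def frameOf (b : Module.Basis (Fin (s + 1)) ℝ (GroupLieAlgebra (𝓡 n) G)) (j : ℕ) :
    GroupLieAlgebra (𝓡 n) G :=
  if h : j < s + 1 then b ⟨j, h⟩ else 0

lemma frameOf_val (b : Module.Basis (Fin (s + 1)) ℝ (GroupLieAlgebra (𝓡 n) G))
    (i : Fin (s + 1)) : frameOf b i.val = b i := dif_pos i.isLt

lemma frameOf_zero (b : Module.Basis (Fin (s + 1)) ℝ (GroupLieAlgebra (𝓡 n) G)) :
    frameOf b 0 = b 0 := frameOf_val b 0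

lemma val_one_of_pos (hs : 1 ≤ s) : (1 : Fin (s + 1)).val = 1 := by
  rw [Fin.val_one', Nat.mod_eq_of_lt (by omega)]

lemma frameOf_one (hs : 1 ≤ s) (b : Module.Basis (Fin (s + 1)) ℝ (GroupLieAlgebra (𝓡 n) G)) :
    frameOf b 1 = b 1 := by
  rw [← frameOf_val b 1, val_one_of_pos hs]

variable {V : ℕ → Submodule ℝ (GroupLieAlgebra (𝓡 n) G)}
  {b : Module.Basis (Fin (s + 1)) ℝ (GroupLieAlgebra (𝓡 n) G)}

variable [LieGroup (𝓡 n) ∞ G]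

lemma IsFirstKindBasis.isFrame (hs : 1 ≤ s) (hb : IsFirstKindBasis s V b) :
    IsFrame s (frameOf b) := by
  have : LieGroup (𝓡 n) (minSmoothness ℝ 3) G := LieGroup.of_le (n := ∞) (by simp; norm_cast)
  have hz : ∀ j, s < j → frameOf b j = 0 := fun j hj => dif_neg (by omega)
  refine ⟨fun j hj => ?_, fun i j hi hj => ?_, hz⟩
  · rw [frameOf_zero]
    rcases lt_trichotomy j s with h | rfl | h
    · have h1 := hb.bracket_zero ⟨j, by omega⟩ ⟨j + 1, by omega⟩ hj rfl
      rwa [← frameOf_val b ⟨j, _⟩, ← frameOf_val b ⟨j + 1, _⟩] at h1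
    · rw [hz _ (Nat.lt_succ_self _)]
      have h1 := hb.bracket_zero_last
      rwa [← frameOf_val b (Fin.last j)] at h1
    · rw [hz _ h, hz _ (by omega), lie_zero]
  · by_cases h1 : s < i
    · rw [hz i h1, zero_lie]
    by_cases h2 : s < j
    · rw [hz j h2, lie_zero]
    have h3 := hb.bracket_eq_zero ⟨i, by omega⟩ ⟨j, by omega⟩ hi hj
    rwa [← frameOf_val b ⟨i, _⟩, ← frameOf_val b ⟨j, _⟩] at h3

/-- The changes of first-kind basis. -/
lemma IsFirstKindBasis.exists_change (hs : 1 ≤ s) (hb : IsFirstKindBasis s V b) {α δ : ℝ}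
    (hα : α ≠ 0) (hδ : δ ≠ 0) (β : ℝ) :
    ∃ b' : Module.Basis (Fin (s + 1)) ℝ (GroupLieAlgebra (𝓡 n) G), IsFirstKindBasis s V b' ∧
      b' 0 = α • b 0 + β • b 1 ∧ b' 1 = δ • b 1 := by
  have : LieGroup (𝓡 n) (minSmoothness ℝ 3) G := LieGroup.of_le (n := ∞) (by simp; norm_cast)
  -- Each bracket with `α X₀ + β X₁` multiplies by `α`, the `X₁` part acting trivially; this
  -- dictates the powers of `α`.
  let v : Fin (s + 1) → GroupLieAlgebra (𝓡 n) G :=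
    Fin.cons (α • b 0 + β • b 1) (fun j : Fin s => (α ^ j.val * δ) • b j.succ)
  have h1s : (1 : Fin (s + 1)) = (⟨0, hs⟩ : Fin s).succ := Fin.ext (val_one_of_pos hs)
  have hv0 : v 0 = α • b 0 + β • b 1 := rfl
  have hvs : ∀ j : Fin s, v j.succ = (α ^ j.val * δ) • b j.succ := fun j => rfl
  have hv1 : v 1 = δ • b 1 := by
    rw [h1s, hvs]
    simp
  have hsucc : ∀ j : Fin s, b j.succ ∈ Submodule.span ℝ (range v) := by
    intro j
    have h1 : b j.succ = (α ^ j.val * δ)⁻¹ • v j.succ := by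
      rw [hvs, smul_smul, inv_mul_cancel₀ (mul_ne_zero (pow_ne_zero _ hα) hδ), one_smul]
    rw [h1]
    exact Submodule.smul_mem _ _ (Submodule.subset_span (mem_range_self _))
  have hspan : ⊤ ≤ Submodule.span ℝ (range v) := by
    rw [← b.span_eq, Submodule.span_le]
    rintro _ ⟨i, rfl⟩
    refine Fin.cases ?_ hsucc i
    have h1 : b 0 = α⁻¹ • (v 0 - β • b 1) := by
      rw [hv0, add_sub_cancel_right, smul_smul, inv_mul_cancel₀ hα, one_smul]
    rw [SetLike.mem_coe, h1]
    refine Submodule.smul_mem _ _ (Submodule.sub_mem _ (Submodule.subset_span (mem_range_self _))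
      (Submodule.smul_mem _ _ ?_))
    rw [h1s]
    exact hsucc _
  have hcard : Fintype.card (Fin (s + 1)) = Module.finrank ℝ (GroupLieAlgebra (𝓡 n) G) :=
    (Module.finrank_eq_card_basis b).symm
  let b' := basisOfTopLeSpanOfCardEqFinrank v hspan hcard
  have hb' : ∀ i, b' i = v i := fun i =>
    congrFun (coe_basisOfTopLeSpanOfCardEqFinrank v hspan hcard) i
  have hb1 : ∀ j : Fin s, (⁅b 1, b j.succ⁆ : GroupLieAlgebra (𝓡 n) G) = 0 := fun j =>
    hb.bracket_eq_zero _ _ (val_one_of_pos hs).ge (by simp)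
  refine ⟨b', ⟨?_, ?_, ?_, ?_, ?_⟩, by rw [hb', hv0], by rw [hb', hv1]⟩
  · rw [hb', hv0]
    have h1 := hb.mem 1 (val_one_of_pos hs).ge
    rw [val_one_of_pos hs] at h1
    exact Submodule.add_mem _ (Submodule.smul_mem _ _ hb.mem_zero) (Submodule.smul_mem _ _ h1)
  · intro j hj
    obtain ⟨k, rfl⟩ := Fin.exists_succ_eq.2 (show j ≠ 0 by rintro rfl; simp at hj)
    rw [hb', hvs]
    exact Submodule.smul_mem _ _ (hb.mem _ hj)
  · intro i j hi hij
    obtain ⟨k, rfl⟩ := Fin.exists_succ_eq.2 (show i ≠ 0 by rintro rfl; simp at hi)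
    obtain ⟨l, rfl⟩ := Fin.exists_succ_eq.2 (show j ≠ 0 by rintro rfl; simp at hij)
    have hkl : l.val = k.val + 1 := by simpa using hij
    rw [hb', hb', hb', hv0, hvs, hvs, add_lie, smul_lie, smul_lie, lie_smul, lie_smul, hb1,
      hb.bracket_zero _ _ hi hij, smul_zero, smul_zero, add_zero, smul_smul, hkl, pow_succ]
    congr 1
    ring
  · have h1 : Fin.last s = (⟨s - 1, by omega⟩ : Fin s).succ := by
      ext
      simp
      omega
    rw [hb', hb', hv0, h1, hvs, add_lie, smul_lie, smul_lie, lie_smul, lie_smul, hb1, ← h1,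
      hb.bracket_zero_last]
    simp
  · intro i j hi hj
    obtain ⟨k, rfl⟩ := Fin.exists_succ_eq.2 (show i ≠ 0 by rintro rfl; simp at hi)
    obtain ⟨l, rfl⟩ := Fin.exists_succ_eq.2 (show j ≠ 0 by rintro rfl; simp at hj)
    rw [hb', hb', hvs, hvs, smul_lie, lie_smul, hb.bracket_eq_zero _ _ hi hj]
    simp

omit [LieGroup (𝓡 n) ∞ G] in
lemma IsFirstKindBasis.mem_one (hs : 1 ≤ s) (hb : IsFirstKindBasis s V b) : b 1 ∈ V 1 := by
  have h1 := hb.mem 1 (val_one_of_pos hs).ge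
  rwa [val_one_of_pos hs] at h1

omit [LieGroup (𝓡 n) ∞ G] in
lemma IsFirstKindBasis.exists_eq_of_mem (hs : 1 ≤ s) (hb : IsFirstKindBasis s V b)
    (hV : Module.finrank ℝ (V 1) = 2) {Y : GroupLieAlgebra (𝓡 n) G} (hY : Y ∈ V 1) :
    ∃ α β : ℝ, Y = α • b 0 + β • b 1 := by
  have hfin : Module.Finite ℝ (GroupLieAlgebra (𝓡 n) G) := Module.Finite.of_basis b
  have h01 : (0 : Fin (s + 1)) ≠ 1 := by
    intro h
    have := congrArg Fin.val h
    rw [val_one_of_pos hs] at this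
    simp at this
  have hli : LinearIndependent ℝ ![b 0, b 1] := by
    have h1 : ![b 0, b 1] = b ∘ ![0, 1] := by
      ext i
      fin_cases i <;> rfl
    rw [h1]
    refine b.linearIndependent.comp _ ?_
    intro i j hij
    fin_cases i <;> fin_cases j <;> simp_all
  have hle : Submodule.span ℝ (range ![b 0, b 1]) ≤ V 1 := by
    rw [Submodule.span_le]
    rintro _ ⟨i, rfl⟩
    fin_cases i
    · exact hb.mem_zero
    · exact hb.mem_one hs
  have heq : Submodule.span ℝ (range ![b 0, b 1]) = V 1 :=
    Submodule.eq_of_le_of_finrank_eq hle (by rw [finrank_span_eq_card hli, hV]; rfl)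
  rw [← heq, Matrix.range_cons, Matrix.range_cons, Matrix.range_empty, union_empty,
    singleton_union, Submodule.mem_span_pair] at hY
  obtain ⟨α, β, h⟩ := hY
  exact ⟨α, β, h.symm⟩

variable [MeasurableSpace G] [BorelSpace G] {μ : Measure G} [IsFiniteMeasureOnCompacts μ] {E : Set G}

/-- A set of constant horizontal normal is adapted to some first-kind basis. -/
lemma IsFirstKindBasis.exists_adapted (hs : 1 ≤ s) (hb : IsFirstKindBasis s V b)
    (hV : Module.finrank ℝ (V 1) = 2) {B : LinearMap.BilinForm ℝ (V 1)}
    (hB : ∀ v, v ≠ 0 → 0 < B v v) {N : V 1} (hE : HasConstantHorizontalNormal μ (V 1) B E N) :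
    ∃ X : Module.Basis (Fin (s + 1)) ℝ (GroupLieAlgebra (𝓡 n) G), IsFirstKindBasis s V X ∧
      ((IsInvariantDirection μ E (X 0) ∧ IsMonotoneDirection μ E (X 1)) ∨
        (IsInvariantDirection μ E (X 1) ∧ IsMonotoneDirection μ E (X 0))) := by
  obtain ⟨hN, hinv⟩ := hE
  set u : V 1 := ⟨b 0, hb.mem_zero⟩ with hu
  set w : V 1 := ⟨b 1, hb.mem_one hs⟩ with hw
  by_cases hN0 : N = 0
  · refine ⟨b, hb, Or.inl ⟨hinv u (by simp [hN0]), ?_⟩⟩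
    exact (hinv w (by simp [hN0])).isMonotoneDirection
  obtain ⟨γ, δ, hγδ⟩ := hb.exists_eq_of_mem hs hV N.2
  have hNuw : N = γ • u + δ • w := Subtype.ext hγδ
  -- These coefficients make `α u + β w` orthogonal to `N`, and `α δ - β γ` equal to `B N N`.
  set α := B N w with hα
  set β := -B N u with hβ
  have hpos : 0 < α * δ - β * γ := by
    have h1 := hB N hN0
    have h2 : B N N = γ * B N u + δ * B N w := by
      conv_lhs => rw [hNuw, map_add (B (γ • u + δ • w)), ← hNuw, map_smul, map_smul]
      rfl
    rw [h2] at h1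
    linarith
  have hYinv : IsInvariantDirection μ E (α • b 0 + β • b 1) :=
    hinv (α • u + β • w) (by
      rw [map_add, map_smul, map_smul, smul_eq_mul, smul_eq_mul, hβ, ← hα]
      ring)
  -- If `α = 0` the invariant line is spanned by `b 1`, and `N` itself serves as the new `X 0`.
  -- Otherwise `α u + β w` is the new `X 0`, and subtracting a multiple of it from `N` leaves a
  -- monotone multiple of `b 1`.
  by_cases hα0 : α = 0
  · rw [hα0, zero_mul, zero_sub] at hpos
    have hγ0 : γ ≠ 0 := by rintro rfl; simp at hpos
    have hβ0 : β ≠ 0 := by intro h; simp [h] at hpos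
    obtain ⟨X, hX, hX0, hX1⟩ := hb.exists_change hs hγ0 one_ne_zero δ
    refine ⟨X, hX, Or.inr ⟨?_, ?_⟩⟩
    · have h1 := hYinv.smul β⁻¹
      rwa [hα0, zero_smul, zero_add, smul_smul, inv_mul_cancel₀ hβ0, ← hX1] at h1
    · rw [hX0, ← hγδ]
      exact hN
  · have hδ' : δ - γ / α * β ≠ 0 := by
      intro h
      field_simp at h
      linarith
    obtain ⟨X, hX, hX0, hX1⟩ := hb.exists_change hs hα0 hδ' β
    refine ⟨X, hX, Or.inl ⟨by rwa [hX0], ?_⟩⟩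
    have h1 := hN.add (hYinv.smul (-(γ / α))).isMonotoneDirection
    have h2 : (N : GroupLieAlgebra (𝓡 n) G) + (-(γ / α)) • (α • b 0 + β • b 1) = X 1 := by
      rw [hX1, hγδ, smul_add, smul_smul, smul_smul, neg_mul, div_mul_cancel₀ _ hα0]
      module
    rwa [h2] at h1

end Bases

end Filiform

/-! ### Assembly of the main theorem. -/

theorem mainTheorem7 {n s : ℕ} (hs : 1 ≤ s)
    {G : Type*} [TopologicalSpace G] [T2Space G] [SecondCountableTopology G]
    [ChartedSpace (EuclideanSpace ℝ (Fin n)) G] [Group G] [LieGroup (𝓡 n) ∞ G]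
    [SimplyConnectedSpace G]
    [MeasurableSpace G] [BorelSpace G] (μ : Measure G) [μ.IsHaarMeasure]
    (V : ℕ → Submodule ℝ (GroupLieAlgebra (𝓡 n) G))
    (hV : Filiform.IsFiliformOfFirstKind s V)
    (B : LinearMap.BilinForm ℝ (V 1)) (hBsymm : B.IsSymm) (hBpos : ∀ v, v ≠ 0 → 0 < B v v)
    (E : Set G) (hEmeas : NullMeasurableSet E μ)
    (N : V 1) (hE : Filiform.HasConstantHorizontalNormal μ (V 1) B E N) :
    -- `E` is equivalent to a Lipschitz domain
    (∃ F : Set G, Filiform.IsLipschitzDomain n F ∧ Filiform.Equivalent μ E F) ∧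
    -- for a suitable basis one of the two cases occurs
    (∃ X : Module.Basis (Fin (s + 1)) ℝ (GroupLieAlgebra (𝓡 n) G),
      Filiform.IsFirstKindBasis s V X ∧
        ((Filiform.IsInvariantDirection μ E (X 0) ∧ Filiform.IsMonotoneDirection μ E (X 1)) ∨
          (Filiform.IsInvariantDirection μ E (X 1) ∧ Filiform.IsMonotoneDirection μ E (X 0)))) ∧
    -- and for every such basis the following holds
    (∀ X : Module.Basis (Fin (s + 1)) ℝ (GroupLieAlgebra (𝓡 n) G),
      Filiform.IsFirstKindBasis s V X →
        -- first case: a basis of monotone directions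
        (Filiform.IsInvariantDirection μ E (X 0) → Filiform.IsMonotoneDirection μ E (X 1) →
          ∀ t : Fin s → ℝ, Function.Injective t →
            (∀ j, Filiform.IsMonotoneDirection μ E
              (Filiform.Ad (Filiform.lieExp (t j • X 0)) (X 1))) ∧
            LinearIndependent ℝ (Fin.cons (X 0)
              (fun j => Filiform.Ad (Filiform.lieExp (t j • X 0)) (X 1)) :
                Fin (s + 1) → GroupLieAlgebra (𝓡 n) G) ∧
            Submodule.span ℝ (Set.range (Fin.cons (X 0)
              (fun j => Filiform.Ad (Filiform.lieExp (t j • X 0)) (X 1)) :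
                Fin (s + 1) → GroupLieAlgebra (𝓡 n) G)) = ⊤) ∧
        -- second case: a half-space
        (Filiform.IsInvariantDirection μ E (X 1) → Filiform.IsMonotoneDirection μ E (X 0) →
          ∃ H : Set G, (H = ∅ ∨ H = Set.univ ∨ Filiform.IsVerticalHalfSpace H) ∧
            Filiform.Equivalent μ E H)) := by
  obtain ⟨hVf, b, hb⟩ := hV
  have hn : n = s + 1 := by
    have h1 : Module.finrank ℝ (GroupLieAlgebra (𝓡 n) G) = n := finrank_euclideanSpace_fin
    rw [← h1, Module.finrank_eq_card_basis b, Fintype.card_fin]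
  subst hn
  -- The Fubini arguments need a genuinely measurable set; monotone and invariant directions do not
  -- change on null sets.
  obtain ⟨E', -, hE'm, hE'⟩ := hEmeas.exists_measurable_superset_ae_eq
  have hli : ∀ X : Module.Basis (Fin (s + 1)) ℝ (GroupLieAlgebra (𝓡 (s + 1)) G),
      LinearIndependent ℝ (fun i : Fin (s + 1) => Filiform.frameOf X i.val) := by
    intro X
    simp only [Filiform.frameOf_val]
    exact X.linearIndependent
  have hequiv : ∀ F : Set G, F =ᵐ[μ] E' → Filiform.Equivalent μ E F := fun F hF =>
    measure_symmDiff_eq_zero_iff.2 (hF.trans hE').symm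
  have hadapt := hb.exists_adapted hs hVf.finrank_one hBpos hE
  refine ⟨?_, hadapt, fun X hX => ⟨fun h0 h1 t ht => ?_, fun h1 h0 => ?_⟩⟩
  · obtain ⟨X, hX, h | h⟩ := hadapt
    · rw [← Filiform.frameOf_zero X, ← Filiform.frameOf_one hs X] at h
      obtain ⟨F, hF, hFE⟩ := (hX.isFrame hs).exists_isLipschitzDomain_of_invariant_zero (hli X) hs
        hE'm (h.1.congr_set hE'.symm) (h.2.congr_set hE'.symm)
      exact ⟨F, hF, hequiv F hFE⟩
    · rw [← Filiform.frameOf_zero X, ← Filiform.frameOf_one hs X] at h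
      obtain ⟨F, hF, hFE⟩ := (hX.isFrame hs).exists_isLipschitzDomain_of_invariant_one (hli X)
        hE'm (h.1.congr_set hE'.symm) (h.2.congr_set hE'.symm)
      exact ⟨F, hF, hequiv F hFE⟩
  · have hexp : ∀ r : ℝ, Filiform.lieExp (r • X 0) = Filiform.oneParam (X 0) r := fun r => by
      rw [Filiform.lieExp_eq_oneParam, Filiform.oneParam_smul, mul_one]
    simp only [hexp]
    have hlin := (hX.isFrame hs).linearIndependent_cons (hli X) hs ht
    rw [Filiform.frameOf_zero, Filiform.frameOf_one hs] at hlin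
    refine ⟨fun j => Filiform.IsMonotoneDirection.Ad_oneParam h0 h1 (t j), hlin, ?_⟩
    exact hlin.span_eq_top_of_card_eq_finrank (Module.finrank_eq_card_basis X).symm
  · rw [← Filiform.frameOf_one hs X] at h1
    rw [← Filiform.frameOf_zero X] at h0
    obtain ⟨H, hH, hHE⟩ := (hX.isFrame hs).exists_halfSpace_of_invariant_one (hli X)
      hE'm (h1.congr_set hE'.symm) (h0.congr_set hE'.symm)
    exact ⟨H, hH, hequiv H hHE⟩
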